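/- Let $k$ be a perfect field (for example, any field of characteristic zero), and let $V$ be a nonsingular variety over $k$: an integral, separated scheme of finite type, smooth over $k$. Let $E_j$, $j\in J$ ($J$ finite), be nonsingular irreducible hypersurfaces of $V$ meeting with normal crossings, i.e. at each point $p\in V$ there is a regular system of parameters of $\mathcal O_{V,p}$ such that the $E_j$ passing through $p$ are cut out at $p$ by distinct members of the system. Let $\emptyset\neq S\subseteq J$, let $B=\bigcap_{j\in S}E_j$ (scheme-theoretic intersection), and let $\pi:W\to V$ be the blowup of $V$ along $B$. Let $F=\pi^{-1}(B)$ be the exceptional divisor and let $F_j$ be the proper transform of $E_j$, i.e. the closure of $\pi^{-1}(E_j\setminus B)$ in $W$ with its reduced structure. For a family $D=(D_i)$ of closed subschemes of an integral $k$-scheme $X$ let $\Omega^1_X(\log\sum D_i)$ denote the sheaf of $\mathcal O_X$-modules whose sections over an open set $U$ are the rational $1$-forms $\omega\in\Omega^1_{K(X)/k}$ that, at each $x\in U$, are $\mathcal O_{X,x}$-linear combinations of the forms $dg$, $g\in\mathcal O_{X,x}$, and $dh/h$, where $h$ is a local equation at $x$ of some $D_i$ (on the empty set there is only the zero section). Then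 $W$ is integral, $\pi$ is dominant, and pullback of rational $1$-forms induces an isomorphism of $\mathcal O_W$-modules $$\pi^*\,\Omega^1_V\Bigl(\log\sum_{j\in J} E_j\Bigr)\;\xrightarrow{\ \sim\ }\;\Omega^1_W\Bigl(\log\bigl(F+\sum_{j\in J} F_j\bigr)\Bigr);$$ that is, there is such an isomorphism whose adjoint $\Omega^1_V(\log\sum E_j)\to\pi_*\Omega^1_W(\log(F+\sum F_j))$ sends each section $\omega$ to the rational form $\pi^*\omega$. -/

import Mathlib

open CategoryTheory AlgebraicGeometry TopologicalSpace

universe u w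

noncomputable section

namespace LogForms

/-! ### Ideal sheaves, effective Cartier divisors and blowups -/

section Blowup

variable {X Y : Scheme.{u}}

/-- The ideal of the local ring `𝒪_{X,x}` generated by a quasi-coherent ideal sheaf `I`,
i.e. the stalk of `I` at `x`. -/
def stalkIdeal (I : X.IdealSheafData) (x : X) : Ideal (X.presheaf.stalk x) :=
  ⨆ (U : X.affineOpens) (hx : x ∈ U.1), (I.ideal U).map (X.presheaf.germ U.1 x hx).hom

/-- The closed subscheme of `I` is an effective Cartier divisor: locally on `X` the ideal sheaf
is generated by one nonzerodivisor. -/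
def IsEffectiveCartier (I : X.IdealSheafData) : Prop :=
  ∀ x : X, ∃ U : X.affineOpens, x ∈ U.1 ∧
    ∃ f ∈ nonZeroDivisors Γ(X, U.1), I.ideal U = Ideal.span {f}

/-- `π : X ⟶ Y` is the blowup of `Y` along the closed subscheme with ideal sheaf `I`: the inverse
image of the center is an effective Cartier divisor, and `π` is universal with this property. -/
structure IsBlowup (π : X ⟶ Y) (I : Y.IdealSheafData) : Prop where
  isEffectiveCartier_comap : IsEffectiveCartier (I.comap π)
  existsUnique_lift : ∀ {T : Scheme.{u}} (g : T ⟶ Y), IsEffectiveCartier (I.comap g) →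
    ∃! h : T ⟶ X, h ≫ π = g

/-- The ideal sheaf of the exceptional divisor of the blowup `π` along `B`. -/
abbrev exceptionalDivisor (π : X ⟶ Y) (B : Y.IdealSheafData) : X.IdealSheafData :=
  B.comap π

/-- The ideal sheaf of the proper transform of `E` under the blowup `π` along `B`: the closure of
`π⁻¹(E ∖ B)`, with its reduced structure. -/
def properTransform (π : X ⟶ Y) (B E : Y.IdealSheafData) : X.IdealSheafData :=
  Scheme.IdealSheafData.vanishingIdeal
    (Closeds.closure (π ⁻¹' ((E.support : Set Y) \ (B.support : Set Y))))

/-- The exceptional divisor together with the proper transforms of a family of hypersurfaces. -/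
def totalFamily (π : X ⟶ Y) (B : Y.IdealSheafData) {J : Type w} (E : J → Y.IdealSheafData) :
    Option J → X.IdealSheafData
  | none => exceptionalDivisor π B
  | some j => properTransform π B (E j)

/-- The closed subschemes `E j` are (nonsingular) hypersurfaces meeting with normal crossings: at
each point `x` there is a regular system of parameters `t` of `𝒪_{X,x}` such that the `E j` through
`x` are cut out at `x` by distinct members of `t`. -/
def HasNormalCrossings {J : Type w} (E : J → X.IdealSheafData) : Prop :=
  ∀ x : X, ∃ (n : ℕ) (t : Fin n → X.presheaf.stalk x) (c : {j // x ∈ (E j).support} → Fin n),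
    ringKrullDim (X.presheaf.stalk x) = n ∧
    Ideal.span (Set.range t) = IsLocalRing.maximalIdeal (X.presheaf.stalk x) ∧
    Function.Injective c ∧
    ∀ j, stalkIdeal (E j.1) x = Ideal.span {t (c j)}

end Blowup

/-! ### Rational and logarithmic 1-forms -/

section Forms

variable {k : Type u} [Field k] {X : Scheme.{u}} [IsIntegral X] (f : X ⟶ Spec (CommRingCat.of k))

/-- The structure map from the ground field to the function field. -/
def toFunctionField : CommRingCat.of k ⟶ X.functionField :=
  (Scheme.ΓSpecIso (CommRingCat.of k)).inv ≫ f.appTop ≫ X.presheaf.germ ⊤ (genericPoint X) (Opens.mem_top _)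

/-- The `K(X)`-vector space `Ω_{K(X)/k}` of rational 1-forms on `X`. -/
abbrev RationalForms : ModuleCat.{u} X.functionField :=
  CommRingCat.KaehlerDifferential (toFunctionField f)

/-- The differential of a rational function. -/
abbrev d (g : X.functionField) : RationalForms f :=
  CommRingCat.KaehlerDifferential.d g

/-- The local ring at `x`, as a subring of the function field. -/
abbrev localRing (X : Scheme.{u}) [IsIntegral X] (x : X) : Subring X.functionField :=
  (algebraMap (X.presheaf.stalk x) X.functionField).range

variable {J : Type w} (D : J → X.IdealSheafData)

/-- The stalk at `x` of the sheaf of 1-forms with logarithmic poles along the divisors `D j`: the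
`𝒪_{X,x}`-module of rational 1-forms generated by the `dg` for `g ∈ 𝒪_{X,x}` and
the `dh / h` for `h` a local equation of one of the `D j` at `x`. -/
def logStalk (x : X) : Submodule (localRing X x) (RationalForms f) :=
  Submodule.span (localRing X x)
    ({ω | ∃ g : X.presheaf.stalk x, ω = d f (algebraMap _ X.functionField g)} ∪
      {ω | ∃ (j : J) (h : X.presheaf.stalk x), stalkIdeal (D j) x = Ideal.span {h} ∧
        ω = (algebraMap _ X.functionField h)⁻¹ • d f (algebraMap _ X.functionField h)})

/-- The sections over `U` of the sheaf of 1-forms with logarithmic poles along the `D j`: rational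
1-forms lying in `logStalk f D x` for all `x ∈ U`. A form is recorded as a constant function on
`U`, so that there is exactly one section over the empty set. -/
@[ext]
structure LogSection (U : X.Opens) : Type u where
  form : U → RationalForms f
  const : ∀ x y, form x = form y
  mem : ∀ x : U, form x ∈ logStalk f D x.1

namespace LogSection

variable {f D}

/-- The rational function defined by a regular function on a neighbourhood of `x`. -/
abbrev ev {U : X.Opens} (x : U) : Γ(X, U) →+* X.functionField :=
  (algebraMap (X.presheaf.stalk x.1) X.functionField).comp (X.presheaf.germ U x.1 x.2).hom

lemma ev_eq {U : X.Opens} (x y : U) : ev x = ev y := by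
  ext r
  have : Nonempty U := ⟨x⟩
  simp [ev]

lemma ev_map {U V : X.Opens} (i : V ⟶ U) (x : V) (r : Γ(X, U)) :
    ev x (X.presheaf.map i.op r) = ev ⟨x.1, i.le x.2⟩ r := by
  simp only [ev, RingHom.comp_apply]
  congr 1
  exact TopCat.Presheaf.germ_res_apply X.presheaf i x.1 x.2 r

lemma ev_smul_mem {U : X.Opens} (x : U) (r : Γ(X, U)) {ω : RationalForms f}
    (h : ω ∈ logStalk f D x.1) : ev x r • ω ∈ logStalk f D x.1 :=
  Submodule.smul_mem _ (⟨ev x r, ⟨_, rfl⟩⟩ : localRing X x.1) h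

variable {U : X.Opens}

instance : Zero (LogSection f D U) :=
  ⟨⟨fun _ => 0, fun _ _ => rfl, fun _ => Submodule.zero_mem _⟩⟩

instance : Add (LogSection f D U) :=
  ⟨fun s t => ⟨fun x => s.form x + t.form x, fun x y => by rw [s.const x y, t.const x y],
    fun x => Submodule.add_mem _ (s.mem x) (t.mem x)⟩⟩

instance : Neg (LogSection f D U) :=
  ⟨fun s => ⟨fun x => -s.form x, fun x y => by rw [s.const x y],
    fun x => Submodule.neg_mem _ (s.mem x)⟩⟩

instance : SMul Γ(X, U) (LogSection f D U) :=
  ⟨fun r s => ⟨fun x => ev x r • s.form x, fun x y => by rw [s.const x y, ev_eq x y],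
    fun x => ev_smul_mem x r (s.mem x)⟩⟩

@[simp] lemma zero_form (x : U) : (0 : LogSection f D U).form x = 0 := rfl
@[simp] lemma add_form (s t : LogSection f D U) (x : U) :
    (s + t).form x = s.form x + t.form x := rfl
@[simp] lemma neg_form (s : LogSection f D U) (x : U) : (-s).form x = -s.form x := rfl
@[simp] lemma smul_form (r : Γ(X, U)) (s : LogSection f D U) (x : U) :
    (r • s).form x = ev x r • s.form x := rfl

instance : AddCommGroup (LogSection f D U) where
  add_assoc a b c := by ext x; simp [add_assoc]
  zero_add a := by ext x; simp
  add_zero a := by ext x; simp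
  add_comm a b := by ext x; simp [add_comm]
  neg_add_cancel a := by ext x; simp
  nsmul := nsmulRec
  zsmul := zsmulRec

instance : Module Γ(X, U) (LogSection f D U) where
  one_smul a := by ext x; rw [smul_form, map_one, one_smul]
  mul_smul r s a := by ext x; simp only [smul_form, map_mul, mul_smul]
  smul_zero r := by ext x; simp
  smul_add r a b := by ext x; simp
  add_smul r s a := by ext x; simp only [smul_form, add_form, map_add, add_smul]
  zero_smul a := by ext x; rw [smul_form, map_zero, zero_smul, zero_form]

/-- Restriction of sections. -/
def res {V : X.Opens} (i : V ⟶ U) (s : LogSection f D U) : LogSection f D V :=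
  ⟨fun x => s.form ⟨x.1, i.le x.2⟩, fun _ _ => s.const _ _, fun x => s.mem ⟨x.1, i.le x.2⟩⟩

end LogSection

open LogSection

/-- The presheaf of abelian groups of logarithmic 1-forms. -/
def logPresheaf : TopCat.Presheaf Ab X where
  obj U := AddCommGrpCat.of (LogSection f D U.unop)
  map i := AddCommGrpCat.ofHom (AddMonoidHom.mk' (res i.unop) fun _ _ => rfl)

instance (U : X.Opensᵒᵖ) : Module (X.ringCatSheaf.obj.obj U) ((logPresheaf f D).obj U) :=
  inferInstanceAs (Module Γ(X, U.unop) (LogSection f D U.unop))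

lemma logPresheaf_isSheaf : (logPresheaf f D).IsSheaf := by
  refine (TopCat.Presheaf.isSheaf_iff_isSheaf_comp (forget AddCommGrpCat) _).2 ?_
  refine TopCat.Presheaf.isSheaf_of_isSheafUniqueGluing_types _ ?_
  intro ι U sf hsf
  let sf' : ∀ i, LogSection f D (U i) := sf
  have key : ∀ i j (x : U i) (y : U j), (sf' i).form x = (sf' j).form y := by
    intro i j x y
    obtain ⟨z, hzi, hzj⟩ := nonempty_preirreducible_inter (U i).isOpen (U j).isOpen
      ⟨x.1, x.2⟩ ⟨y.1, y.2⟩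
    have h := congrArg (fun s : LogSection f D (U i ⊓ U j) => s.form ⟨z, hzi, hzj⟩) (hsf i j)
    exact ((sf' i).const x ⟨z, hzi⟩).trans (h.trans ((sf' j).const ⟨z, hzj⟩ y))
  choose idx hidx using fun x : ↑(iSup U) => Opens.mem_iSup.mp x.2
  refine ⟨(⟨fun x => (sf' (idx x)).form ⟨x.1, hidx x⟩, fun x y => key _ _ _ _,
    fun x => (sf' (idx x)).mem ⟨x.1, hidx x⟩⟩ : LogSection f D (iSup U)), ?_, ?_⟩
  · intro i
    exact LogSection.ext (funext fun x => key _ _ _ _)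
  · intro t ht
    refine LogSection.ext (f := f) (D := D) (funext fun x => ?_)
    exact congrArg (fun s : LogSection f D (U (idx x)) => s.form ⟨x.1, hidx x⟩) (ht (idx x))

/-- The sheaf of `𝒪_X`-modules `Ω¹_X(log ∑ D j)` of 1-forms with logarithmic poles along the
divisors `D j`. -/
def logForms : X.Modules where
  val := PresheafOfModules.ofPresheaf (logPresheaf f D) (by
    intro U V i r m
    refine LogSection.ext (funext fun x => ?_)
    exact congrArg (fun z => z • m.form _) (ev_map i.unop x r).symm)
  isSheaf := logPresheaf_isSheaf f D

variable {f D} in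
/-- The rational 1-form underlying a section of the sheaf of logarithmic 1-forms. -/
def sectionForm {U : X.Opens} (s : Γ(logForms f D, U)) (x : U) : RationalForms f :=
  LogSection.form (f := f) (D := D) s x

end Forms

/-! ### Pullback of rational forms -/

section Pullback

variable {k : Type u} [Field k] {W V : Scheme.{u}} [IsIntegral W] [IsIntegral V]

lemma map_genericPoint (π : W ⟶ V) [IsDominant π] : π (genericPoint W) = genericPoint V := by
  apply ((genericPoint_spec V).eq _).symm
  have h := (genericPoint_spec W).image π.continuous
  rwa [Set.image_univ, π.denseRange.closure_range] at h

/-- The inclusion `K(V) → K(W)` of function fields defined by a dominant morphism. -/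
def functionFieldMap (π : W ⟶ V) [IsDominant π] : V.functionField ⟶ W.functionField :=
  V.presheaf.stalkSpecializes (specializes_of_eq (map_genericPoint π)) ≫
    π.stalkMap (genericPoint W)

lemma toFunctionField_comp (v : V ⟶ Spec (CommRingCat.of k)) (π : W ⟶ V) [IsDominant π] :
    𝟙 _ ≫ toFunctionField (π ≫ v) = toFunctionField v ≫ functionFieldMap π := by
  have h : V.presheaf.germ ⊤ (genericPoint V) (Opens.mem_top _) ≫ functionFieldMap π =
      π.appTop ≫ W.presheaf.germ ⊤ (genericPoint W) (Opens.mem_top _) := by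
    rw [functionFieldMap, TopCat.Presheaf.germ_stalkSpecializes_assoc]
    exact Scheme.Hom.germ_stalkMap π ⊤ (genericPoint W) (Opens.mem_top _)
  simp only [toFunctionField, Category.id_comp, Category.assoc, h, Scheme.Hom.comp_appTop]

/-- The pullback `π^*` of rational 1-forms along a dominant morphism. -/
def pullbackForm (v : V ⟶ Spec (CommRingCat.of k)) (π : W ⟶ V) [IsDominant π]
    (ω : RationalForms v) : RationalForms (π ≫ v) :=
  CommRingCat.KaehlerDifferential.map (toFunctionField_comp v π) ω

end Pullback

end LogForms

end

/-!
Write `p = π w` and let `h j` be equations of the divisors `E j` at `p`: members of a regular system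
of parameters of `𝒪_{V,p}`, or units.

*Log forms on `V`.* As `V` is smooth over a perfect field, the regular system of parameters extends
to a family `y` whose differentials form a basis of the differentials of `𝒪_{V,p}`
(`exists_basis_D_of_regularSystem`). Replacing `dy` by `dy / y` for the equations of the `E j` gives
a frame of the logarithmic forms at `p`, and by finiteness near `p`
(`HasNormalCrossings.exists_frame`).

*The blowup.* The center has the stalk ideal `(h j : j ∈ S)`. Only the universal property of the
blowup is available. On the one hand, it makes the ideal of the center principal at `w`, generated
by some `h s`, so that `C = 𝒪_{V,p}[h j / h s : j ∈ S]` maps to `𝒪_{W,w}`. On the other hand, the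
center becomes a Cartier divisor on the spectrum of the localization of `C` at the prime of `w`,
which therefore maps to `W`. The two maps are inverse to each other, so `𝒪_{W,w}` is a localization
of `C` (`IsBlowup.exists_isLocalization`). In particular it embeds into `K(V)`, and the generic
point of `V` has only one lift to `W`, which therefore specializes to every point of `W`. So `W` is
integral and birational to `V` (`IsBlowup.isIntegral_and_isDominant`,
`IsBlowup.bijective_functionFieldMap`).

*Proper transforms.* The `h j` form a regular family, and division by `h j` lowers the order with
respect to the ideal `(h j : j ∈ S)` by one for `j ∈ S` and not at all for `j ∉ S`. Hence
`h j / h s`, for `j ∈ S`, or `h j`, for `j ∉ S`, is a unit or a prime element of `C` not dividing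
`h s` (`isPrime_span_div_pow`), and it is an equation of the proper transform of `E j`
(`stalkIdeal_properTransform`).

*Comparison.* From `d log (h j / h s) = d log (h j) - d log (h s)` the pulled back logarithmic forms
generate those of `W` at every point (`IsBlowup.logStalk_eq_span`). So the pullback of a frame is a
frame, and a morphism `M ⟶ π_* L` that maps local frames of `M` to local frames of `L` is adjoint to
an isomorphism: it has the universal property of `M ⟶ π_* π^* M`, since morphisms out of `L` are
determined by the images of the frames and can be glued from them (`isIso_homEquiv_symm`).
-/

namespace LogForms


/-! ### Regular systems of parameters -/

section RegularLocal

open IsLocalRing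

/-- The image of a generating set of the maximal ideal generates the maximal ideal of a quotient,
and the elements that lie in the ideal may be dropped. -/
lemma span_image_maximalIdeal_quotient {R : Type u} [CommRing R] [IsLocalRing R] (I : Ideal R)
    [IsLocalRing (R ⧸ I)] (s : Set R)
    (hs : maximalIdeal R = Ideal.span s ⊔ I) :
    Ideal.span (Ideal.Quotient.mk I '' s) = maximalIdeal (R ⧸ I) := by
  have h1 : (maximalIdeal R).map (Ideal.Quotient.mk I) = maximalIdeal (R ⧸ I) := by
    have hloc : IsLocalHom (Ideal.Quotient.mk I) :=
      .of_surjective _ Ideal.Quotient.mk_surjective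
    refine le_antisymm (((local_hom_TFAE _).out 0 2).mp hloc) fun y hy => ?_
    obtain ⟨x, rfl⟩ := Ideal.Quotient.mk_surjective y
    exact Ideal.mem_map_of_mem _ (fun hx => hy (hx.map _))
  rw [← h1, hs, Ideal.map_sup, Ideal.map_span, Ideal.map_quotient_self, sup_bot_eq]

/-- A noetherian local ring whose maximal ideal is generated by `dim R` elements is a domain. -/
theorem isDomain_of_card_le_ringKrullDim (n : ℕ) (R : Type u) [CommRing R] [IsLocalRing R]
    [IsNoetherianRing R] (s : Finset R) (hs : Ideal.span (s : Set R) = maximalIdeal R)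
    (hn : s.card ≤ n) (hdim : n ≤ ringKrullDim R) : IsDomain R := by
  classical
  induction n generalizing R with
  | zero =>
    have : s = ∅ := by simpa using hn
    subst this
    have hb : maximalIdeal R = ⊥ := by simpa using hs.symm
    exact (isField_iff_maximalIdeal_eq.mpr hb).isDomain
  | succ n ih =>
    have hht := maximalIdeal_height_eq_ringKrullDim (R := R)
    have hmin : maximalIdeal R ∉ minimalPrimes R := by
      rw [← Ideal.height_eq_zero_iff]
      intro h0
      rw [← hht, h0] at hdim
      exact absurd hdim (by norm_cast)
    -- an element of the maximal ideal that lies neither in its square nor in a minimal prime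
    obtain ⟨x, hxm, hx2, hxP⟩ : ∃ x ∈ maximalIdeal R, x ∉ maximalIdeal R ^ 2 ∧
        ∀ P ∈ minimalPrimes R, x ∉ P := by
      by_contra! hcon
      have hsub : (maximalIdeal R : Set R) ⊆
          ⋃ I ∈ insert (maximalIdeal R ^ 2) (minimalPrimes R), (I : Set R) := by
        intro x hx
        by_cases h2 : x ∈ maximalIdeal R ^ 2
        · exact Set.mem_biUnion (Set.mem_insert _ _) h2
        · obtain ⟨P, hP, hxP⟩ := hcon x hx h2
          exact Set.mem_biUnion (Set.mem_insert_of_mem _ hP) hxP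
      rw [Ideal.subset_union_prime_finite
        ((minimalPrimes.finite_of_isNoetherianRing R).insert _) (f := fun I => I)
        (maximalIdeal R ^ 2) (maximalIdeal R ^ 2)] at hsub
      · obtain ⟨I, hI, hle⟩ := hsub
        rcases hI with rfl | hI
        · have hbot : maximalIdeal R = ⊥ :=
            Submodule.eq_bot_of_le_smul_of_le_jacobson_bot (maximalIdeal R) _
              (IsNoetherian.noetherian _) (by rwa [smul_eq_mul, ← sq])
              (maximalIdeal_le_jacobson _)
          have : IsDomain R := (isField_iff_maximalIdeal_eq.mpr hbot).isDomain
          apply hmin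
          rw [hbot, IsDomain.minimalPrimes_eq_singleton_bot]
          rfl
        · have hIp : I.IsPrime := hI.1.1
          have : maximalIdeal R = I := le_antisymm hle (le_maximalIdeal hIp.ne_top)
          exact hmin (this ▸ hI)
      · rintro I (rfl | hI) h _
        · exact absurd rfl h
        · exact hI.1.1
    -- `x` replaces one of the generators
    obtain ⟨y, hys, hy⟩ : ∃ y ∈ s, maximalIdeal R =
        Ideal.span ((s.erase y : Finset R) : Set R) ⊔ Ideal.span {x} := by
      rw [← hs, Submodule.mem_span_finset] at hxm
      obtain ⟨a, -, ha⟩ := hxm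
      obtain ⟨y, hys, hay⟩ : ∃ y ∈ s, IsUnit (a y) := by
        by_contra! hcon
        apply hx2
        rw [← ha, sq]
        refine Ideal.sum_mem _ fun y hy => Ideal.mul_mem_mul (hcon y hy) ?_
        rw [← hs]; exact Ideal.subset_span hy
      refine ⟨y, hys, le_antisymm ?_ (sup_le ?_ ?_)⟩
      · rw [← hs, Ideal.span_le]
        intro z hz
        by_cases hzy : z = y
        · subst hzy
          obtain ⟨b, hb⟩ := hay.exists_right_inv
          have hx' : b * x - b * ∑ i ∈ s.erase z, a i * i = z := by
            rw [← ha, ← Finset.add_sum_erase s _ hys]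
            simp only [smul_eq_mul]
            linear_combination z * hb
          have hm := Ideal.sub_mem (Ideal.span ((s.erase z : Finset R) : Set R) ⊔ Ideal.span {x})
            (Ideal.mul_mem_left _ b (Ideal.mem_sup_right (Ideal.mem_span_singleton_self x)))
            (Ideal.mul_mem_left _ b (Ideal.mem_sup_left
              (Ideal.sum_mem _ fun i hi => Ideal.mul_mem_left _ (a i) (Ideal.subset_span hi))))
          rwa [hx'] at hm
        · exact Ideal.mem_sup_left (Ideal.subset_span (by simpa [hzy] using hz))
      · rw [← hs]; exact Ideal.span_mono (by simp)
      · rw [Ideal.span_singleton_le_iff_mem, ← hs, ← ha]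
        exact Ideal.sum_mem _ fun i hi => Ideal.mul_mem_left _ _ (Ideal.subset_span hi)
    have hxne : Ideal.span {x} ≠ ⊤ := fun h => by
      have : Ideal.span {x} ≤ maximalIdeal R := by rwa [Ideal.span_singleton_le_iff_mem]
      rw [h, top_le_iff] at this
      exact (maximalIdeal.isMaximal R).ne_top this
    have : Nontrivial (R ⧸ Ideal.span {x}) := Ideal.Quotient.nontrivial_iff.mpr hxne
    have : IsLocalRing (R ⧸ Ideal.span {x}) :=
      .of_surjective' (Ideal.Quotient.mk _) Ideal.Quotient.mk_surjective
    have hdom : IsDomain (R ⧸ Ideal.span {x}) := by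
      refine ih _ ((s.erase y).image (Ideal.Quotient.mk _)) ?_ ?_ ?_
      · rw [Finset.coe_image]
        exact span_image_maximalIdeal_quotient _ _ hy
      · refine Finset.card_image_le.trans ?_
        rw [Finset.card_erase_of_mem hys]; omega
      · have := ringKrullDim_le_ringKrullDim_quotient_add_card (R := R) {x} (by
          rw [IsLocalRing.ringJacobson_eq_maximalIdeal]; simpa using hxm)
        have h2 := hdim.trans this
        rw [Finset.coe_singleton, Finset.card_singleton] at h2
        push_cast at h2
        exact ENat.WithBot.add_le_add_one_right_iff.mp h2
    have hxp : (Ideal.span {x}).IsPrime := (Ideal.Quotient.isDomain_iff_prime _).mp hdom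
    obtain ⟨P, hP, hPx⟩ := Ideal.exists_minimalPrimes_le (I := ⊥) (J := Ideal.span {x}) bot_le
    have hPp : P.IsPrime := hP.1.1
    have hP0 : P = ⊥ := by
      refine Submodule.eq_bot_of_le_smul_of_le_jacobson_bot (Ideal.span {x}) _
        (IsNoetherian.noetherian _) (fun z hz => ?_)
        ((le_maximalIdeal hxne).trans (maximalIdeal_le_jacobson _))
      obtain ⟨r, rfl⟩ := Ideal.mem_span_singleton.mp (hPx hz)
      exact Ideal.mul_mem_mul (Ideal.mem_span_singleton_self x)
        ((hPp.mem_or_mem hz).resolve_left (hxP P hP))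
    rw [hP0] at hPp
    exact IsDomain.of_bot_isPrime R

variable {R : Type u} [CommRing R] [IsLocalRing R] [IsNoetherianRing R] {n : ℕ}

/-- A member of a regular system of parameters is not in the ideal generated by others. -/
lemma notMem_span_of_regularSystem (t : Fin n → R) (hdim : ringKrullDim R = n)
    (ht : Ideal.span (Set.range t) = maximalIdeal R) (T : Finset (Fin n)) {i : Fin n} (hi : i ∉ T) :
    t i ∉ Ideal.span (t '' T) := by
  classical
  intro hmem
  have hsp : Ideal.span (((Finset.univ.erase i).image t : Finset R) : Set R) =
      maximalIdeal R := by
    rw [← ht]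
    refine le_antisymm (Ideal.span_mono (by simp [Set.image_subset_iff])) ?_
    rw [Ideal.span_le]
    rintro _ ⟨j, rfl⟩
    by_cases hj : j = i
    · subst hj
      refine Ideal.span_mono ?_ hmem
      rw [Finset.coe_image]
      refine Set.image_mono fun k hk => ?_
      simp only [Finset.coe_erase, Finset.coe_univ, Set.mem_sdiff, Set.mem_univ, true_and,
        Set.mem_singleton_iff]
      rintro rfl
      exact hi hk
    · exact Ideal.subset_span (by simpa using ⟨j, hj, rfl⟩)
  have h1 := ringKrullDim_le_spanFinrank_maximalIdeal R
  rw [hdim, ← hsp] at h1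
  have h2 : n ≤ (Finset.univ.erase i).card := by
    refine (Nat.cast_le (α := WithBot ℕ∞)).mp (h1.trans ?_)
    rw [Nat.cast_le]
    refine (Submodule.spanFinrank_span_le_ncard_of_finite (Finset.finite_toSet _)).trans ?_
    rw [Set.ncard_coe_finset]
    exact Finset.card_image_le
  rw [Finset.card_erase_of_mem (Finset.mem_univ _), Finset.card_univ, Fintype.card_fin] at h2
  have := i.pos
  omega

/-- Part of a regular system of parameters generates a prime ideal. -/
lemma isPrime_span_of_regularSystem (t : Fin n → R) (hdim : ringKrullDim R = n)
    (ht : Ideal.span (Set.range t) = maximalIdeal R) (T : Finset (Fin n)) :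
    (Ideal.span (t '' T)).IsPrime := by
  classical
  have hle : Ideal.span (t '' T) ≤ maximalIdeal R := by
    rw [← ht]; exact Ideal.span_mono (Set.image_subset_range _ _)
  have hne : Ideal.span (t '' T) ≠ ⊤ := fun h => by
    rw [h, top_le_iff] at hle
    exact (maximalIdeal.isMaximal R).ne_top hle
  have : Nontrivial (R ⧸ Ideal.span (t '' T)) := Ideal.Quotient.nontrivial_iff.mpr hne
  have : IsLocalRing (R ⧸ Ideal.span (t '' T)) :=
    .of_surjective' (Ideal.Quotient.mk _) Ideal.Quotient.mk_surjective
  rw [← Ideal.Quotient.isDomain_iff_prime]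
  refine isDomain_of_card_le_ringKrullDim (n - T.card) _
    (((Finset.univ \ T).image t).image (Ideal.Quotient.mk _)) ?_ ?_ ?_
  · rw [Finset.coe_image]
    refine span_image_maximalIdeal_quotient _ _ ?_
    rw [← ht, ← Ideal.span_union, Finset.coe_image, ← Set.image_union]
    simp
  · refine Finset.card_image_le.trans (Finset.card_image_le.trans ?_)
    rw [Finset.card_sdiff_of_subset (Finset.subset_univ _)]
    simp
  · have h := ringKrullDim_le_ringKrullDim_quotient_add_card (R := R) (T.image t) (by
      rw [IsLocalRing.ringJacobson_eq_maximalIdeal, Finset.coe_image]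
      exact Ideal.subset_span.trans hle)
    rw [hdim, Finset.coe_image] at h
    have h3 : ((n - T.card : ℕ) : WithBot ℕ∞) + (T.card : ℕ) ≤
        ringKrullDim (R ⧸ Ideal.span (t '' T)) + (T.card : ℕ) := by
      rw [← Nat.cast_add, Nat.sub_add_cancel (by simpa using Finset.card_le_univ T)]
      refine h.trans ?_
      gcongr
      exact Finset.card_image_le
    exact ENat.WithBot.add_le_add_natCast_right_iff.mp h3

end RegularLocal


/-! ### Regular families and affine charts of blowups -/

section BlowupAlgebra

variable {R : Type u} [CommRing R] {J : Type w}

/-- A family of elements such that every member is a nonzerodivisor modulo any finite set of other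
members: a regular sequence in every order. -/
def IsRegularFamily (h : J → R) : Prop :=
  ∀ (T : Finset J) (i : J), i ∉ T → ∀ x, h i * x ∈ Ideal.span (h '' T) → x ∈ Ideal.span (h '' T)

/-- Members of a regular system of parameters together with units form a regular family. -/
lemma isRegularFamily_of_regularSystem [IsLocalRing R] [IsNoetherianRing R] {n : ℕ}
    (t : Fin n → R) (hdim : ringKrullDim R = n)
    (ht : Ideal.span (Set.range t) = IsLocalRing.maximalIdeal R) (h : J → R) {Q : J → Prop}
    (c : {j // Q j} → Fin n) (hc : Function.Injective c) (h1 : ∀ j, h j.1 = t (c j))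
    (h2 : ∀ j, ¬ Q j → IsUnit (h j)) : IsRegularFamily h := by
  classical
  intro T i hi x hx
  by_cases hT : ∃ k ∈ T, ¬ Q k
  · obtain ⟨k, hkT, hk⟩ := hT
    rw [Ideal.eq_top_of_isUnit_mem (Ideal.span (h '' T)) (Ideal.subset_span ⟨k, hkT, rfl⟩)
      (h2 k hk)]
    trivial
  · by_cases hQ : Q i
    · push Not at hT
      let T' : Finset (Fin n) := T.attach.image fun k => c ⟨k.1, hT k.1 k.2⟩
      have him : h '' T = t '' T' := by
        ext y
        simp only [Set.mem_image, Finset.mem_coe, T', Finset.mem_image, Finset.mem_attach,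
          true_and, Subtype.exists]
        constructor
        · rintro ⟨k, hk, rfl⟩
          exact ⟨_, ⟨k, hk, rfl⟩, (h1 ⟨k, hT k hk⟩).symm⟩
        · rintro ⟨_, ⟨k, hk, rfl⟩, rfl⟩
          exact ⟨k, hk, h1 ⟨k, hT k hk⟩⟩
      have hnot : c ⟨i, hQ⟩ ∉ T' := by
        simp only [T', Finset.mem_image, Finset.mem_attach, true_and, Subtype.exists, not_exists]
        intro k hk hck
        have := congrArg Subtype.val (hc hck)
        subst this
        exact hi hk
      rw [him] at hx ⊢
      have hp := isPrime_span_of_regularSystem t hdim ht T'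
      refine (hp.mem_or_mem hx).resolve_left ?_
      rw [h1 ⟨i, hQ⟩]
      exact notMem_span_of_regularSystem t hdim ht T' hnot
    · exact (Ideal.unit_mul_mem_iff_mem _ (h2 i hQ)).mp hx

lemma span_sup_pow_succ (a : R) (I : Ideal R) (N : ℕ) :
    (Ideal.span {a} ⊔ I) ^ (N + 1) = Ideal.span {a} * (Ideal.span {a} ⊔ I) ^ N ⊔ I ^ (N + 1) := by
  apply le_antisymm
  · induction N with
    | zero => simp
    | succ N ih =>
      rw [pow_succ, Ideal.mul_sup, mul_comm _ (Ideal.span {a})]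
      refine sup_le le_sup_left ?_
      refine (Ideal.mul_mono_left ih).trans ?_
      rw [Ideal.sup_mul, ← pow_succ, mul_assoc]
      refine sup_le_sup_right (Ideal.mul_mono_right ?_) _
      rw [pow_succ]
      exact Ideal.mul_mono_right le_sup_right
  · refine sup_le ?_ (Ideal.pow_right_mono le_sup_right _)
    rw [pow_succ, mul_comm]
    exact Ideal.mul_mono_right le_sup_left

/-- In a regular family, a member is a nonzerodivisor modulo powers of the ideal generated by other
members. The auxiliary set `K` makes the induction on `T` possible, since the quotient by one more
member has to be considered. -/
theorem IsRegularFamily.mem_sup_pow {h : J → R} (hreg : IsRegularFamily h) (T : Finset J) :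
    ∀ (K : Finset J) (i : J), Disjoint T K → i ∉ T → i ∉ K → ∀ (N : ℕ) (x : R),
      h i * x ∈ Ideal.span (h '' K) ⊔ Ideal.span (h '' T) ^ N →
        x ∈ Ideal.span (h '' K) ⊔ Ideal.span (h '' T) ^ N := by
  classical
  induction T using Finset.induction_on with
  | empty =>
    intro K i _ _ hiK N x hx
    cases N with
    | zero => simp
    | succ N =>
      simp only [Finset.coe_empty, Set.image_empty, Ideal.span_empty, ne_eq, N.succ_ne_zero,
        not_false_eq_true, Ideal.bot_pow, sup_bot_eq] at hx ⊢
      exact hreg K i hiK x hx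
  | insert a T haT ih =>
    intro K i hdis hiT hiK N
    rw [Finset.disjoint_insert_left] at hdis
    rw [Finset.mem_insert, not_or] at hiT
    induction N with
    | zero => simp
    | succ N ihN =>
      intro x hx
      rw [Finset.coe_insert, Set.image_insert_eq, Ideal.span_insert] at hx ihN ⊢
      set I' := Ideal.span (h '' T) with hI'
      set I := Ideal.span {h a} ⊔ I' with hI
      set K' := Ideal.span (h '' (K : Set J)) with hK'
      rw [hI, span_sup_pow_succ, ← hI] at hx
      obtain ⟨k, hk, r, hr, hkr⟩ := Submodule.mem_sup.mp hx
      obtain ⟨z, hz, α, hα, rfl⟩ := Submodule.mem_sup.mp hr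
      obtain ⟨b, hb, rfl⟩ := Ideal.mem_span_singleton_mul.mp hz
      have h1 : b ∈ Ideal.span (h '' (insert i K : Finset J)) ⊔ I' ^ (N + 1) := by
        refine ih (insert i K) a ?_ haT ?_ (N + 1) b ?_
        · rw [Finset.disjoint_insert_right]; exact ⟨hiT.2, hdis.2⟩
        · rw [Finset.mem_insert, not_or]; exact ⟨fun e => hiT.1 e.symm, hdis.1⟩
        · have : h a * b = (h i * x - k) - α := by rw [← hkr]; ring
          rw [this]
          refine Ideal.sub_mem _ (Ideal.mem_sup_left ?_) (Ideal.mem_sup_right hα)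
          rw [Finset.coe_insert, Set.image_insert_eq, Ideal.span_insert]
          exact Ideal.sub_mem _ (Ideal.mem_sup_left
            (Ideal.mul_mem_right _ _ (Ideal.mem_span_singleton_self _))) (Ideal.mem_sup_right hk)
      rw [Finset.coe_insert, Set.image_insert_eq, Ideal.span_insert] at h1
      obtain ⟨m, hm, α', hα', rfl⟩ := Submodule.mem_sup.mp h1
      obtain ⟨q, hq, k', hk', rfl⟩ := Submodule.mem_sup.mp hm
      obtain ⟨c, rfl⟩ := Ideal.mem_span_singleton.mp hq
      have h2 : x - h a * c ∈ K' ⊔ I' ^ (N + 1) := by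
        refine ih K i hdis.2 hiT.2 hiK (N + 1) _ ?_
        have : h i * (x - h a * c) = (k + h a * k') + (α + h a * α') := by
          rw [mul_sub, ← hkr]; ring
        rw [this]
        exact Ideal.add_mem _ (Ideal.mem_sup_left (Ideal.add_mem _ hk (Ideal.mul_mem_left _ _ hk')))
          (Ideal.mem_sup_right (Ideal.add_mem _ hα (Ideal.mul_mem_left _ _ hα')))
      have h3 : c ∈ K' ⊔ I ^ N := by
        refine ihN c ?_
        have : h i * c = (h i * c + k' + α') - α' - k' := by ring
        rw [this]
        refine Ideal.sub_mem _ (Ideal.mem_sup_right (Ideal.sub_mem _ hb ?_))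
          (Ideal.mem_sup_left hk')
        exact Ideal.pow_right_mono (le_sup_right : I' ≤ I) N (Ideal.pow_le_pow_right N.le_succ hα')
      have h4 : h a * c ∈ K' ⊔ I ^ (N + 1) := by
        obtain ⟨p, hp, q', hq', rfl⟩ := Submodule.mem_sup.mp h3
        rw [mul_add]
        refine Ideal.add_mem _ (Ideal.mem_sup_left (Ideal.mul_mem_left _ _ hp))
          (Ideal.mem_sup_right ?_)
        rw [pow_succ']
        exact Ideal.mul_mem_mul (Ideal.mem_sup_left (Ideal.mem_span_singleton_self _)) hq'
      have : x = (x - h a * c) + h a * c := by ring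
      rw [this]
      exact Ideal.add_mem _ (sup_le_sup le_rfl
        (Ideal.pow_right_mono (le_sup_right : I' ≤ I) (N + 1)) h2) h4

lemma IsRegularFamily.mem_pow_of_notMem {h : J → R} (hreg : IsRegularFamily h) {T : Finset J}
    {i : J} (hi : i ∉ T) {N : ℕ} {x : R} (hx : h i * x ∈ Ideal.span (h '' T) ^ N) :
    x ∈ Ideal.span (h '' T) ^ N := by
  have := hreg.mem_sup_pow T ∅ i (by simp) hi (by simp) N x
  simpa using this (by simpa using hx)

lemma IsRegularFamily.mem_pow_of_mem {h : J → R} (hreg : IsRegularFamily h) {T : Finset J}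
    {i : J} (hi : i ∈ T) {N : ℕ} {x : R} (hx : h i * x ∈ Ideal.span (h '' T) ^ (N + 1)) :
    x ∈ Ideal.span (h '' T) ^ N := by
  classical
  obtain ⟨T, hiT, rfl⟩ : ∃ T' : Finset J, i ∉ T' ∧ insert i T' = T :=
    ⟨T.erase i, Finset.notMem_erase _ _, Finset.insert_erase hi⟩
  rw [Finset.coe_insert, Set.image_insert_eq, Ideal.span_insert] at hx ⊢
  rw [span_sup_pow_succ] at hx
  obtain ⟨y, hy, α, hα, hxy⟩ := Submodule.mem_sup.mp hx
  obtain ⟨z, hz, rfl⟩ := Ideal.mem_span_singleton_mul.mp hy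
  have h1 : x - z ∈ Ideal.span (h '' T) ^ (N + 1) := by
    refine hreg.mem_pow_of_notMem hiT ?_
    rw [mul_sub, ← hxy]
    simpa using hα
  rw [← sub_add_cancel x z]
  exact Ideal.add_mem _
    (Ideal.pow_right_mono le_sup_right _ (Ideal.pow_le_pow_right N.le_succ h1)) hz

variable (K : Type u) [Field K] [Algebra R K]

/-- The coordinate ring `R[hⱼ/hₛ : j ∈ S]` of an affine chart of the blowup of the ideal generated
by the `hⱼ`, `j ∈ S`, as a subring of the fraction field. -/
def blowupAlgebra (h : J → R) (S : Set J) (s : J) : Subalgebra R K :=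
  Algebra.adjoin R ((fun j => algebraMap R K (h j) / algebraMap R K (h s)) '' S)

variable {K}

lemma div_pow_mem_blowupAlgebra {h : J → R} {S : Set J} {s : J} {N : ℕ} {A : R}
    (hA : A ∈ Ideal.span (h '' S) ^ N) :
    algebraMap R K A / algebraMap R K (h s) ^ N ∈ blowupAlgebra K h S s := by
  induction N generalizing A with
  | zero => simp
  | succ N ih =>
    rw [pow_succ'] at hA
    refine Submodule.mul_induction_on hA (fun a ha b hb => ?_) (fun x y hx hy => ?_)
    · rw [map_mul, pow_succ', mul_div_mul_comm]
      refine Subalgebra.mul_mem _ ?_ (ih hb)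
      refine Submodule.span_induction ?_ ?_ (fun x y _ _ hx hy => ?_) (fun r x _ hx => ?_) ha
      · rintro _ ⟨j, hj, rfl⟩
        exact Algebra.subset_adjoin ⟨j, hj, rfl⟩
      · simp
      · rw [map_add, add_div]; exact Subalgebra.add_mem _ hx hy
      · rw [smul_eq_mul, map_mul, mul_div_assoc]
        exact Subalgebra.mul_mem _ (Subalgebra.algebraMap_mem _ r) hx
    · rw [map_add, add_div]; exact Subalgebra.add_mem _ hx hy

lemma exists_eq_div_pow_of_mem_blowupAlgebra {h : J → R} {S : Set J} {s : J} (hs : s ∈ S)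
    (hs0 : algebraMap R K (h s) ≠ 0) {x : K} (hx : x ∈ blowupAlgebra K h S s) :
    ∃ (N : ℕ) (A : R), A ∈ Ideal.span (h '' S) ^ N ∧
      x = algebraMap R K A / algebraMap R K (h s) ^ N := by
  have hsm : h s ∈ Ideal.span (h '' S) := Ideal.subset_span ⟨s, hs, rfl⟩
  induction hx using Algebra.adjoin_induction with
  | mem x hx =>
    obtain ⟨j, hj, rfl⟩ := hx
    exact ⟨1, h j, by rw [pow_one]; exact Ideal.subset_span (Set.mem_image_of_mem h hj), by simp⟩
  | algebraMap r => exact ⟨0, r, by simp, by simp⟩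
  | add x y _ _ hx hy =>
    obtain ⟨N, A, hA, rfl⟩ := hx
    obtain ⟨M, B, hB, rfl⟩ := hy
    refine ⟨N + M, A * h s ^ M + h s ^ N * B, ?_, ?_⟩
    · rw [pow_add]
      exact Ideal.add_mem _ (Ideal.mul_mem_mul hA (Ideal.pow_mem_pow hsm M))
        (Ideal.mul_mem_mul (Ideal.pow_mem_pow hsm N) hB)
    · rw [map_add, map_mul, map_mul, map_pow, map_pow]
      field_simp
      ring
  | mul x y _ _ hx hy =>
    obtain ⟨N, A, hA, rfl⟩ := hx
    obtain ⟨M, B, hB, rfl⟩ := hy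
    refine ⟨N + M, A * B, ?_, ?_⟩
    · rw [pow_add]; exact Ideal.mul_mem_mul hA hB
    · rw [map_mul, pow_add, mul_div_mul_comm]

/-- Let `g` be a prime element of `R` not dividing `hₛ` such that multiplication by `g` raises the
order with respect to the center by exactly `e`. Then `g / hₛᵉ`, a local equation of the proper
transform of `g = 0`, generates a prime ideal of the affine chart, which does not contain `hₛ`. -/
theorem isPrime_span_div_pow [FaithfulSMul R K] {h : J → R} {S : Set J} {s : J} (hs : s ∈ S)
    {g : R} (e : ℕ) (hg : (Ideal.span {g}).IsPrime) (hsg : h s ∉ Ideal.span {g})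
    (hdiv : ∀ (N : ℕ) (x : R), g * x ∈ Ideal.span (h '' S) ^ (N + e) →
      x ∈ Ideal.span (h '' S) ^ N)
    (v : blowupAlgebra K h S s) (hv : (v : K) = algebraMap R K g / algebraMap R K (h s) ^ e) :
    (Ideal.span {v}).IsPrime ∧ algebraMap R (blowupAlgebra K h S s) (h s) ∉ Ideal.span {v} := by
  have hinj : Function.Injective (algebraMap R K) := FaithfulSMul.algebraMap_injective R K
  have hs0 : algebraMap R K (h s) ≠ 0 := fun h0 => hsg (by
    rw [map_eq_zero_iff _ hinj] at h0; rw [h0]; exact Ideal.zero_mem _)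
  have hsm : h s ∈ Ideal.span (h '' S) := Ideal.subset_span ⟨s, hs, rfl⟩
  have key : ∀ (N : ℕ) (A : R), A ∈ Ideal.span (h '' S) ^ N → A ∈ Ideal.span {g} →
      ∀ x : blowupAlgebra K h S s, (x : K) = algebraMap R K A / algebraMap R K (h s) ^ N →
        x ∈ Ideal.span {v} := by
    intro N A hA hAg x hx
    obtain ⟨B, rfl⟩ := Ideal.mem_span_singleton.mp hAg
    have hB : B * h s ^ e ∈ Ideal.span (h '' S) ^ N := by
      refine hdiv N _ ?_
      rw [← mul_assoc, pow_add]
      exact Ideal.mul_mem_mul hA (Ideal.pow_mem_pow hsm e)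
    rw [Ideal.mem_span_singleton]
    refine ⟨⟨_, div_pow_mem_blowupAlgebra (K := K) (s := s) hB⟩, Subtype.ext ?_⟩
    rw [hx, Subalgebra.coe_mul, hv]
    simp only [map_mul, map_pow]
    field_simp
  have conv : ∀ (N : ℕ) (A : R) (x : blowupAlgebra K h S s),
      (x : K) = algebraMap R K A / algebraMap R K (h s) ^ N → x ∈ Ideal.span {v} →
        A ∈ Ideal.span {g} := by
    intro N A x hx hxv
    obtain ⟨y, rfl⟩ := Ideal.mem_span_singleton.mp hxv
    obtain ⟨M, B, -, hy⟩ := exists_eq_div_pow_of_mem_blowupAlgebra hs hs0 y.2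
    rw [Subalgebra.coe_mul, hv, hy] at hx
    have h1 : A * h s ^ (M + e) = g * (B * h s ^ N) := by
      apply hinj
      simp only [map_mul, map_pow]
      field_simp at hx
      rw [pow_add]
      linear_combination -hx
    have h2 : A * h s ^ (M + e) ∈ Ideal.span {g} := by
      rw [h1]; exact Ideal.mul_mem_right _ _ (Ideal.mem_span_singleton_self g)
    exact (hg.mem_or_mem h2).resolve_right fun h3 => hsg (hg.mem_of_pow_mem _ h3)
  refine ⟨⟨fun htop => ?_, fun {x y} hxy => ?_⟩, fun hmem => ?_⟩
  · have : (1 : blowupAlgebra K h S s) ∈ Ideal.span {v} := by rw [htop]; trivial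
    exact hg.ne_top ((Ideal.eq_top_iff_one _).mpr (conv 0 1 1 (by simp) this))
  · obtain ⟨N, A, hA, hx⟩ := exists_eq_div_pow_of_mem_blowupAlgebra hs hs0 x.2
    obtain ⟨M, B, hB, hy⟩ := exists_eq_div_pow_of_mem_blowupAlgebra hs hs0 y.2
    have := conv (N + M) (A * B) (x * y) (by
      rw [Subalgebra.coe_mul, hx, hy, map_mul, pow_add, mul_div_mul_comm]) hxy
    exact (hg.mem_or_mem this).imp (fun h => key N A hA h x hx) (fun h => key M B hB h y hy)
  · exact hsg (conv 0 (h s) _ (by simp) hmem)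

end BlowupAlgebra


/-! ### Differentials of a regular system of parameters -/

section SmoothLocal

open IsLocalRing TensorProduct

/-- Linear independence of exact differentials passes to the fraction field. -/
lemma linearIndependent_D_fractionRing {k R : Type u} [Field k] [CommRing R] [Algebra k R]
    {K : Type u} [Field K] [Algebra R K] [Algebra k K]
    [IsScalarTower k R K] [IsDomain R] [IsFractionRing R K] {ι : Type u} {y : ι → R}
    (hy : LinearIndependent R fun i => KaehlerDifferential.D k R (y i)) :
    LinearIndependent K fun i => KaehlerDifferential.D k K (algebraMap R K (y i)) := by
  have h := hy.of_isLocalizedModule K (nonZeroDivisors R) (KaehlerDifferential.map k k R K)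
  have he : (KaehlerDifferential.map k k R K ∘ fun i => KaehlerDifferential.D k R (y i)) =
      fun i => KaehlerDifferential.D k K (algebraMap R K (y i)) := by
    funext i
    simp
  rwa [he] at h

variable {k R : Type u} [Field k] [CommRing R] [IsLocalRing R] [IsNoetherianRing R] [Algebra k R]

/-- Over a perfect field, the differentials of a regular system of parameters are linearly
independent modulo the maximal ideal: the residue field is formally smooth, so the cotangent space
embeds into the fibre of the module of differentials. -/
lemma linearIndependent_D_of_regularSystem [PerfectField k] [Algebra.EssFiniteType k R]
    [Algebra.FormallySmooth k R] {n : ℕ} (t : Fin n → R) (hdim : ringKrullDim R = n)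
    (ht : Ideal.span (Set.range t) = maximalIdeal R) :
    LinearIndependent (ResidueField R)
      (fun i => (1 : ResidueField R) ⊗ₜ[R] KaehlerDifferential.D k R (t i)) := by
  have : Algebra.EssFiniteType k (ResidueField R) :=
    inferInstanceAs (Algebra.EssFiniteType k (R ⧸ maximalIdeal R))
  have hsurj : Function.Surjective (algebraMap R (ResidueField R)) := residue_surjective
  obtain ⟨l, hl⟩ := (Algebra.FormallySmooth.iff_split_injection (R := k) hsurj).mp
    inferInstance
  have hinj : Function.Injective
      (KaehlerDifferential.kerCotangentToTensor k R (ResidueField R)) :=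
    Function.LeftInverse.injective (g := l) fun x => DFunLike.congr_fun hl x
  have hker : RingHom.ker (algebraMap R (ResidueField R)) = maximalIdeal R := ker_residue
  rw [Fintype.linearIndependent_iff]
  intro a ha
  choose α hα using fun i => hsurj (a i)
  have htm : ∀ i, t i ∈ RingHom.ker (algebraMap R (ResidueField R)) := fun i => by
    rw [hker, ← ht]; exact Ideal.subset_span ⟨i, rfl⟩
  have h2 : ∑ i, α i * t i ∈ maximalIdeal R ^ 2 := by
    have h0 : Ideal.toCotangent _ (∑ i, α i • (⟨t i, htm i⟩ :
        RingHom.ker (algebraMap R (ResidueField R)))) = 0 := by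
      apply hinj
      rw [map_zero, ← ha]
      simp only [map_sum, map_smul, KaehlerDifferential.kerCotangentToTensor_toCotangent]
      refine Finset.sum_congr rfl fun i _ => ?_
      rw [← hα, algebraMap_smul]
    rw [Ideal.toCotangent_eq_zero] at h0
    have h3 : ∑ i, α i * t i ∈ RingHom.ker (algebraMap R (ResidueField R)) ^ 2 := by
      rwa [AddSubmonoidClass.coe_finsetSum] at h0
    rwa [hker] at h3
  intro j
  by_contra hj
  have hu : IsUnit (α j) := by
    by_contra hn
    exact hj ((hα j).symm.trans ((residue_eq_zero_iff _).mpr hn))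
  -- otherwise `t j` would be redundant modulo the square of the maximal ideal
  refine notMem_span_of_regularSystem t hdim ht (Finset.univ.erase j) (Finset.notMem_erase _ _) ?_
  set N := Ideal.span (t '' (Finset.univ.erase j : Finset (Fin n))) with hN
  have hmem : ∀ i, i ≠ j → t i ∈ N := fun i hi => Ideal.subset_span ⟨i, by simpa using hi, rfl⟩
  have hle : maximalIdeal R ≤ N ⊔ maximalIdeal R • maximalIdeal R := by
    conv_lhs => rw [← ht]
    rw [Ideal.span_le]
    rintro _ ⟨i, rfl⟩
    by_cases hi : i = j
    · subst hi
      rw [SetLike.mem_coe, ← Ideal.unit_mul_mem_iff_mem _ hu]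
      have : α i * t i = ∑ i, α i * t i - ∑ l ∈ Finset.univ.erase i, α l * t l := by
        rw [← Finset.add_sum_erase _ _ (Finset.mem_univ i)]; ring
      rw [this, smul_eq_mul, ← sq]
      exact Ideal.sub_mem _ (Ideal.mem_sup_right h2) (Ideal.mem_sup_left
        (Ideal.sum_mem _ fun l hl => Ideal.mul_mem_left _ _ (hmem l (Finset.ne_of_mem_erase hl))))
    · exact Ideal.mem_sup_left (hmem i hi)
  have := Submodule.le_of_le_smul_of_le_jacobson_bot (IsNoetherian.noetherian _)
    (maximalIdeal_le_jacobson _) hle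
  apply this
  rw [← ht]
  exact Ideal.subset_span ⟨j, rfl⟩

/-- Over a perfect field, the differentials of a regular system of parameters of a smooth local
ring extend to a basis of the module of differentials consisting of exact differentials. -/
theorem exists_basis_D_of_regularSystem [PerfectField k] [Algebra.EssFiniteType k R]
    [Algebra.FormallySmooth k R] {n : ℕ} (t : Fin n → R) (hdim : ringKrullDim R = n)
    (ht : Ideal.span (Set.range t) = maximalIdeal R) :
    ∃ (ι : Type u) (_ : Finite ι) (y : ι → R) (c : Fin n → ι) (b : Module.Basis ι R Ω[R⁄k]),
      Function.Injective c ∧ (∀ i, y (c i) = t i) ∧ ∀ i, b i = KaehlerDifferential.D k R (y i) := by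
  classical
  have hli := linearIndependent_D_of_regularSystem (k := k) t hdim ht
  set δ : R → ResidueField R ⊗[R] Ω[R⁄k] := fun r => 1 ⊗ₜ[R] KaehlerDifferential.D k R r with hδ
  have hinj : Function.Injective (fun i => δ (t i)) := hli.injective
  obtain ⟨b, hbt, hsb, hspan, hbli⟩ := exists_linearIndepOn_id_extension
    (s := Set.range fun i => δ (t i)) (t := Set.range δ) hli.linearIndepOn_id
    (by rintro _ ⟨i, rfl⟩; exact ⟨_, rfl⟩)
  choose g hg using hbt
  let y : b → R := fun z => if h : ∃ i, δ (t i) = z.1 then t h.choose else g z.2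
  have hy : ∀ z : b, δ (y z) = z.1 := by
    intro z
    by_cases h : ∃ i, δ (t i) = z.1
    · simp only [y, dif_pos h]; exact h.choose_spec
    · simp only [y, dif_neg h]; exact hg z.2
  have hspan' : Submodule.span (ResidueField R) (Set.range δ) = ⊤ := by
    rw [eq_top_iff]
    rintro x -
    induction x using TensorProduct.induction_on with
    | zero => exact Submodule.zero_mem _
    | add x y hx hy => exact Submodule.add_mem _ hx hy
    | tmul a ω =>
      have hω : ω ∈ Submodule.span R (Set.range (KaehlerDifferential.D k R)) := by
        rw [KaehlerDifferential.span_range_derivation]; trivial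
      induction hω using Submodule.span_induction with
      | mem _ h =>
        obtain ⟨r, rfl⟩ := h
        rw [← mul_one a, ← smul_eq_mul, ← TensorProduct.smul_tmul']
        exact Submodule.smul_mem _ _ (Submodule.subset_span ⟨r, rfl⟩)
      | zero => rw [TensorProduct.tmul_zero]; exact Submodule.zero_mem _
      | add _ _ _ _ h1 h2 => rw [TensorProduct.tmul_add]; exact Submodule.add_mem _ h1 h2
      | smul r _ _ h =>
        rw [TensorProduct.tmul_smul, ← algebraMap_smul (ResidueField R)]
        exact Submodule.smul_mem _ _ h
  obtain ⟨B, hB⟩ := Module.exists_basis_of_basis_baseChange (R := R) (M := Ω[R⁄k])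
    (fun z : b => KaehlerDifferential.D k R (y z)) (by
      have : (TensorProduct.mk R (ResidueField R) Ω[R⁄k] 1 ∘
          fun z : b => KaehlerDifferential.D k R (y z)) = Subtype.val := funext hy
      rw [this]; exact hbli) (by
      have : (TensorProduct.mk R (ResidueField R) Ω[R⁄k] 1 ∘
          fun z : b => KaehlerDifferential.D k R (y z)) = Subtype.val := funext hy
      rw [this, Subtype.range_coe, eq_top_iff, ← hspan']
      exact Submodule.span_le.mpr hspan)
    (Module.Flat.rTensor_preserves_injective_linearMap (maximalIdeal R).subtype
      Subtype.val_injective)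
  refine ⟨b, Module.Finite.finite_basis B, y, fun i => ⟨δ (t i), hsb ⟨i, rfl⟩⟩, B, ?_, ?_, hB⟩
  · intro i j hij
    exact hinj (congrArg Subtype.val hij)
  · intro i
    have h : ∃ j, δ (t j) = δ (t i) := ⟨i, rfl⟩
    simp only [y, dif_pos h]
    exact congrArg t (hinj h.choose_spec)

end SmoothLocal


/-! ### Stalks of ideal sheaves -/

section StalkIdeal

variable {X Y : Scheme.{u}}

lemma stalkIdeal_eq_map (I : X.IdealSheafData) {x : X} (U : X.affineOpens) (hx : x ∈ U.1) :
    stalkIdeal I x = (I.ideal U).map (X.presheaf.germ U.1 x hx).hom := by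
  have key : ∀ (V W : X.affineOpens) (hW : W ≤ V) (hx : x ∈ W.1),
      (I.ideal V).map (X.presheaf.germ V.1 x (hW hx)).hom =
        (I.ideal W).map (X.presheaf.germ W.1 x hx).hom := by
    intro V W hW hx
    rw [← I.map_ideal hW, Ideal.map_map, ← CommRingCat.hom_comp]
    exact congrArg (fun t => Ideal.map (CommRingCat.Hom.hom t) (I.ideal V))
      (TopCat.Presheaf.germ_res X.presheaf (homOfLE hW) x hx).symm
  refine le_antisymm (iSup₂_le fun V hV => ?_) (le_iSup₂_of_le U hx le_rfl)
  obtain ⟨W, hW, hxW, hle⟩ := Opens.isBasis_iff_nbhd.mp X.isBasis_affineOpens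
    (show x ∈ U.1 ⊓ V.1 from ⟨hx, hV⟩)
  rw [key V ⟨W, hW⟩ (hle.trans inf_le_right) hxW, key U ⟨W, hW⟩ (hle.trans inf_le_left) hxW]

/-- An element of the stalk of an ideal sheaf extends to a section on a small affine open. -/
lemma exists_mem_ideal_of_mem_stalkIdeal (I : X.IdealSheafData) {x : X} {O : X.Opens}
    (hxO : x ∈ O) {h : X.presheaf.stalk x} (hh : h ∈ stalkIdeal I x) :
    ∃ (U : X.affineOpens) (hx : x ∈ U.1) (a : Γ(X, U.1)), U.1 ≤ O ∧ a ∈ I.ideal U ∧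
      X.presheaf.germ U.1 x hx a = h := by
  obtain ⟨U, hU, hxU, hle⟩ := Opens.isBasis_iff_nbhd.mp X.isBasis_affineOpens hxO
  rw [stalkIdeal_eq_map I ⟨U, hU⟩ hxU] at hh
  let := X.presheaf.algebra_section_stalk ⟨x, hxU⟩
  have hloc := hU.isLocalization_stalk ⟨x, hxU⟩
  obtain ⟨⟨⟨a, ha⟩, s⟩, has⟩ :=
    (IsLocalization.mem_map_algebraMap_iff (hU.primeIdealOf ⟨x, hxU⟩).asIdeal.primeCompl _).mp hh
  have hsu : IsUnit (X.presheaf.germ U x hxU s.1) := IsLocalization.map_units _ s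
  have hxs : x ∈ X.basicOpen s.1 := (X.mem_basicOpen _ _ hxU).mpr hsu
  have hsu' : IsUnit (X.presheaf.map (homOfLE (X.basicOpen_le s.1)).op s.1) :=
    RingedSpace.isUnit_res_basicOpen _ _
  obtain ⟨r, hr⟩ := hsu'.exists_right_inv
  refine ⟨X.affineBasicOpen (U := ⟨U, hU⟩) s.1, hxs,
    X.presheaf.map (homOfLE (X.basicOpen_le s.1)).op a * r, (X.basicOpen_le s.1).trans hle, ?_, ?_⟩
  · refine Ideal.mul_mem_right _ _ ?_
    exact I.ideal_le_comap_ideal (V := ⟨U, hU⟩) (X.affineBasicOpen_le (V := ⟨U, hU⟩) s.1) ha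
  · have h1 : X.presheaf.germ U x hxU s.1 * X.presheaf.germ (X.basicOpen s.1) x hxs r = 1 := by
      have := congrArg (X.presheaf.germ (X.basicOpen s.1) x hxs) hr
      rw [map_mul, map_one, TopCat.Presheaf.germ_res_apply] at this
      exact this
    have h2 : h * X.presheaf.germ U x hxU s.1 = X.presheaf.germ U x hxU a := has
    change X.presheaf.germ (X.basicOpen s.1) x hxs _ = h
    rw [map_mul, TopCat.Presheaf.germ_res_apply]
    change X.presheaf.germ U x hxU a * _ = h
    rw [← h2, mul_assoc, h1, mul_one]

lemma mem_support_iff_stalkIdeal (I : X.IdealSheafData) (x : X) :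
    x ∈ I.support ↔ stalkIdeal I x ≤ IsLocalRing.maximalIdeal (X.presheaf.stalk x) := by
  obtain ⟨U, hU, hxU, -⟩ := Opens.isBasis_iff_nbhd.mp X.isBasis_affineOpens (Opens.mem_top x)
  rw [Scheme.IdealSheafData.mem_support_iff_of_mem (U := ⟨U, hU⟩) hxU,
    stalkIdeal_eq_map I ⟨U, hU⟩ hxU, Ideal.map_le_iff_le_comap, Scheme.mem_zeroLocus_iff]
  refine forall₂_congr fun f _ => ?_
  rw [X.mem_basicOpen _ _ hxU]
  rfl

lemma stalkIdeal_eq_top_iff (I : X.IdealSheafData) (x : X) :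
    stalkIdeal I x = ⊤ ↔ x ∉ I.support := by
  rw [mem_support_iff_stalkIdeal]
  refine ⟨fun h h' => ?_, fun h => by_contra fun h' => h (IsLocalRing.le_maximalIdeal h')⟩
  rw [h, top_le_iff] at h'
  exact (IsLocalRing.maximalIdeal.isMaximal _).ne_top h'

lemma stalkIdeal_iSup {ι : Sort*} (I : ι → X.IdealSheafData) (x : X) :
    stalkIdeal (⨆ i, I i) x = ⨆ i, stalkIdeal (I i) x := by
  obtain ⟨U, hU, hxU, -⟩ := Opens.isBasis_iff_nbhd.mp X.isBasis_affineOpens (Opens.mem_top x)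
  have h : (⨆ i, I i).ideal ⟨U, hU⟩ = ⨆ i, (I i).ideal ⟨U, hU⟩ := by
    rw [← iSup_plift_down I, ← iSup_plift_down fun i => (I i).ideal ⟨U, hU⟩,
      Scheme.IdealSheafData.ideal_iSup, iSup_apply]
  rw [stalkIdeal_eq_map _ ⟨U, hU⟩ hxU, h, Ideal.map_iSup]
  exact iSup_congr fun i => (stalkIdeal_eq_map (I i) ⟨U, hU⟩ hxU).symm

/-- Pulling back an ideal sheaf along a morphism of affine schemes extends the ideal. -/
lemma ideal_comap_top [IsAffine X] [IsAffine Y] (g : X ⟶ Y) (I : Y.IdealSheafData) :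
    (I.comap g).ideal ⟨⊤, isAffineOpen_top X⟩ =
      (I.ideal ⟨⊤, isAffineOpen_top Y⟩).map g.appTop.hom := by
  have key : ∀ L : X.IdealSheafData, I.comap g ≤ L ↔
      (I.ideal ⟨⊤, isAffineOpen_top Y⟩).map g.appTop.hom ≤ L.ideal ⟨⊤, isAffineOpen_top X⟩ := by
    intro L
    rw [← Scheme.IdealSheafData.le_map_iff_comap_le, Ideal.map_le_iff_le_comap]
    have : (L.map g).ideal ⟨⊤, isAffineOpen_top Y⟩ =
        (L.ideal ⟨⊤, isAffineOpen_top X⟩).comap g.appTop.hom :=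
      Scheme.IdealSheafData.ideal_map L g ⟨⊤, isAffineOpen_top Y⟩ (isAffineOpen_top X)
    rw [← this]
    exact ⟨fun h => h _, fun h => Scheme.IdealSheafData.le_of_isAffine h⟩
  apply le_antisymm
  · have := (key (Scheme.IdealSheafData.ofIdealTop
      ((I.ideal ⟨⊤, isAffineOpen_top Y⟩).map g.appTop.hom))).mpr (by simp)
    simpa using this ⟨⊤, isAffineOpen_top X⟩
  · exact (key _).mp le_rfl

lemma stalkIdeal_comap_of_isAffine [IsAffine X] [IsAffine Y] (g : X ⟶ Y) (I : Y.IdealSheafData)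
    (x : X) : stalkIdeal (I.comap g) x = (stalkIdeal I (g x)).map (g.stalkMap x).hom := by
  rw [stalkIdeal_eq_map _ ⟨⊤, isAffineOpen_top X⟩ (Opens.mem_top x),
    stalkIdeal_eq_map _ ⟨⊤, isAffineOpen_top Y⟩ (Opens.mem_top (g x)), ideal_comap_top,
    Ideal.map_map, Ideal.map_map, ← CommRingCat.hom_comp, ← CommRingCat.hom_comp,
    Scheme.Hom.germ_stalkMap]
  rfl

lemma stalkIdeal_comap_of_isOpenImmersion (g : X ⟶ Y) [IsOpenImmersion g] (I : Y.IdealSheafData)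
    (x : X) : stalkIdeal (I.comap g) x = (stalkIdeal I (g x)).map (g.stalkMap x).hom := by
  obtain ⟨U, hU, hxU, -⟩ := Opens.isBasis_iff_nbhd.mp X.isBasis_affineOpens (Opens.mem_top x)
  have hxU' : g x ∈ g ''ᵁ U := ⟨x, hxU, rfl⟩
  rw [stalkIdeal_eq_map _ ⟨U, hU⟩ hxU,
    stalkIdeal_eq_map _ ⟨g ''ᵁ U, hU.image_of_isOpenImmersion g⟩ hxU',
    Scheme.IdealSheafData.ideal_comap_of_isOpenImmersion]
  have : (I.ideal ⟨g ''ᵁ U, hU.image_of_isOpenImmersion g⟩).comap (g.appIso U).inv.hom =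
      (I.ideal ⟨g ''ᵁ U, hU.image_of_isOpenImmersion g⟩).map (g.appIso U).hom.hom := by
    exact (Ideal.map_comap_of_equiv (g.appIso U).commRingCatIsoToRingEquiv).symm
  rw [this, Ideal.map_map, Ideal.map_map, ← CommRingCat.hom_comp, ← CommRingCat.hom_comp]
  refine congrArg (fun t => Ideal.map (CommRingCat.Hom.hom t) _) ?_
  rw [Scheme.Hom.appIso_hom', Scheme.Hom.germ_stalkMap, Scheme.Hom.appLE, Category.assoc]
  exact congrArg _ (X.presheaf.germ_res _ _ _)

lemma stalkIdeal_comap_comp {Z : Scheme.{u}} (f : X ⟶ Y) (g : Y ⟶ Z)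
    (hf : ∀ (I : Y.IdealSheafData) (x : X),
      stalkIdeal (I.comap f) x = (stalkIdeal I (f x)).map (f.stalkMap x).hom)
    (hg : ∀ (I : Z.IdealSheafData) (y : Y),
      stalkIdeal (I.comap g) y = (stalkIdeal I (g y)).map (g.stalkMap y).hom)
    (I : Z.IdealSheafData) (x : X) : stalkIdeal (I.comap (f ≫ g)) x =
      (stalkIdeal I ((f ≫ g) x)).map ((f ≫ g).stalkMap x).hom := by
  rw [Scheme.IdealSheafData.comap_comp, hf, hg, Ideal.map_map, ← CommRingCat.hom_comp]
  exact congrArg (fun t => Ideal.map (CommRingCat.Hom.hom t) _)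
    (Scheme.Hom.stalkMap_comp f g x).symm

lemma map_equiv_injective {A B : Type u} [CommRing A] [CommRing B] (e : A ≃+* B) :
    Function.Injective (Ideal.map (e : A →+* B)) := fun a b hab => by
  rw [← Ideal.map_of_equiv (I := a) e, ← Ideal.map_of_equiv (I := b) e, hab]

/-- The stalk of the inverse image of an ideal sheaf is the extension of the stalk. -/
lemma stalkIdeal_comap (g : X ⟶ Y) (I : Y.IdealSheafData) (x : X) :
    stalkIdeal (I.comap g) x = (stalkIdeal I (g x)).map (g.stalkMap x).hom := by
  obtain ⟨U, hU, hxU, -⟩ := Opens.isBasis_iff_nbhd.mp Y.isBasis_affineOpens (Opens.mem_top (g x))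
  obtain ⟨T, hT, hxT, hle⟩ := Opens.isBasis_iff_nbhd.mp X.isBasis_affineOpens
    (show x ∈ g ⁻¹ᵁ U from hxU)
  have : IsAffine U := hU
  have : IsAffine T := hT
  let ιT := Scheme.Opens.ι (X := X) T
  let ιU := Scheme.Opens.ι (X := Y) U
  obtain ⟨z, rfl⟩ : ∃ z : (T : Scheme.{u}), ιT z = x := ⟨⟨x, hxT⟩, rfl⟩
  have h0 : g.resLE U T hle ≫ ιU = ιT ≫ g := Scheme.Hom.resLE_comp_ι g hle
  have h1 := stalkIdeal_comap_comp (g.resLE U T hle) ιU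
    (stalkIdeal_comap_of_isAffine _) (stalkIdeal_comap_of_isOpenImmersion _) I z
  rw [h0, Scheme.IdealSheafData.comap_comp, stalkIdeal_comap_of_isOpenImmersion] at h1
  have h3 := h1.trans (congrArg (fun t => Ideal.map (CommRingCat.Hom.hom t)
    (stalkIdeal I ((ιT ≫ g) z))) (Scheme.Hom.stalkMap_comp ιT g z))
  let e := (asIso (ιT.stalkMap z)).commRingCatIsoToRingEquiv
  have h2 : Function.Injective (Ideal.map (ιT.stalkMap z).hom) :=
    map_equiv_injective e
  exact h2 (h3.trans (Ideal.map_map (g.stalkMap (ιT z)).hom (ιT.stalkMap z).hom).symm)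

/-- The ideal of an effective Cartier divisor in a local ring is generated by a nonzerodivisor. -/
lemma IsEffectiveCartier.exists_stalkIdeal_eq {I : X.IdealSheafData} (hI : IsEffectiveCartier I)
    (x : X) : ∃ a ∈ nonZeroDivisors (X.presheaf.stalk x), stalkIdeal I x = Ideal.span {a} := by
  obtain ⟨U, hxU, f, hf, hI⟩ := hI x
  let := X.presheaf.algebra_section_stalk ⟨x, hxU⟩
  have hloc := U.2.isLocalization_stalk ⟨x, hxU⟩
  refine ⟨X.presheaf.germ U.1 x hxU f, ?_, ?_⟩
  · exact IsLocalization.map_nonZeroDivisors_le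
      (U.2.primeIdealOf ⟨x, hxU⟩).asIdeal.primeCompl (X.presheaf.stalk x) ⟨f, hf, rfl⟩
  · rw [stalkIdeal_eq_map I U hxU, hI, Ideal.map_span, Set.image_singleton]

/-- The closed point of the spectrum of a local ring `D`: its local ring is `D`, every global
section comes from it, and local morphisms out of `Spec D` are described by it. -/
lemma exists_closedPoint_stalkIso {D : CommRingCat.{u}} [IsLocalRing D] (x : X)
    (ψ : X.presheaf.stalk x ⟶ D) [IsLocalHom ψ.hom] :
    ∃ (c : Spec D) (e : (Spec D).presheaf.stalk c ≅ D),
      IsIso ((Spec D).presheaf.germ ⊤ c (Opens.mem_top _)) ∧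
      (Spec.map ψ ≫ X.fromSpecStalk x) c = x ∧
      ∀ (U : X.Opens) (hU : (Spec.map ψ ≫ X.fromSpecStalk x) c ∈ U) (hx : x ∈ U),
        X.presheaf.germ U _ hU ≫ (Spec.map ψ ≫ X.fromSpecStalk x).stalkMap c ≫ e.hom =
          X.presheaf.germ U x hx ≫ ψ := by
  refine ⟨IsLocalRing.closedPoint D, stalkClosedPointIso D, ?_, ?_, ?_⟩
  · have h := ΓSpecIso_hom_stalkClosedPointIso_inv D
    exact h ▸ (inferInstance : IsIso ((Scheme.ΓSpecIso D).hom ≫ (stalkClosedPointIso D).inv))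
  · have h : Spec.map ψ (IsLocalRing.closedPoint D) =
        IsLocalRing.closedPoint (X.presheaf.stalk x) := IsLocalRing.comap_closedPoint ψ.hom
    exact (congrArg (X.fromSpecStalk x) h).trans Scheme.fromSpecStalk_closedPoint
  · intro U hU hx
    exact Scheme.germ_stalkClosedPointTo_Spec_fromSpecStalk ψ U hU

lemma map_eq_span_singleton_symm {A B : Type u} [CommRing A] [CommRing B] (e : A ≃+* B)
    {I : Ideal A} {b : B} (h : I.map (e : A →+* B) = Ideal.span {b}) :
    I = Ideal.span {e.symm b} := by
  have h2 := congrArg (Ideal.map (e.symm : B →+* A)) h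
  rw [Ideal.map_of_equiv, Ideal.map_span, Set.image_singleton] at h2
  exact h2

lemma symm_mem_nonZeroDivisors {A B : Type u} [CommRing A] [CommRing B] (e : A ≃+* B)
    {b : B} (h : b ∈ nonZeroDivisors B) : e.symm b ∈ nonZeroDivisors A :=
  (MulEquivClass.map_nonZeroDivisors (e.symm : B ≃* A)) ▸ ⟨b, h, rfl⟩

/-- A local morphism from the spectrum of a local ring to a scheme pulls an ideal sheaf back to an
effective Cartier divisor if the extended ideal is generated by a nonzerodivisor. -/
lemma isEffectiveCartier_comap_spec {D : CommRingCat.{u}} [IsLocalRing D] (I : X.IdealSheafData)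
    (x : X) (ψ : X.presheaf.stalk x ⟶ D) [IsLocalHom ψ.hom] {a : D} (ha : a ∈ nonZeroDivisors D)
    (hI : (stalkIdeal I x).map ψ.hom = Ideal.span {a}) :
    IsEffectiveCartier (I.comap (Spec.map ψ ≫ X.fromSpecStalk x)) := by
  obtain ⟨c, e, hiso, hcx, he⟩ := exists_closedPoint_stalkIso x ψ
  set g := Spec.map ψ ≫ X.fromSpecStalk x with hg
  obtain ⟨U, hU, hxU, -⟩ := Opens.isBasis_iff_nbhd.mp X.isBasis_affineOpens (Opens.mem_top (g c))
  have hxU' : x ∈ U := hcx ▸ hxU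
  let e₁ := (asIso ((Spec D).presheaf.germ ⊤ c (Opens.mem_top _))).commRingCatIsoToRingEquiv
  let e₂ := e.commRingCatIsoToRingEquiv
  have h1 : (stalkIdeal (I.comap g) c).map (e₂ : _ →+* _) = Ideal.span {a} := by
    rw [stalkIdeal_comap, stalkIdeal_eq_map I ⟨U, hU⟩ hxU, Ideal.map_map, Ideal.map_map, ← hI,
      stalkIdeal_eq_map I ⟨U, hU⟩ hxU', Ideal.map_map]
    exact congrArg (fun t => Ideal.map (CommRingCat.Hom.hom t) (I.ideal ⟨U, hU⟩)) (he U hxU hxU')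
  have h2 := map_eq_span_singleton_symm e₂ h1
  rw [stalkIdeal_eq_map _ ⟨⊤, isAffineOpen_top _⟩ (Opens.mem_top _)] at h2
  have h3 := map_eq_span_singleton_symm e₁ h2
  intro y
  exact ⟨⟨⊤, isAffineOpen_top _⟩, Opens.mem_top y, _,
    symm_mem_nonZeroDivisors e₁ (symm_mem_nonZeroDivisors e₂ ha), h3⟩

end StalkIdeal


/-! ### Local rings of blowups -/

section BlowupLocal

/-- A ring homomorphism `ψ : R → O` extends to a subalgebra `C` of `R[1/a]` as soon as the images
of the elements of `C` can be divided by powers of the nonzerodivisor `ψ a`. -/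
lemma exists_ringHom_extend {R K O : Type u} [CommRing R] [Field K] [Algebra R K] [FaithfulSMul R K]
    [CommRing O] (ψ : R →+* O) (a : R) (ha : ψ a ∈ nonZeroDivisors O) (C : Subalgebra R K)
    (hC : ∀ x ∈ C, ∃ (N : ℕ) (A : R) (y : O), x * algebraMap R K a ^ N = algebraMap R K A ∧
      ψ A = ψ a ^ N * y) :
    ∃ θ : C →+* O, ∀ r, θ (algebraMap R C r) = ψ r := by
  have hinj : Function.Injective (algebraMap R K) := FaithfulSMul.algebraMap_injective R K
  let Rel : K → O → Prop := fun x y => ∃ (N : ℕ) (A : R),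
    x * algebraMap R K a ^ N = algebraMap R K A ∧ ψ A = ψ a ^ N * y
  have huniq : ∀ x y y', Rel x y → Rel x y' → y = y' := by
    rintro x y y' ⟨N, A, hA, hy⟩ ⟨M, A', hA', hy'⟩
    have h1 : A * a ^ M = A' * a ^ N := by
      apply hinj
      rw [map_mul, map_mul, map_pow, map_pow, ← hA, ← hA']
      ring
    have h2 : ψ a ^ (N + M) * (y - y') = 0 := by
      have := congrArg ψ h1
      rw [map_mul, map_mul, map_pow, map_pow, hy, hy'] at this
      rw [pow_add]
      linear_combination this
    exact sub_eq_zero.mp ((mul_left_mem_nonZeroDivisors_eq_zero_iff (pow_mem ha _)).mp h2)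
  have hadd : ∀ {x x' y y'}, Rel x y → Rel x' y' → Rel (x + x') (y + y') := by
    rintro x x' y y' ⟨N, A, hA, hy⟩ ⟨M, A', hA', hy'⟩
    refine ⟨N + M, A * a ^ M + A' * a ^ N, ?_, ?_⟩
    · simp only [map_add, map_mul, map_pow, ← hA, ← hA']; ring
    · simp only [map_add, map_mul, map_pow, hy, hy']; ring
  have hmul : ∀ {x x' y y'}, Rel x y → Rel x' y' → Rel (x * x') (y * y') := by
    rintro x x' y y' ⟨N, A, hA, hy⟩ ⟨M, A', hA', hy'⟩
    refine ⟨N + M, A * A', ?_, ?_⟩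
    · simp only [map_mul, ← hA, ← hA']; ring
    · simp only [map_mul, hy, hy']; ring
  have halg : ∀ r, Rel (algebraMap R K r) (ψ r) := fun r => ⟨0, r, by simp, by simp⟩
  have hex : ∀ x : C, ∃ y, Rel x y := fun x => by
    obtain ⟨N, A, y, h⟩ := hC x x.2
    exact ⟨y, N, A, h⟩
  choose f hf using hex
  refine ⟨{ toFun := f, map_one' := ?_, map_mul' := ?_, map_zero' := ?_, map_add' := ?_ }, ?_⟩
  · exact huniq _ _ _ (hf 1) (by simpa using halg 1)
  · exact fun x y => huniq _ _ _ (hf (x * y)) (hmul (hf x) (hf y))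
  · exact huniq _ _ _ (hf 0) (by simpa using halg 0)
  · exact fun x y => huniq _ _ _ (hf (x + y)) (hadd (hf x) (hf y))
  · exact fun r => huniq _ _ _ (hf (algebraMap R C r)) (halg r)

/-- In a local ring, an ideal that is generated by one nonzerodivisor is generated by a member of
any given generating family. -/
lemma exists_span_singleton_eq_of_isPrincipal {O : Type u} [CommRing O] [IsLocalRing O] {J : Type w}
    (f : J → O) (S : Set J) {a : O} (ha : a ∈ nonZeroDivisors O)
    (h : Ideal.span (f '' S) = Ideal.span {a}) :
    ∃ s ∈ S, Ideal.span (f '' S) = Ideal.span {f s} ∧ f s ∈ nonZeroDivisors O := by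
  by_cases hu : ∃ s ∈ S, ∃ u : O, IsUnit u ∧ f s = a * u
  · obtain ⟨s, hs, u, hu, hsu⟩ := hu
    refine ⟨s, hs, ?_, ?_⟩
    · rw [h, hsu, Ideal.span_singleton_mul_right_unit hu]
    · rw [hsu]; exact mul_mem ha hu.mem_nonZeroDivisors
  · exfalso
    push Not at hu
    have hle : Ideal.span (f '' S) ≤ Ideal.span {a} * IsLocalRing.maximalIdeal O := by
      rw [Ideal.span_le]
      rintro _ ⟨s, hs, rfl⟩
      have h1 : f s ∈ Ideal.span {a} := by rw [← h]; exact Ideal.subset_span ⟨s, hs, rfl⟩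
      obtain ⟨u, hsu⟩ := Ideal.mem_span_singleton.mp h1
      exact Ideal.mem_span_singleton_mul.mpr ⟨u, fun hu' => hu s hs u hu' hsu, hsu.symm⟩
    have h2 : a ∈ Ideal.span {a} * IsLocalRing.maximalIdeal O :=
      hle (by rw [h]; exact Ideal.mem_span_singleton_self a)
    obtain ⟨u, hu, hau⟩ := Ideal.mem_span_singleton_mul.mp h2
    have h3 : a * (u - 1) = 0 := by rw [mul_sub, hau]; ring
    have h4 : u = 1 := sub_eq_zero.mp ((mul_left_mem_nonZeroDivisors_eq_zero_iff ha).mp h3)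
    exact hu (h4 ▸ isUnit_one)

/-- A morphism from the spectrum of a local ring factors through the local ring at the image of the
closed point. -/
lemma exists_factor_fromSpecStalk {W : Scheme.{u}} {D : CommRingCat.{u}} [IsLocalRing D]
    (l : Spec D ⟶ W) {w : W} (hw : l (IsLocalRing.closedPoint D) = w) :
    ∃ τ : W.presheaf.stalk w ⟶ D, l = Spec.map τ ≫ W.fromSpecStalk w := by
  subst hw
  exact ⟨_, (Scheme.Spec_stalkClosedPointTo_fromSpecStalk l).symm⟩

/-- The universal property of the blowup, for morphisms from spectra of local rings: a local ring
`D` between the local rings of the center and of the blowup in which the center becomes a Cartier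
divisor has a section of its map to the local ring of the blowup. -/
lemma IsBlowup.exists_section {V W : Scheme.{u}} {π : W ⟶ V} {B : V.IdealSheafData}
    (hπ : IsBlowup π B) (w : W) {D : CommRingCat.{u}} [IsLocalRing D]
    (ψ : V.presheaf.stalk (π w) ⟶ D) [IsLocalHom ψ.hom] (χ : D ⟶ W.presheaf.stalk w)
    [IsLocalHom χ.hom] (hψχ : ψ ≫ χ = π.stalkMap w) {a : D} (ha : a ∈ nonZeroDivisors D)
    (hI : (stalkIdeal B (π w)).map ψ.hom = Ideal.span {a}) :
    ∃ τ : W.presheaf.stalk w ⟶ D, τ ≫ χ = 𝟙 _ ∧ π.stalkMap w ≫ τ = ψ := by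
  obtain ⟨l, hl, -⟩ := hπ.existsUnique_lift (Spec.map ψ ≫ V.fromSpecStalk (π w))
    (isEffectiveCartier_comap_spec B (π w) ψ ha hI)
  obtain ⟨b, hb, hbB⟩ := hπ.isEffectiveCartier_comap.exists_stalkIdeal_eq w
  have hcart : IsEffectiveCartier (B.comap (Spec.map (π.stalkMap w) ≫ V.fromSpecStalk (π w))) :=
    isEffectiveCartier_comap_spec B (π w) (π.stalkMap w) hb (by rw [← stalkIdeal_comap, hbB])
  have h1 : Spec.map χ ≫ l = W.fromSpecStalk w := by
    refine (hπ.existsUnique_lift _ hcart).unique ?_ (Scheme.SpecMap_stalkMap_fromSpecStalk π).symm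
    rw [Category.assoc, hl, ← Category.assoc, ← Spec.map_comp, hψχ]
  have h2 : l (IsLocalRing.closedPoint D) = w := by
    have h3 : Spec.map χ (IsLocalRing.closedPoint (W.presheaf.stalk w)) =
        IsLocalRing.closedPoint D := IsLocalRing.comap_closedPoint χ.hom
    refine (congrArg l h3.symm).trans ((Scheme.Hom.comp_apply _ _ _).symm.trans ?_)
    rw [h1]
    exact Scheme.fromSpecStalk_closedPoint
  obtain ⟨τ, hτ⟩ := exists_factor_fromSpecStalk l h2
  refine ⟨τ, ?_, ?_⟩
  · apply Spec.map_injective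
    rw [← cancel_mono (W.fromSpecStalk w), Spec.map_comp, Category.assoc, ← hτ, h1, Spec.map_id,
      Category.id_comp]
  · apply Spec.map_injective
    rw [← cancel_mono (V.fromSpecStalk (π w)), Spec.map_comp, Category.assoc,
      Scheme.SpecMap_stalkMap_fromSpecStalk, ← Category.assoc, ← hτ, hl]

/-- A local homomorphism `χ : C_q → O` from a localization of a subalgebra `C` of `R[1/a]` with a
section over `R` is an isomorphism. -/
lemma isLocalization_of_section {R K O : Type u} [CommRing R] [Field K] [Algebra R K]
    [FaithfulSMul R K] [CommRing O] {ψ : R →+* O} {a : R} (ha : a ≠ 0) {C : Subalgebra R K}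
    (hC : ∀ x ∈ C, ∃ (N : ℕ) (A : R), x * algebraMap R K a ^ N = algebraMap R K A)
    (θ : C →+* O) (hθ : ∀ r, θ (algebraMap R C r) = ψ r) (q : Ideal C) [q.IsPrime]
    (χ : Localization.AtPrime q →+* O)
    (hχ : ∀ c, χ (algebraMap C _ c) = θ c) (τ : O →+* Localization.AtPrime q)
    (hτχ : ∀ x, χ (τ x) = x) (hτ : ∀ r, τ (ψ r) = algebraMap C _ (algebraMap R C r)) :
    @IsLocalization.AtPrime _ _ O _ θ.toAlgebra q inferInstance := by
  have hinj : Function.Injective (algebraMap R K) := FaithfulSMul.algebraMap_injective R K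
  have hDdom : IsDomain (Localization.AtPrime q) :=
    IsLocalization.isDomain_of_local_atPrime inferInstance
  have hDinj : Function.Injective (algebraMap C (Localization.AtPrime q)) :=
    IsLocalization.injective _ q.primeCompl_le_nonZeroDivisors
  have ha' : algebraMap C (Localization.AtPrime q) (algebraMap R C a) ≠ 0 := fun h0 => by
    have h1 : algebraMap R C a = 0 := hDinj (by rw [h0, map_zero])
    exact ha (hinj ((congrArg Subtype.val h1).trans (map_zero _).symm))
  have hχτ : τ.comp χ = RingHom.id _ := by
    refine IsLocalization.ringHom_ext q.primeCompl (RingHom.ext fun x => ?_)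
    obtain ⟨N, A, hA⟩ := hC x x.2
    have hA' : x * algebraMap R C a ^ N = algebraMap R C A := Subtype.ext hA
    simp only [RingHom.comp_apply, RingHom.id_apply, hχ]
    apply mul_right_cancel₀ (pow_ne_zero N ha')
    rw [← map_pow, ← map_mul, hA', map_pow, ← hτ, ← map_pow, ← map_mul, ← hθ a, ← map_pow,
      ← map_mul, hA', hθ, hτ]
  let e : Localization.AtPrime q ≃+* O := RingEquiv.ofRingHom χ τ (RingHom.ext hτχ) hχτ
  let := θ.toAlgebra
  exact IsLocalization.isLocalization_of_algEquiv q.primeCompl (AlgEquiv.ofRingEquiv (f := e) hχ)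

/-- The local ring of the blowup at `w` is a localization of the coordinate ring of a chart of the
blowup of the local ring at `π w`. Both are compared by the universal property: the localized chart
has a morphism to the blowup, which gives the inverse. -/
theorem IsBlowup.exists_isLocalization {V W : Scheme.{u}} {π : W ⟶ V}
    {B : V.IdealSheafData} (hπ : IsBlowup π B) (w : W) (K : Type u) [Field K]
    [Algebra (V.presheaf.stalk (π w)) K] [FaithfulSMul (V.presheaf.stalk (π w)) K] {J : Type w}
    (h : J → V.presheaf.stalk (π w)) (S : Set J)
    (hB : stalkIdeal B (π w) = Ideal.span (h '' S)) :
    ∃ s ∈ S, h s ≠ 0 ∧ stalkIdeal (B.comap π) w = Ideal.span {(π.stalkMap w).hom (h s)} ∧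
      ∃ θ : blowupAlgebra K h S s →+* W.presheaf.stalk w,
        (∀ r, θ (algebraMap _ _ r) = (π.stalkMap w).hom r) ∧
        @IsLocalization.AtPrime _ _ (W.presheaf.stalk w) _ θ.toAlgebra
          ((IsLocalRing.maximalIdeal (W.presheaf.stalk w)).comap θ) inferInstance := by
  have hinj : Function.Injective (algebraMap (V.presheaf.stalk (π w)) K) :=
    FaithfulSMul.algebraMap_injective _ _
  obtain ⟨a, ha, haB⟩ := hπ.isEffectiveCartier_comap.exists_stalkIdeal_eq w
  have hmap : stalkIdeal (B.comap π) w = Ideal.span (((π.stalkMap w).hom ∘ h) '' S) := by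
    rw [stalkIdeal_comap, hB, Ideal.map_span, Set.image_image]
    rfl
  rw [hmap] at haB
  obtain ⟨s, hs, hsp, hsn⟩ :=
    exists_span_singleton_eq_of_isPrincipal ((π.stalkMap w).hom ∘ h) S ha haB
  have hs0 : h s ≠ 0 := fun h0 => by
    rw [Function.comp_apply, h0, map_zero] at hsn
    exact zero_notMem_nonZeroDivisors hsn
  have hs0' : algebraMap (V.presheaf.stalk (π w)) K (h s) ≠ 0 := fun h0 =>
    hs0 (hinj (h0.trans (map_zero _).symm))
  refine ⟨s, hs, hs0, hmap.trans hsp, ?_⟩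
  have hexp : ∀ x ∈ blowupAlgebra K h S s, ∃ (N : ℕ) (A : V.presheaf.stalk (π w)),
      A ∈ Ideal.span (h '' S) ^ N ∧ x * algebraMap _ K (h s) ^ N = algebraMap _ K A := by
    intro x hx
    obtain ⟨N, A, hA, rfl⟩ := exists_eq_div_pow_of_mem_blowupAlgebra hs hs0' hx
    exact ⟨N, A, hA, div_mul_cancel₀ _ (pow_ne_zero _ hs0')⟩
  obtain ⟨θ, hθ⟩ := exists_ringHom_extend (π.stalkMap w).hom (h s) hsn (blowupAlgebra K h S s) (by
    intro x hx
    obtain ⟨N, A, hA, hxA⟩ := hexp x hx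
    have h1 : (π.stalkMap w).hom A ∈ Ideal.span {(π.stalkMap w).hom (h s)} ^ N := by
      have := Ideal.mem_map_of_mem (π.stalkMap w).hom hA
      rw [Ideal.map_pow, Ideal.map_span, ← Set.image_comp, hsp] at this
      exact this
    rw [Ideal.span_singleton_pow, Ideal.mem_span_singleton] at h1
    obtain ⟨y, hy⟩ := h1
    exact ⟨N, A, y, hxA, hy⟩)
  refine ⟨θ, hθ, ?_⟩
  -- The prime of `w` is treated as an ideal `q` with a characteristic property, which keeps `comap`
  -- out of the types below.
  suffices key : ∀ (q : Ideal (blowupAlgebra K h S s)) (_ : q.IsPrime),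
      (∀ c, c ∈ q ↔ ¬ IsUnit (θ c)) →
      @IsLocalization.AtPrime _ _ (W.presheaf.stalk w) _ θ.toAlgebra q inferInstance from
    key _ inferInstance fun c => by
      rw [Ideal.mem_comap, IsLocalRing.mem_maximalIdeal, mem_nonunits_iff]
  intro q hqp hmem
  let χ : Localization.AtPrime q →+* W.presheaf.stalk w :=
    IsLocalization.lift (M := q.primeCompl) (g := θ) fun c => by
      by_contra hc
      exact c.2 ((hmem c).mpr hc)
  have hχ : ∀ c, χ (algebraMap _ _ c) = θ c := fun c => IsLocalization.lift_eq _ c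
  have hχl : IsLocalHom χ := ⟨fun x hx => by
    obtain ⟨c, t, rfl⟩ := IsLocalization.exists_mk'_eq q.primeCompl x
    rw [IsLocalization.AtPrime.isUnit_mk'_iff (Localization.AtPrime q) q]
    intro hc
    have h1 := congrArg χ (IsLocalization.mk'_spec (Localization.AtPrime q) c t)
    rw [map_mul, hχ, hχ] at h1
    refine (hmem c).mp hc ?_
    rw [← h1]
    refine hx.mul ?_
    by_contra ht
    exact t.2 ((hmem t).mpr ht)⟩
  -- The local homomorphism `𝒪_{V,π w} → C_q → 𝒪_{W,w}`, through which `W` is reached from `C_q`.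
  let ψD : V.presheaf.stalk (π w) →+* Localization.AtPrime q :=
    (algebraMap (blowupAlgebra K h S s) (Localization.AtPrime q)).comp (algebraMap _ _)
  have hψχ : χ.comp ψD = (π.stalkMap w).hom := RingHom.ext fun r => (hχ _).trans (hθ r)
  have hψl : IsLocalHom ψD := ⟨fun x hx => by
    have h1 := hx.map χ
    rw [← RingHom.comp_apply, hψχ] at h1
    exact isUnit_of_map_unit (π.stalkMap w).hom x h1⟩
  have hDdom : IsDomain (Localization.AtPrime q) :=
    IsLocalization.isDomain_of_local_atPrime inferInstance
  have hDinj : Function.Injective (algebraMap (blowupAlgebra K h S s) (Localization.AtPrime q)) :=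
    IsLocalization.injective _ q.primeCompl_le_nonZeroDivisors
  have hψ0 : ψD (h s) ≠ 0 := fun h0 => by
    have h1 : algebraMap _ (blowupAlgebra K h S s) (h s) = 0 := hDinj (by rw [map_zero]; exact h0)
    exact hs0' (congrArg Subtype.val h1)
  -- The center becomes a Cartier divisor on `Spec C_q`, with equation `h s`.
  have hspan : (stalkIdeal B (π w)).map ψD = Ideal.span {ψD (h s)} := by
    rw [hB, Ideal.map_span]
    apply le_antisymm
    · rw [Ideal.span_le]
      rintro _ ⟨_, ⟨j, hj, rfl⟩, rfl⟩
      have hu : algebraMap _ K (h j) / algebraMap _ K (h s) ∈ blowupAlgebra K h S s :=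
        Algebra.subset_adjoin ⟨j, hj, rfl⟩
      refine Ideal.mem_span_singleton.mpr ⟨algebraMap (blowupAlgebra K h S s) _ ⟨_, hu⟩, ?_⟩
      rw [RingHom.comp_apply, RingHom.comp_apply, ← map_mul]
      exact congrArg _ (Subtype.ext (mul_div_cancel₀ _ hs0').symm)
    · rw [Ideal.span_singleton_le_iff_mem]
      exact Ideal.subset_span ⟨_, ⟨s, hs, rfl⟩, rfl⟩
  -- By the universal property, `Spec C_q → V` lifts to `W`, and the lift is given on local rings by
  -- a map `τ : 𝒪_{W,w} → C_q`.
  obtain ⟨τ, hτ1, hτ2⟩ := hπ.exists_section w (D := CommRingCat.of (Localization.AtPrime q))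
    (CommRingCat.ofHom ψD) (CommRingCat.ofHom χ) (CommRingCat.hom_ext hψχ)
    (mem_nonZeroDivisors_of_ne_zero hψ0) hspan
  exact isLocalization_of_section (ψ := (π.stalkMap w).hom) hs0
    (fun x hx => let ⟨N, A, _, h⟩ := hexp x hx; ⟨N, A, h⟩) θ hθ q χ hχ τ.hom
    (fun x => congrArg (fun f => f.hom x) hτ1) fun r => congrArg (fun f => f.hom r) hτ2

end BlowupLocal


section BlowupIntegral

variable {V W : Scheme.{u}} [IsIntegral V] {π : W ⟶ V} {B : V.IdealSheafData}

/-- The generic point of `V` lifts to the blowup, and the lift factors through all local rings of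
the blowup, which thereby embed into the function field of `V`. -/
lemma IsBlowup.exists_toFunctionField (hπ : IsBlowup π B) (hB : genericPoint V ∉ B.support) :
    ∃ l : Spec V.functionField ⟶ W, l ≫ π = V.fromSpecStalk (genericPoint V) ∧
      ∀ w, ∃ κ : W.presheaf.stalk w ⟶ V.functionField, Function.Injective κ.hom ∧
        π.stalkMap w ≫ κ =
          V.presheaf.stalkSpecializes ((genericPoint_spec V).specializes trivial) ∧
        Spec.map κ ≫ W.fromSpecStalk w = l := by
  have hcart : IsEffectiveCartier (B.comap (V.fromSpecStalk (genericPoint V))) := by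
    have h1 : IsLocalHom (CommRingCat.Hom.hom (𝟙 (V.presheaf.stalk (genericPoint V)))) :=
      inferInstance
    have := isEffectiveCartier_comap_spec B (genericPoint V) (𝟙 _) (a := 1) (one_mem _) (by
      rw [(stalkIdeal_eq_top_iff _ _).mpr hB, Ideal.map_top, Ideal.span_singleton_one])
    rwa [Spec.map_id, Category.id_comp] at this
  obtain ⟨l, hl, huniq⟩ := hπ.existsUnique_lift _ hcart
  refine ⟨l, hl, fun w => ?_⟩
  have hinj : Function.Injective (algebraMap (V.presheaf.stalk (π w)) V.functionField) :=
    IsFractionRing.injective _ _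
  have hfaith : FaithfulSMul (V.presheaf.stalk (π w)) V.functionField :=
    (faithfulSMul_iff_algebraMap_injective _ _).mpr hinj
  obtain ⟨s, -, -, -, θ, hθ, hloc⟩ := hπ.exists_isLocalization w V.functionField
    (h := (id : V.presheaf.stalk (π w) → _)) (S := stalkIdeal B (π w)) (by simp)
  algebraize [θ]
  let q := (IsLocalRing.maximalIdeal (W.presheaf.stalk w)).comap θ
  have hunit : ∀ c : q.primeCompl, IsUnit ((blowupAlgebra V.functionField id
      (stalkIdeal B (π w) : Set (V.presheaf.stalk (π w))) s).val.toRingHom c) := fun c => by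
    refine isUnit_iff_ne_zero.mpr fun h0 => c.2 ?_
    obtain ⟨c, hc⟩ := c
    obtain rfl : c = 0 := Subtype.ext h0
    exact zero_mem q
  let κ : W.presheaf.stalk w →+* V.functionField :=
    IsLocalization.lift (M := q.primeCompl) hunit
  have hκ : ∀ c, κ (θ c) = c := fun c => IsLocalization.lift_eq _ c
  have hκi : Function.Injective κ := by
    refine (IsLocalization.lift_injective_iff _).mpr fun x y => ⟨fun h => ?_, fun h => ?_⟩
    · exact (hκ x).symm.trans ((congrArg κ h).trans (hκ y))
    · rw [Subtype.ext h]
  clear_value κ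
  obtain ⟨κ', rfl⟩ : ∃ κ' : W.presheaf.stalk w ⟶ V.functionField, κ'.hom = κ :=
    ⟨CommRingCat.ofHom κ, rfl⟩
  have hκψ : π.stalkMap w ≫ κ' =
      V.presheaf.stalkSpecializes ((genericPoint_spec V).specializes trivial) := by
    ext r
    exact (congrArg κ'.hom (hθ r).symm).trans (hκ _)
  refine ⟨κ', hκi, hκψ, huniq _ ?_⟩
  have h1 : Spec.map κ' ≫ Spec.map (π.stalkMap w) =
      Spec.map (V.presheaf.stalkSpecializes ((genericPoint_spec V).specializes trivial)) := by
    rw [← Spec.map_comp]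
    exact congrArg Spec.map hκψ
  dsimp only
  rw [Category.assoc, ← Scheme.SpecMap_stalkMap_fromSpecStalk, reassoc_of% h1]
  exact Scheme.SpecMap_stalkSpecializes_fromSpecStalk _

/-- A blowup of an integral scheme along a proper closed subscheme is integral and dominant. -/
theorem IsBlowup.isIntegral_and_isDominant (hπ : IsBlowup π B) (hB : genericPoint V ∉ B.support) :
    IsIntegral W ∧ IsDominant π := by
  obtain ⟨l, hl, h⟩ := hπ.exists_toFunctionField hB
  obtain ⟨η, hη⟩ : ∃ η, l (IsLocalRing.closedPoint V.functionField) = η := ⟨_, rfl⟩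
  -- The lift `η` of the generic point of `V` factors through every local ring of `W`, so it is the
  -- generic point of `W`.
  have hspec : ∀ w, η ⤳ w := by
    intro w
    obtain ⟨κ, -, -, hκ⟩ := h w
    have h1 : η ∈ Set.range (W.fromSpecStalk w) := by
      refine ⟨Spec.map κ (IsLocalRing.closedPoint V.functionField), ?_⟩
      rw [← hη, ← hκ]
      exact (Scheme.Hom.comp_apply _ _ _).symm
    rwa [Scheme.range_fromSpecStalk] at h1
  have hcl : closure {η} = (Set.univ : Set W) :=
    Set.eq_univ_of_forall fun w => specializes_iff_mem_closure.mp (hspec w)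
  have hirr : IrreducibleSpace W :=
    { isPreirreducible_univ := by
        rw [← hcl]; exact isIrreducible_singleton.closure.isPreirreducible
      toNonempty := ⟨η⟩ }
  have hdom : ∀ w, IsDomain (W.presheaf.stalk w) := fun w =>
    let ⟨κ, hκ, _⟩ := h w
    hκ.isDomain κ.hom
  have hred : IsReduced W := by
    have : ∀ w, _root_.IsReduced (W.presheaf.stalk w) := fun w => inferInstance
    exact isReduced_of_isReduced_stalk W
  refine ⟨isIntegral_of_irreducibleSpace_of_isReduced W, ⟨?_⟩⟩
  have hπη : π η = genericPoint V := by
    rw [← hη]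
    refine (Scheme.Hom.comp_apply _ _ _).symm.trans ?_
    rw [hl]
    exact Scheme.fromSpecStalk_closedPoint
  have h2 : closure {genericPoint V} = (Set.univ : Set V) := genericPoint_spec V
  refine dense_iff_closure_eq.mpr (Set.eq_univ_of_univ_subset ?_)
  rw [← h2, ← hπη]
  exact closure_mono (Set.singleton_subset_iff.mpr ⟨η, rfl⟩)

/-- A blowup is birational. -/
theorem IsBlowup.bijective_functionFieldMap [IsIntegral W] [IsDominant π] (hπ : IsBlowup π B)
    (hB : genericPoint V ∉ B.support) : Function.Bijective (functionFieldMap π).hom := by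
  obtain ⟨l, hl, h⟩ := hπ.exists_toFunctionField hB
  obtain ⟨κ, hκ, hκψ, -⟩ := h (genericPoint W)
  have h1 : functionFieldMap π ≫ κ = 𝟙 _ := by
    rw [functionFieldMap, Category.assoc, hκψ, TopCat.Presheaf.stalkSpecializes_comp]
    exact TopCat.Presheaf.stalkSpecializes_refl _ _
  have h2 : ∀ x, κ.hom ((functionFieldMap π).hom x) = x := fun x =>
    congrArg (fun f => f.hom x) h1
  refine ⟨(functionFieldMap π).hom.injective, fun y => ⟨κ.hom y, hκ ?_⟩⟩
  rw [h2]

end BlowupIntegral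


/-! ### Proper transforms -/

section TransformAlgebra

variable {R : Type u} [CommRing R] {J : Type w}

/-- The properties of local equations of divisors with normal crossings that determine their
transforms: they form a regular family, and each of them is a unit or a prime element that divides
no other member. -/
structure IsCrossingFamily (h : J → R) : Prop where
  isRegularFamily : IsRegularFamily h
  isUnit_or_isPrime : ∀ j, IsUnit (h j) ∨
    (Ideal.span {h j}).IsPrime ∧ ∀ i, i ≠ j → h i ∉ Ideal.span {h j}
  ne_zero : ∀ j, h j ≠ 0

lemma isCrossingFamily_of_regularSystem [IsLocalRing R] [IsNoetherianRing R] {n : ℕ}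
    (t : Fin n → R) (hdim : ringKrullDim R = n)
    (ht : Ideal.span (Set.range t) = IsLocalRing.maximalIdeal R) (h : J → R) {Q : J → Prop}
    (c : {j // Q j} → Fin n) (hc : Function.Injective c) (h1 : ∀ j, h j.1 = t (c j))
    (h2 : ∀ j, ¬ Q j → IsUnit (h j)) : IsCrossingFamily h := by
  refine ⟨isRegularFamily_of_regularSystem t hdim ht h c hc h1 h2, fun j => ?_, fun j => ?_⟩
  · by_cases hj : Q j
    · have hprime := isPrime_span_of_regularSystem t hdim ht {c ⟨j, hj⟩}
      rw [Finset.coe_singleton, Set.image_singleton, ← h1] at hprime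
      refine Or.inr ⟨hprime, fun i hij hi => ?_⟩
      by_cases hi' : Q i
      · refine notMem_span_of_regularSystem t hdim ht {c ⟨j, hj⟩} (i := c ⟨i, hi'⟩) ?_ ?_
        · rw [Finset.mem_singleton]
          exact fun h => hij (congrArg Subtype.val (hc h))
        · rwa [Finset.coe_singleton, Set.image_singleton, ← h1, ← h1]
      · exact hprime.ne_top (Ideal.eq_top_of_isUnit_mem _ hi (h2 i hi'))
    · exact Or.inl (h2 j hj)
  · by_cases hj : Q j
    · have := notMem_span_of_regularSystem t hdim ht ∅ (i := c ⟨j, hj⟩) (by simp)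
      rw [← h1] at this
      simpa using this
    · exact (h2 j hj).ne_zero

open Classical in
/-- On a chart of the blowup, the quotient `h j / h s`, for `j ∈ S`, or `h j`, for `j ∉ S`, is a
unit or a prime element that does not divide the equation `h s` of the exceptional divisor. -/
lemma IsCrossingFamily.exists_transform [Finite J] {K O : Type u} [Field K] [Algebra R K]
    [FaithfulSMul R K] [CommRing O] {h : J → R} (hh : IsCrossingFamily h) {S : Set J} {s : J}
    (hs : s ∈ S) [Algebra (blowupAlgebra K h S s) O] (q : Ideal (blowupAlgebra K h S s)) [q.IsPrime]
    [IsLocalization.AtPrime O q] (j : J) :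
    ∃ v : blowupAlgebra K h S s,
      (v : K) = algebraMap R K (h j) / algebraMap R K (h s) ^ (if j ∈ S then 1 else 0) ∧
      (Ideal.span {algebraMap _ O v} = ⊤ ∨ (Ideal.span {algebraMap _ O v}).IsPrime ∧
        algebraMap _ O (algebraMap R (blowupAlgebra K h S s) (h s)) ∉
          Ideal.span {algebraMap _ O v}) := by
  have hs0 : algebraMap R K (h s) ≠ 0 := fun h0 => hh.ne_zero s (by
    rwa [map_eq_zero_iff _ (FaithfulSMul.algebraMap_injective R K)] at h0)
  have hmem : algebraMap R K (h j) / algebraMap R K (h s) ^ (if j ∈ S then 1 else 0) ∈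
      blowupAlgebra K h S s := by
    apply div_pow_mem_blowupAlgebra
    split_ifs with hj
    · rw [pow_one]; exact Ideal.subset_span ⟨j, hj, rfl⟩
    · simp
  refine ⟨⟨_, hmem⟩, rfl, ?_⟩
  set v : blowupAlgebra K h S s := ⟨_, hmem⟩ with hv
  have hvs : v * algebraMap R _ (h s) ^ (if j ∈ S then 1 else 0) = algebraMap R _ (h j) :=
    Subtype.ext (div_mul_cancel₀ _ (pow_ne_zero _ hs0))
  have hunit : IsUnit v → Ideal.span {algebraMap _ O v} = ⊤ := fun hu =>
    Ideal.eq_top_of_isUnit_mem _ (Ideal.mem_span_singleton_self _) (hu.map _)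
  rcases hh.isUnit_or_isPrime j with hu | ⟨hprime, hne⟩
  · left
    apply hunit
    refine isUnit_of_mul_isUnit_left (y := algebraMap R _ (h s) ^ (if j ∈ S then 1 else 0)) ?_
    rw [hvs]
    exact hu.map _
  by_cases hjs : j = s
  · subst hjs
    left
    apply hunit
    have : v = 1 := Subtype.ext (by simp [hv, hs, hs0])
    rw [this]
    exact isUnit_one
  have hfin : ((Set.toFinite S).toFinset : Set J) = S := Set.Finite.coe_toFinset _
  obtain ⟨hv1, hv2⟩ := isPrime_span_div_pow (K := K) hs (if j ∈ S then 1 else 0) hprime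
    (hne s (Ne.symm hjs)) (fun N x hx => by
      rw [← hfin] at hx ⊢
      split_ifs at hx with hj
      · exact hh.isRegularFamily.mem_pow_of_mem (by simpa using hj) hx
      · exact hh.isRegularFamily.mem_pow_of_notMem (by simpa using hj) hx) v rfl
  by_cases hle : Ideal.span {v} ≤ q
  · right
    have hdisj : Disjoint (q.primeCompl : Set (blowupAlgebra K h S s)) (Ideal.span {v}) :=
      Set.disjoint_left.mpr fun x hx hxv => hx (hle hxv)
    have h3 := IsLocalization.isPrime_of_isPrime_disjoint q.primeCompl O _ hv1 hdisj
    have h4 := IsLocalization.under_map_of_isPrime_disjoint q.primeCompl O hv1 hdisj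
    rw [Ideal.map_span, Set.image_singleton] at h3 h4
    refine ⟨h3, fun hmem => hv2 ?_⟩
    rw [← h4]
    exact hmem
  · left
    have hvq : v ∉ q := fun h => hle ((Ideal.span_singleton_le_iff_mem _).mpr h)
    exact Ideal.eq_top_of_isUnit_mem _ (Ideal.mem_span_singleton_self _)
      (IsLocalization.map_units O (⟨v, hvq⟩ : q.primeCompl))

end TransformAlgebra

section TransformStalk

variable {X : Scheme.{u}}

lemma fromSpecStalk_mem_basicOpen_iff {x : X} (U : X.affineOpens) (hx : x ∈ U.1)
    (P : Spec (X.presheaf.stalk x)) (a : Γ(X, U.1)) :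
    X.fromSpecStalk x P ∈ X.basicOpen a ↔ X.presheaf.germ U.1 x hx a ∉ P.asIdeal := by
  have h1 : X.fromSpecStalk x = Spec.map (X.presheaf.germ U.1 x hx) ≫ U.2.fromSpec :=
    (U.2.fromSpecStalk_eq_fromSpecStalk hx).symm
  have h2 : X.fromSpecStalk x P = U.2.fromSpec (Spec.map (X.presheaf.germ U.1 x hx) P) := by
    rw [h1]; rfl
  have h3 := congrArg (fun O => Spec.map (X.presheaf.germ U.1 x hx) P ∈ O)
    (U.2.fromSpec_preimage_basicOpen a)
  rw [h2]
  exact iff_of_eq h3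

lemma fromSpecStalk_mem_affine {x : X} (U : X.affineOpens) (hx : x ∈ U.1)
    (P : Spec (X.presheaf.stalk x)) : X.fromSpecStalk x P ∈ U.1 :=
  X.basicOpen_le (1 : Γ(X, U.1)) ((fromSpecStalk_mem_basicOpen_iff U hx P 1).mpr fun h => by
    rw [map_one] at h
    exact P.2.ne_top ((Ideal.eq_top_iff_one _).mpr h))

/-- The points of the closed subscheme of `I` specializing to `x` are the primes containing the
stalk of `I`. -/
lemma fromSpecStalk_mem_support_iff (I : X.IdealSheafData) {x : X}
    (P : Spec (X.presheaf.stalk x)) :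
    X.fromSpecStalk x P ∈ I.support ↔ stalkIdeal I x ≤ P.asIdeal := by
  obtain ⟨U, hU, hxU, -⟩ := Opens.isBasis_iff_nbhd.mp X.isBasis_affineOpens (Opens.mem_top x)
  rw [Scheme.IdealSheafData.mem_support_iff_of_mem (U := ⟨U, hU⟩)
    (fromSpecStalk_mem_affine ⟨U, hU⟩ hxU P), stalkIdeal_eq_map I ⟨U, hU⟩ hxU,
    Ideal.map_le_iff_le_comap, Scheme.mem_zeroLocus_iff]
  refine forall₂_congr fun f _ => ?_
  rw [fromSpecStalk_mem_basicOpen_iff ⟨U, hU⟩ hxU P f, not_not]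
  rfl

/-- A product formula for germs at a point holds in a neighbourhood. -/
lemma exists_nhds_germ_eq_mul {U O T : X.Opens} {x : X} (hU : x ∈ U) (hO : x ∈ O) (hT : x ∈ T)
    {a : Γ(X, U)} {b : Γ(X, O)} {c : Γ(X, T)}
    (h : X.presheaf.germ U x hU a = X.presheaf.germ O x hO b * X.presheaf.germ T x hT c) :
    ∃ O' : X.Opens, x ∈ O' ∧ ∃ (hU' : O' ≤ U) (hO' : O' ≤ O) (hT' : O' ≤ T), ∀ z (hz : z ∈ O'),
      X.presheaf.germ U z (hU' hz) a =
        X.presheaf.germ O z (hO' hz) b * X.presheaf.germ T z (hT' hz) c := by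
  have hx : x ∈ U ⊓ (O ⊓ T) := ⟨hU, hO, hT⟩
  have h3 : X.presheaf.germ (U ⊓ (O ⊓ T)) x hx (X.presheaf.map (homOfLE inf_le_left).op a) =
      X.presheaf.germ (U ⊓ (O ⊓ T)) x hx
        (X.presheaf.map (homOfLE (inf_le_right.trans inf_le_left)).op b *
          X.presheaf.map (homOfLE (inf_le_right.trans inf_le_right)).op c) := by
    rw [map_mul, TopCat.Presheaf.germ_res_apply, TopCat.Presheaf.germ_res_apply,
      TopCat.Presheaf.germ_res_apply]
    exact h
  obtain ⟨O', hxO', i, i', h4⟩ := TopCat.Presheaf.germ_eq X.presheaf x _ _ _ _ h3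
  refine ⟨O', hxO', i.le.trans inf_le_left, i.le.trans (inf_le_right.trans inf_le_left),
    i.le.trans (inf_le_right.trans inf_le_right), fun z hz => ?_⟩
  have h5 := congrArg (X.presheaf.germ O' z hz) h4
  rw [TopCat.Presheaf.germ_res_apply, TopCat.Presheaf.germ_res_apply,
    TopCat.Presheaf.germ_res_apply, map_mul] at h5
  rw [h5, TopCat.Presheaf.germ_res_apply, TopCat.Presheaf.germ_res_apply]

/-- Near a point at which a section `b` generates a finitely generated ideal sheaf, it generates
that ideal sheaf. -/
lemma exists_nhds_stalkIdeal_eq_span (I : X.IdealSheafData) (U : X.affineOpens)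
    (hU : (I.ideal U).FG) {O : X.Opens} {x : X} (hxU : x ∈ U.1) (hxO : x ∈ O) (b : Γ(X, O))
    (hb : stalkIdeal I x = Ideal.span {X.presheaf.germ O x hxO b}) :
    ∃ O' : X.Opens, x ∈ O' ∧ ∃ hO : O' ≤ O, ∀ z (hz : z ∈ O'),
      stalkIdeal I z = Ideal.span {X.presheaf.germ O z (hO hz) b} := by
  obtain ⟨F, hF⟩ := hU
  -- every generator of the ideal is a multiple of `b` near `x`
  have h1 : ∀ f ∈ F, ∃ O' : X.Opens, x ∈ O' ∧ ∃ (hO : O' ≤ O) (hO' : O' ≤ U.1),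
      ∀ z (hz : z ∈ O'), X.presheaf.germ U.1 z (hO' hz) f ∈
        Ideal.span {X.presheaf.germ O z (hO hz) b} := by
    intro f hf
    have h2 : X.presheaf.germ U.1 x hxU f ∈ stalkIdeal I x := by
      rw [stalkIdeal_eq_map I U hxU, ← hF]
      exact Ideal.mem_map_of_mem _ (Ideal.subset_span hf)
    rw [hb, Ideal.mem_span_singleton] at h2
    obtain ⟨r, hr⟩ := h2
    obtain ⟨T, hxT, r, rfl⟩ := X.presheaf.exists_germ_eq r
    obtain ⟨O', hxO', hU, hO, hT, hz⟩ := exists_nhds_germ_eq_mul hxU hxO hxT hr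
    exact ⟨O', hxO', hO, hU, fun z hz' => Ideal.mem_span_singleton.mpr ⟨_, hz z hz'⟩⟩
  choose! N hxN hNO hNU hN using h1
  -- and `b` lies in the ideal near `x`
  obtain ⟨U', hxU', a, hU'O, ha, hab⟩ := exists_mem_ideal_of_mem_stalkIdeal I hxO
    (h := X.presheaf.germ O x hxO b) (by rw [hb]; exact Ideal.mem_span_singleton_self _)
  obtain ⟨M, hxM, i, i', hM⟩ := TopCat.Presheaf.germ_eq X.presheaf x _ _ _ _ hab
  let T : X.Opens := ⟨⋂ f ∈ F, (N f : Set X),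
    F.finite_toSet.isOpen_biInter fun f _ => (N f).isOpen⟩
  have hT : ∀ f ∈ F, T ≤ N f := fun f hf => Set.biInter_subset_of_mem hf
  refine ⟨U.1 ⊓ (M ⊓ T), ⟨hxU, hxM, Set.mem_iInter₂.mpr hxN⟩,
    inf_le_right.trans (inf_le_left.trans i'.le), fun z hz => le_antisymm ?_ ?_⟩
  · rw [stalkIdeal_eq_map I U hz.1, ← hF, Ideal.map_span, Ideal.span_le]
    rintro _ ⟨f, hf, rfl⟩
    exact hN f hf z (hT f hf hz.2.2)
  · rw [Ideal.span_singleton_le_iff_mem, stalkIdeal_eq_map I U' (i.le hz.2.1)]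
    have h5 := congrArg (X.presheaf.germ M z hz.2.1) hM
    rw [TopCat.Presheaf.germ_res_apply, TopCat.Presheaf.germ_res_apply] at h5
    rw [← h5]
    exact Ideal.mem_map_of_mem _ ha

end TransformStalk


section ProperTransform

lemma mem_ideal_vanishingIdeal {X : Scheme.{u}} {Z : Closeds X} {U : X.affineOpens}
    {a : Γ(X, U.1)} (h : ∀ z ∈ Z, z ∉ X.basicOpen a) :
    a ∈ (Scheme.IdealSheafData.vanishingIdeal Z).ideal U := by
  rw [Scheme.IdealSheafData.vanishingIdeal_ideal]
  refine (PrimeSpectrum.mem_vanishingIdeal _ _).mpr fun p hp => ?_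
  have h1 := congrArg (fun O => p ∈ O) (U.2.fromSpec_preimage_basicOpen a)
  exact not_not.mp fun h2 => h _ hp ((iff_of_eq h1).mpr h2)

/-- Let `b` be an equation of the exceptional divisor at `w`, and write the equation `c` of the
preimage of `E` as `y * b ^ e`. If `y` is a unit or a prime element that does not divide `b`, then
`y` is an equation of the proper transform of `E`: it vanishes on the preimage of `E` off the
exceptional divisor, and the prime ideal that it generates is a point of this preimage. -/
theorem stalkIdeal_properTransform {V W : Scheme.{u}} {π : W ⟶ V} {B : V.IdealSheafData}
    (hB : IsEffectiveCartier (B.comap π)) (E : V.IdealSheafData) (w : W)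
    {b c y : W.presheaf.stalk w} {e : ℕ} (hb : stalkIdeal (B.comap π) w = Ideal.span {b})
    (hc : stalkIdeal (E.comap π) w = Ideal.span {c}) (hy : y * b ^ e = c)
    (hprime : Ideal.span {y} = ⊤ ∨ (Ideal.span {y}).IsPrime ∧ b ∉ Ideal.span {y}) :
    stalkIdeal (properTransform π B E) w = Ideal.span {y} := by
  have hG : ∀ z, z ∈ π ⁻¹' ((E.support : Set V) \ (B.support : Set V)) ↔
      z ∈ (E.comap π).support ∧ z ∉ (B.comap π).support := fun z => by
    rw [← SetLike.mem_coe, ← SetLike.mem_coe, Scheme.IdealSheafData.support_comap,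
      Scheme.IdealSheafData.support_comap]
    rfl
  apply le_antisymm
  -- The point of the prime ideal `(y)` lies over `E` and off the center.
  · rcases hprime with htop | ⟨hp, hbp⟩
    · rw [htop]; exact le_top
    · let P : Spec (W.presheaf.stalk w) := ⟨Ideal.span {y}, hp⟩
      refine (fromSpecStalk_mem_support_iff _ P).mp ?_
      rw [properTransform, ← SetLike.mem_coe,
        Scheme.IdealSheafData.coe_support_vanishingIdeal]
      refine subset_closure ((hG _).mpr ⟨?_, ?_⟩)
      · rw [fromSpecStalk_mem_support_iff, hc, Ideal.span_singleton_le_iff_mem, ← hy]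
        exact Ideal.mul_mem_right _ _ (Ideal.mem_span_singleton_self y)
      · rw [fromSpecStalk_mem_support_iff, hb, Ideal.span_singleton_le_iff_mem]
        exact hbp
  -- Near `w` all equations extend. Where `b` is invertible, the equation `c = y * b ^ e` can vanish
  -- only if `y` does, so `y` vanishes on the closure of the part of `E` off the center.
  · rw [Ideal.span_singleton_le_iff_mem]
    obtain ⟨U, hwU, f, -, hf⟩ := hB w
    obtain ⟨T₁, hT₁, y, rfl⟩ := W.presheaf.exists_germ_eq y
    obtain ⟨T₂, hT₂, b, rfl⟩ := W.presheaf.exists_germ_eq b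
    obtain ⟨U', hU', c', -, hc', hc'c⟩ := exists_mem_ideal_of_mem_stalkIdeal (E.comap π)
      (Opens.mem_top w) (h := c) (by rw [hc]; exact Ideal.mem_span_singleton_self c)
    obtain ⟨O₁, hwO₁, hO₁, hO₁b⟩ := exists_nhds_stalkIdeal_eq_span (B.comap π) U
      (by rw [hf]; exact ⟨{f}, by simp⟩) hwU hT₂ b hb
    obtain ⟨O₂, hwO₂, h1, h2, h3, h4⟩ := exists_nhds_germ_eq_mul hU' hT₁ hT₂ (a := c') (b := y)
      (c := b ^ e) (by rw [hc'c, ← hy, map_pow])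
    obtain ⟨U₀, hU₀, hwU₀, hle⟩ := Opens.isBasis_iff_nbhd.mp W.isBasis_affineOpens
      (show w ∈ O₁ ⊓ O₂ from ⟨hwO₁, hwO₂⟩)
    rw [stalkIdeal_eq_map _ ⟨U₀, hU₀⟩ hwU₀, ← W.presheaf.germ_res_apply
      (homOfLE (hle.trans (inf_le_right.trans h2))) w hwU₀ y]
    refine Ideal.mem_map_of_mem _ (mem_ideal_vanishingIdeal fun z hz hzy => ?_)
    obtain ⟨z', hz'y, hz'⟩ := mem_closure_iff.mp hz _ (W.basicOpen _).isOpen hzy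
    have hz'U : z' ∈ U₀ := W.basicOpen_le _ hz'y
    obtain ⟨hz'E, hz'B⟩ := (hG z').mp hz'
    have h5 : W.presheaf.germ U'.1 z' (h1 (hle hz'U).2) c' ∈
        IsLocalRing.maximalIdeal (W.presheaf.stalk z') := by
      refine (mem_support_iff_stalkIdeal _ _).mp hz'E ?_
      rw [stalkIdeal_eq_map _ U' (h1 (hle hz'U).2)]
      exact Ideal.mem_map_of_mem _ hc'
    rw [h4 z' (hle hz'U).2, IsLocalRing.mem_maximalIdeal, mem_nonunits_iff, map_pow] at h5
    refine h5 (IsUnit.mul ?_ (IsUnit.pow e ?_))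
    · have h6 := (W.mem_basicOpen _ _ hz'U).mp hz'y
      rwa [TopCat.Presheaf.germ_res_apply] at h6
    · rw [← Ideal.span_singleton_eq_top, ← hO₁b z' (hle hz'U).1, stalkIdeal_eq_top_iff]
      exact hz'B

end ProperTransform


section LocalEquations

variable {V W : Scheme.{u}} {J : Type w}

/-- Local equations at `x` of divisors with normal crossings, completed by units for the divisors
that do not pass through `x`. -/
lemma HasNormalCrossings.exists_equations {E : J → V.IdealSheafData} (hE : HasNormalCrossings E)
    (x : V) : ∃ (n : ℕ) (t : Fin n → V.presheaf.stalk x) (c : {j // x ∈ (E j).support} → Fin n)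
      (h : J → V.presheaf.stalk x), ringKrullDim (V.presheaf.stalk x) = n ∧
      Ideal.span (Set.range t) = IsLocalRing.maximalIdeal (V.presheaf.stalk x) ∧
      Function.Injective c ∧ (∀ j, h j.1 = t (c j)) ∧ (∀ j, x ∉ (E j).support → h j = 1) ∧
      ∀ j, stalkIdeal (E j) x = Ideal.span {h j} := by
  classical
  obtain ⟨n, t, c, hdim, ht, hc, hE⟩ := hE x
  refine ⟨n, t, c, fun j => if hj : x ∈ (E j).support then t (c ⟨j, hj⟩) else 1, hdim, ht, hc,
    fun j => dif_pos j.2, fun j hj => dif_neg hj, fun j => ?_⟩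
  dsimp only
  by_cases hj : x ∈ (E j).support
  · rw [dif_pos hj]; exact hE ⟨j, hj⟩
  · rw [dif_neg hj, Ideal.span_singleton_one]; exact (stalkIdeal_eq_top_iff _ _).mpr hj

lemma HasNormalCrossings.genericPoint_notMem [IsIntegral V] {E : J → V.IdealSheafData}
    (hE : HasNormalCrossings E) (j : J) : genericPoint V ∉ (E j).support := by
  intro hj
  obtain ⟨n, t, c, hdim, -⟩ := hE (genericPoint V)
  have h0 : ringKrullDim V.functionField = 0 := ringKrullDim_eq_zero_of_field _
  obtain rfl : n = 0 := by exact_mod_cast hdim.symm.trans h0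
  exact (c ⟨j, hj⟩).elim0

lemma stalkIdeal_biSup (E : J → V.IdealSheafData) (S : Set J) (x : V)
    {h : J → V.presheaf.stalk x} (hE : ∀ j, stalkIdeal (E j) x = Ideal.span {h j}) :
    stalkIdeal (⨆ j ∈ S, E j) x = Ideal.span (h '' S) := by
  rw [stalkIdeal_iSup, ← Set.biUnion_of_singleton (h '' S), Set.biUnion_image, Ideal.span_iUnion]
  refine iSup_congr fun j => ?_
  rw [stalkIdeal_iSup, Ideal.span_iUnion]
  exact iSup_congr fun hj => hE j

/-- Equations at `w` of the exceptional divisor (`h s`) and of the proper transforms (`y j`) of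
divisors `E j` with equations `h j`, when the intersection of the `E j`, `j ∈ S`, is blown up. The
local ring at `w` is generated by that of `V`, the `y j` and inverses. -/
theorem IsBlowup.exists_localEquations [IsIntegral V] [Finite J] {π : W ⟶ V}
    {E : J → V.IdealSheafData} {S : Set J} (hπ : IsBlowup π (⨆ j ∈ S, E j)) (w : W)
    {h : J → V.presheaf.stalk (π w)} (hh : IsCrossingFamily h)
    (hE : ∀ j, stalkIdeal (E j) (π w) = Ideal.span {h j}) :
    ∃ s ∈ S, stalkIdeal ((⨆ j ∈ S, E j).comap π) w = Ideal.span {(π.stalkMap w).hom (h s)} ∧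
      ∃ y : J → W.presheaf.stalk w,
        (∀ j ∈ S, y j * (π.stalkMap w).hom (h s) = (π.stalkMap w).hom (h j)) ∧
        (∀ j ∉ S, y j = (π.stalkMap w).hom (h j)) ∧
        (∀ j, stalkIdeal (properTransform π (⨆ j ∈ S, E j) (E j)) w = Ideal.span {y j}) ∧
        ∀ P : Subring (W.presheaf.stalk w), (∀ r, (π.stalkMap w).hom r ∈ P) → (∀ j ∈ S, y j ∈ P) →
          (∀ a b, a ∈ P → a * b = 1 → b ∈ P) → P = ⊤ := by
  classical
  have hfaith : FaithfulSMul (V.presheaf.stalk (π w)) V.functionField :=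
    (faithfulSMul_iff_algebraMap_injective _ _).mpr (IsFractionRing.injective _ _)
  obtain ⟨s, hs, -, hsB, θ, hθ, hloc⟩ := hπ.exists_isLocalization w V.functionField h S
    (stalkIdeal_biSup E S _ hE)
  have hs0 : algebraMap (V.presheaf.stalk (π w)) V.functionField (h s) ≠ 0 := fun h0 =>
    hh.ne_zero s (by rwa [map_eq_zero_iff _ (FaithfulSMul.algebraMap_injective _ _)] at h0)
  let := θ.toAlgebra
  choose v hv hvp using fun j => hh.exists_transform (O := W.presheaf.stalk w) hs
    ((IsLocalRing.maximalIdeal (W.presheaf.stalk w)).comap θ) j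
  have hvs : ∀ j, θ (v j) * (π.stalkMap w).hom (h s) ^ (if j ∈ S then 1 else 0) =
      (π.stalkMap w).hom (h j) := fun j => by
    rw [← hθ, ← hθ, ← map_pow, ← map_mul]
    refine congrArg θ (Subtype.ext ?_)
    rw [Subalgebra.coe_mul, hv]
    exact div_mul_cancel₀ _ (pow_ne_zero _ hs0)
  refine ⟨s, hs, hsB, fun j => θ (v j), fun j hj => ?_, fun j hj => ?_, fun j => ?_, ?_⟩
  · have := hvs j
    rwa [if_pos hj, pow_one] at this
  · have := hvs j
    rwa [if_neg hj, pow_zero, mul_one] at this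
  · refine stalkIdeal_properTransform hπ.isEffectiveCartier_comap (E j) w hsB ?_ (hvs j) ?_
    · rw [stalkIdeal_comap, hE, Ideal.map_span, Set.image_singleton]
    · have := hvp j
      rwa [RingHom.algebraMap_toAlgebra, hθ] at this
  · intro P hPr hPy hPinv
    have hC : ∀ x : blowupAlgebra V.functionField h S s, θ x ∈ P := by
      rintro ⟨x, hx⟩
      induction hx using Algebra.adjoin_induction with
      | mem x hx =>
        obtain ⟨j, hj, rfl⟩ := hx
        have h1 : v j = ⟨_, Algebra.subset_adjoin ⟨j, hj, rfl⟩⟩ :=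
          Subtype.ext (by rw [hv, if_pos hj, pow_one])
        exact h1 ▸ hPy j hj
      | algebraMap r => exact (hθ r).symm ▸ hPr r
      | add x y hx hy h1 h2 =>
        have := P.add_mem h1 h2
        rwa [← map_add] at this
      | mul x y hx hy h1 h2 =>
        have := P.mul_mem h1 h2
        rwa [← map_mul] at this
    refine top_le_iff.mp fun z _ => ?_
    obtain ⟨a, b, rfl⟩ := IsLocalization.exists_mk'_eq
      ((IsLocalRing.maximalIdeal (W.presheaf.stalk w)).comap θ).primeCompl z
    rw [IsLocalization.mk'_eq_mul_mk'_one]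
    refine P.mul_mem (hC a) (hPinv (θ b) _ (hC b) ?_)
    rw [mul_comm]
    exact (IsLocalization.mk'_spec _ _ _).trans (map_one _)

end LocalEquations


/-! ### Logarithmic differentials -/

section DerivationLog

variable {K : Type*} [Field K] {M : Type*} [AddCommGroup M] [Module K M] (δ : Derivation ℤ K M)

lemma inv_smul_derivation_mul {a b : K} (ha : a ≠ 0) (hb : b ≠ 0) :
    (a * b)⁻¹ • δ (a * b) = a⁻¹ • δ a + b⁻¹ • δ b := by
  rw [δ.leibniz, smul_add, smul_smul, smul_smul, add_comm]
  congr 2 <;> field_simp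

lemma derivation_eq_smul_add {a b c : K} (hb : b ≠ 0) (h : a * b = c) :
    δ a = a • (c⁻¹ • δ c) - a • (b⁻¹ • δ b) := by
  subst h
  by_cases ha : a = 0
  · simp [ha]
  · rw [inv_smul_derivation_mul δ ha hb, smul_add, add_sub_cancel_right, smul_smul,
      mul_inv_cancel₀ ha, one_smul]

/-- The elements of a subring whose differential lies in a given submodule. -/
def derivationSubring (A : Subring K) (N : Submodule A M) : Subring K where
  carrier := {a | a ∈ A ∧ δ a ∈ N}
  mul_mem' := fun {a b} ha hb => ⟨A.mul_mem ha.1 hb.1, by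
    rw [δ.leibniz]
    exact N.add_mem (N.smul_mem ⟨a, ha.1⟩ hb.2) (N.smul_mem ⟨b, hb.1⟩ ha.2)⟩
  one_mem' := ⟨A.one_mem, by rw [δ.map_one_eq_zero]; exact N.zero_mem⟩
  add_mem' := fun {a b} ha hb => ⟨A.add_mem ha.1 hb.1, by
    rw [δ.map_add]; exact N.add_mem ha.2 hb.2⟩
  zero_mem' := ⟨A.zero_mem, by rw [δ.map_zero]; exact N.zero_mem⟩
  neg_mem' := fun {a} ha => ⟨A.neg_mem ha.1, by rw [δ.map_neg]; exact N.neg_mem ha.2⟩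

lemma mem_derivationSubring_of_mul_eq_one {A : Subring K} {N : Submodule A M} {a b : K}
    (ha : a ∈ derivationSubring δ A N) (hb : b ∈ A) (hab : a * b = 1) :
    b ∈ derivationSubring δ A N := by
  refine ⟨hb, ?_⟩
  have h1 : a ≠ 0 := left_ne_zero_of_mul_eq_one hab
  obtain rfl : b = a⁻¹ := eq_inv_of_mul_eq_one_right hab
  have h2 := derivation_eq_smul_add δ h1 (inv_mul_cancel₀ h1)
  rw [δ.map_one_eq_zero, smul_zero, smul_zero, zero_sub] at h2
  rw [h2]
  exact N.neg_mem (N.smul_mem ⟨_, hb⟩ (N.smul_mem ⟨_, hb⟩ ha.2))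

end DerivationLog

section LogStalk

variable {k : Type u} [Field k] {X : Scheme.{u}} [IsIntegral X] (f : X ⟶ Spec (CommRingCat.of k))

/-- The universal differential on rational functions, as a derivation. -/
noncomputable def rationalD : Derivation ℤ X.functionField (RationalForms f) :=
  Derivation.mk' (AddMonoidHom.mk' (d f) fun a b =>
    (CommRingCat.KaehlerDifferential.D (toFunctionField f)).d_add a b).toIntLinearMap fun a b =>
      (CommRingCat.KaehlerDifferential.D (toFunctionField f)).d_mul a b

@[simp]
lemma rationalD_apply (g : X.functionField) : rationalD f g = d f g := rfl

lemma d_toFunctionField (a : k) : d f ((toFunctionField f).hom a) = 0 :=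
  (CommRingCat.KaehlerDifferential.D (toFunctionField f)).d_map a

variable {J : Type w} {D : J → X.IdealSheafData} {x : X}

lemma algebraMap_functionField_injective (x : X) :
    Function.Injective (algebraMap (X.presheaf.stalk x) X.functionField) :=
  IsFractionRing.injective _ _

variable (D) in
lemma d_mem_logStalk (g : X.presheaf.stalk x) :
    d f (algebraMap _ X.functionField g) ∈ logStalk f D x :=
  Submodule.subset_span (Or.inl ⟨g, rfl⟩)

lemma dlog_mem_logStalk {j : J} {h : X.presheaf.stalk x}
    (hj : stalkIdeal (D j) x = Ideal.span {h}) :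
    (algebraMap _ X.functionField h)⁻¹ • d f (algebraMap _ X.functionField h) ∈ logStalk f D x :=
  Submodule.subset_span (Or.inr ⟨j, h, hj, rfl⟩)

/-- To contain the stalk of the logarithmic forms, it suffices to contain the logarithmic
differential of one equation for each divisor. -/
lemma logStalk_le {h : J → X.presheaf.stalk x}
    (hD : ∀ j, stalkIdeal (D j) x = Ideal.span {h j})
    {N : Submodule (localRing X x) (RationalForms f)}
    (h1 : ∀ g : X.presheaf.stalk x, d f (algebraMap _ X.functionField g) ∈ N)
    (h2 : ∀ j, (algebraMap _ X.functionField (h j))⁻¹ •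
      d f (algebraMap _ X.functionField (h j)) ∈ N) :
    logStalk f D x ≤ N := by
  refine Submodule.span_le.mpr ?_
  rintro _ (⟨g, rfl⟩ | ⟨j, g, hg, rfl⟩)
  · exact h1 g
  · rw [hD j] at hg
    obtain ⟨u, hu⟩ := Ideal.span_singleton_eq_span_singleton.mp hg
    by_cases h0 : h j = 0
    · rw [h0, zero_mul] at hu
      rw [← hu, map_zero, inv_zero, zero_smul]
      exact N.zero_mem
    have hne : ∀ {a : X.presheaf.stalk x}, a ≠ 0 → algebraMap _ X.functionField a ≠ 0 := fun ha =>
      (map_ne_zero_iff _ (algebraMap_functionField_injective x)).mpr ha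
    rw [← hu, map_mul]
    have h3 := inv_smul_derivation_mul (rationalD f) (hne h0) (hne u.ne_zero)
    rw [rationalD_apply, rationalD_apply, rationalD_apply] at h3
    rw [h3]
    refine N.add_mem (h2 j) ?_
    have h4 : (algebraMap _ X.functionField (u : X.presheaf.stalk x))⁻¹ =
        algebraMap _ X.functionField ((u⁻¹ : (X.presheaf.stalk x)ˣ) : X.presheaf.stalk x) := by
      refine inv_eq_of_mul_eq_one_right ?_
      rw [← map_mul, Units.mul_inv, map_one]
    rw [h4]
    exact N.smul_mem (⟨_, _, rfl⟩ : localRing X x) (h1 u)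

end LogStalk

/-! ### Pullback of logarithmic forms to the blowup -/

section PullbackForm

variable {k : Type u} [Field k] {W V : Scheme.{u}} [IsIntegral W] [IsIntegral V]
  (v : V ⟶ Spec (CommRingCat.of k)) (π : W ⟶ V) [IsDominant π]

lemma functionFieldMap_algebraMap (w : W) (r : V.presheaf.stalk (π w)) :
    (functionFieldMap π).hom (algebraMap _ V.functionField r) =
      algebraMap _ W.functionField ((π.stalkMap w).hom r) := by
  have h : V.presheaf.stalkSpecializes ((genericPoint_spec V).specializes trivial) ≫
      functionFieldMap π = π.stalkMap w ≫
        W.presheaf.stalkSpecializes ((genericPoint_spec W).specializes trivial) := by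
    rw [functionFieldMap, TopCat.Presheaf.stalkSpecializes_comp_assoc]
    exact Scheme.Hom.stalkSpecializes_stalkMap π _ _ _
  exact congrArg (fun t => t.hom r) h

lemma pullbackForm_add (ω ω' : RationalForms v) :
    pullbackForm v π (ω + ω') = pullbackForm v π ω + pullbackForm v π ω' :=
  map_add (CommRingCat.KaehlerDifferential.map (toFunctionField_comp v π)).hom ω ω'

lemma pullbackForm_smul (a : V.functionField) (ω : RationalForms v) :
    pullbackForm v π (a • ω) = (functionFieldMap π).hom a • pullbackForm v π ω :=
  map_smul (CommRingCat.KaehlerDifferential.map (toFunctionField_comp v π)).hom a ω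

lemma pullbackForm_d (a : V.functionField) :
    pullbackForm v π (d v a) = d (π ≫ v) ((functionFieldMap π).hom a) :=
  CommRingCat.KaehlerDifferential.map_d _ a

/-- The pullback of rational 1-forms as a semilinear map. -/
noncomputable def pullbackFormHom :
    RationalForms v →ₛₗ[(functionFieldMap π).hom] RationalForms (π ≫ v) where
  toFun := pullbackForm v π
  map_add' := pullbackForm_add v π
  map_smul' := pullbackForm_smul v π

lemma span_range_d {X : Scheme.{u}} [IsIntegral X] (f : X ⟶ Spec (CommRingCat.of k)) :
    Submodule.span X.functionField (Set.range (d f)) = ⊤ := by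
  let := (toFunctionField f).hom.toAlgebra
  exact KaehlerDifferential.span_range_derivation (CommRingCat.of k) X.functionField

/-- Pullback of rational forms along a birational morphism is injective. -/
lemma pullbackForm_injective (hbij : Function.Bijective (functionFieldMap π).hom) :
    Function.Injective (pullbackForm v π) := by
  have hiso : IsIso (functionFieldMap π) := (ConcreteCategory.isIso_iff_bijective _).mpr hbij
  have fac : 𝟙 _ ≫ toFunctionField v = toFunctionField (π ≫ v) ≫ inv (functionFieldMap π) := by
    rw [← Category.id_comp (toFunctionField (π ≫ v)), toFunctionField_comp v π, Category.assoc,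
      IsIso.hom_inv_id, Category.id_comp, Category.comp_id]
  obtain ⟨G, hG⟩ : ∃ G : RationalForms (π ≫ v) →ₛₗ[(inv (functionFieldMap π)).hom] RationalForms v,
      ∀ b, G (d (π ≫ v) b) = d v ((inv (functionFieldMap π)).hom b) :=
    ⟨{ toFun := (CommRingCat.KaehlerDifferential.map fac).hom
       map_add' := map_add _
       map_smul' := map_smul (CommRingCat.KaehlerDifferential.map fac).hom },
      CommRingCat.KaehlerDifferential.map_d fac⟩
  have hi : ∀ a, (inv (functionFieldMap π)).hom ((functionFieldMap π).hom a) = a := fun a =>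
    congrArg (fun t => t.hom a) (IsIso.hom_inv_id (functionFieldMap π))
  refine Function.LeftInverse.injective (g := G) fun ω => ?_
  have hω : ω ∈ Submodule.span V.functionField (Set.range (d v)) := by
    rw [span_range_d]; trivial
  induction hω using Submodule.span_induction with
  | mem _ h =>
    obtain ⟨a, rfl⟩ := h
    rw [pullbackForm_d, hG, hi]
  | zero =>
    have h0 : pullbackForm v π 0 = 0 := map_zero (pullbackFormHom v π)
    rw [h0, map_zero]
  | add x y _ _ hx hy => rw [pullbackForm_add, map_add, hx, hy]
  | smul a x _ hx => rw [pullbackForm_smul, LinearMap.map_smulₛₗ, hx, hi]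

end PullbackForm


section PullbackLogStalk

variable {k : Type u} [Field k] {W V : Scheme.{u}} [IsIntegral W] [IsIntegral V]
  (v : V ⟶ Spec (CommRingCat.of k)) {π : W ⟶ V} [IsDominant π]

lemma functionFieldMap_mem_localRing {w : W} {a : V.functionField} (ha : a ∈ localRing V (π w)) :
    (functionFieldMap π).hom a ∈ localRing W w := by
  obtain ⟨r, rfl⟩ := ha
  rw [functionFieldMap_algebraMap]
  exact ⟨_, rfl⟩

/-- The forms whose pullback lies in a given module of forms on `W`. -/
noncomputable def comapPullbackForm (w : W)
    (N : Submodule (localRing W w) (RationalForms (π ≫ v))) :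
    Submodule (localRing V (π w)) (RationalForms v) where
  carrier := {ω | pullbackForm v π ω ∈ N}
  zero_mem' := by
    have h0 : pullbackForm v π 0 = 0 := map_zero (pullbackFormHom v π)
    rw [Set.mem_ofPred_eq, h0]
    exact N.zero_mem
  add_mem' := fun {a b} ha hb => by
    rw [Set.mem_ofPred_eq, pullbackForm_add]
    exact N.add_mem ha hb
  smul_mem' := fun c ω hω => by
    rw [Set.mem_ofPred_eq, Subring.smul_def, pullbackForm_smul]
    exact N.smul_mem (⟨_, functionFieldMap_mem_localRing c.2⟩ : localRing W w) hω

/-- At every point of the blowup, the forms with logarithmic poles along the exceptional divisor and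
the proper transforms are generated by the pullbacks of the logarithmic forms. -/
theorem IsBlowup.logStalk_eq_span [IsLocallyNoetherian V] {J : Type w} [Finite J]
    {E : J → V.IdealSheafData} (hE : HasNormalCrossings E) {S : Set J}
    (hπ : IsBlowup π (⨆ j ∈ S, E j)) (w : W) :
    logStalk (π ≫ v) (totalFamily π (⨆ j ∈ S, E j) E) w =
      Submodule.span (localRing W w) (pullbackForm v π '' logStalk v E (π w)) := by
  obtain ⟨n, t, c, h, hdim, ht, hc, ht', hu, hEh⟩ := hE.exists_equations (π w)
  have hh : IsCrossingFamily h := isCrossingFamily_of_regularSystem t hdim ht h c hc ht'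
    fun j hj => by rw [hu j hj]; exact isUnit_one
  obtain ⟨s, hs, hsB, y, hyS, hyS', hyD, hgen⟩ := hπ.exists_localEquations w hh hEh
  let h' : Option J → W.presheaf.stalk w := fun o => o.elim ((π.stalkMap w).hom (h s)) y
  have hD : ∀ o, stalkIdeal (totalFamily π (⨆ j ∈ S, E j) E o) w = Ideal.span {h' o}
    | none => hsB
    | some j => hyD j
  have hne : ∀ j, algebraMap _ W.functionField ((π.stalkMap w).hom (h j)) ≠ 0 := fun j => by
    rw [← functionFieldMap_algebraMap]
    exact (map_ne_zero _).mpr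
      ((map_ne_zero_iff _ (algebraMap_functionField_injective _)).mpr (hh.ne_zero j))
  have hpull : ∀ r : V.presheaf.stalk (π w), pullbackForm v π (d v (algebraMap _ _ r)) =
      d (π ≫ v) (algebraMap _ W.functionField ((π.stalkMap w).hom r)) := fun r => by
    rw [pullbackForm_d, functionFieldMap_algebraMap]
  have hpull' : ∀ r : V.presheaf.stalk (π w), pullbackForm v π
      ((algebraMap _ V.functionField r)⁻¹ • d v (algebraMap _ V.functionField r)) =
      (algebraMap _ W.functionField ((π.stalkMap w).hom r))⁻¹ •
        d (π ≫ v) (algebraMap _ W.functionField ((π.stalkMap w).hom r)) := fun r => by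
    rw [pullbackForm_smul, hpull, map_inv₀, functionFieldMap_algebraMap]
  have hymul : ∀ j ∈ S, algebraMap _ W.functionField (y j) *
      algebraMap _ W.functionField ((π.stalkMap w).hom (h s)) =
        algebraMap _ W.functionField ((π.stalkMap w).hom (h j)) := fun j hj => by
    rw [← map_mul, hyS j hj]
  have hy0 : ∀ j ∈ S, algebraMap _ W.functionField (y j) ≠ 0 := fun j hj h0 => hne j (by
    rw [← hymul j hj, h0, zero_mul])
  -- the logarithmic differentials of the two systems of equations
  have hdlog : ∀ j ∈ S, (algebraMap _ W.functionField ((π.stalkMap w).hom (h j)))⁻¹ •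
      d (π ≫ v) (algebraMap _ W.functionField ((π.stalkMap w).hom (h j))) =
      (algebraMap _ W.functionField (y j))⁻¹ • d (π ≫ v) (algebraMap _ W.functionField (y j)) +
      (algebraMap _ W.functionField ((π.stalkMap w).hom (h s)))⁻¹ •
        d (π ≫ v) (algebraMap _ W.functionField ((π.stalkMap w).hom (h s))) := fun j hj => by
    have h1 := inv_smul_derivation_mul (rationalD (π ≫ v)) (hy0 j hj) (hne s)
    rw [hymul j hj] at h1
    exact h1
  apply le_antisymm
  · set N := Submodule.span (localRing W w) (pullbackForm v π '' logStalk v E (π w)) with hN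
    have hmem : ∀ ω ∈ logStalk v E (π w), pullbackForm v π ω ∈ N := fun ω hω =>
      Submodule.subset_span ⟨ω, hω, rfl⟩
    have hlog : ∀ j, (algebraMap _ W.functionField ((π.stalkMap w).hom (h j)))⁻¹ •
        d (π ≫ v) (algebraMap _ W.functionField ((π.stalkMap w).hom (h j))) ∈ N := fun j => by
      rw [← hpull']
      exact hmem _ (dlog_mem_logStalk v (hEh j))
    refine logStalk_le (π ≫ v) hD (fun g => ?_) fun o => ?_
    · let P : Subring (W.presheaf.stalk w) :=
        (derivationSubring (rationalD (π ≫ v)) (localRing W w) N).comap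
          (algebraMap _ W.functionField)
      -- The functions whose differentials lie in `N` form a subring closed under inverses. It
      -- contains the quotients `h j / h s`, hence everything, as the local ring is a localization of
      -- the chart.
      have hP : P = ⊤ := by
        refine hgen P (fun r => ⟨⟨_, rfl⟩, ?_⟩) (fun j hj => ⟨⟨_, rfl⟩, ?_⟩) fun a b ha hab => ?_
        · rw [rationalD_apply, ← hpull]
          exact hmem _ (d_mem_logStalk v E r)
        · rw [derivation_eq_smul_add (rationalD (π ≫ v)) (hne s) (hymul j hj)]
          exact N.sub_mem (N.smul_mem (⟨_, _, rfl⟩ : localRing W w) (hlog j))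
            (N.smul_mem (⟨_, _, rfl⟩ : localRing W w) (hlog s))
        · refine mem_derivationSubring_of_mul_eq_one _ ha ⟨_, rfl⟩ ?_
          rw [← map_mul, hab, map_one]
      have hg : g ∈ P := hP ▸ Subring.mem_top g
      exact hg.2
    · rcases o with _ | j
      · exact hlog s
      · by_cases hj : j ∈ S
        · have h1 := N.sub_mem (hlog j) (hlog s)
          rw [hdlog j hj, add_sub_cancel_right] at h1
          exact h1
        · have h1 := hlog j
          rw [← hyS' j hj] at h1
          exact h1
  · refine Submodule.span_le.mpr ?_
    rintro _ ⟨ω, hω, rfl⟩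
    have h1 := fun o => dlog_mem_logStalk (π ≫ v) (hD o)
    suffices hle : logStalk v E (π w) ≤ comapPullbackForm v w
        (logStalk (π ≫ v) (totalFamily π (⨆ j ∈ S, E j) E) w) from hle hω
    refine logStalk_le v hEh (fun g => ?_) (fun j => ?_)
    · change pullbackForm v π _ ∈ logStalk _ _ _
      rw [hpull]
      exact d_mem_logStalk _ _ _
    · change pullbackForm v π _ ∈ logStalk _ _ _
      rw [hpull']
      by_cases hj : j ∈ S
      · rw [hdlog j hj]
        exact Submodule.add_mem _ (h1 (some j)) (h1 none)
      · rw [← hyS' j hj]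
        exact h1 (some j)

end PullbackLogStalk


/-! ### Frames of logarithmic forms -/

section SmoothStalk

variable {k : Type u} [Field k] {X : Scheme.{u}} (f : X ⟶ Spec (CommRingCat.of k))

/-- The structure map from the ground field to the sections over an open set. -/
noncomputable def toSections (U : X.Opens) : CommRingCat.of k ⟶ Γ(X, U) :=
  (Scheme.ΓSpecIso (CommRingCat.of k)).inv ≫ f.appLE ⊤ U le_top

/-- The structure map from the ground field to a local ring. -/
noncomputable def toStalk (x : X) : CommRingCat.of k ⟶ X.presheaf.stalk x :=
  (Scheme.ΓSpecIso (CommRingCat.of k)).inv ≫ f.appTop ≫ X.presheaf.germ ⊤ x (Opens.mem_top x)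

lemma toSections_germ {U : X.Opens} {x : X} (hx : x ∈ U) :
    toSections f U ≫ X.presheaf.germ U x hx = toStalk f x := by
  simp only [toSections, toStalk, Scheme.Hom.appLE, Category.assoc, TopCat.Presheaf.germ_res]
  rfl

lemma toStalk_stalkSpecializes [IsIntegral X] (x : X) :
    toStalk f x ≫ X.presheaf.stalkSpecializes ((genericPoint_spec X).specializes trivial) =
      toFunctionField f := by
  simp only [toFunctionField, toStalk, Category.assoc, TopCat.Presheaf.germ_stalkSpecializes]

lemma finiteType_toSections [LocallyOfFiniteType f] {U : X.Opens} (hU : IsAffineOpen U) :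
    (toSections f U).hom.FiniteType := by
  have h1 := f.finiteType_appLE (isAffineOpen_top _) hU (le_top : U ≤ f ⁻¹ᵁ ⊤)
  have h2 : (Scheme.ΓSpecIso (CommRingCat.of k)).inv.hom.FiniteType :=
    RingHom.FiniteType.of_surjective _
      (Scheme.ΓSpecIso (CommRingCat.of k)).symm.commRingCatIsoToRingEquiv.surjective
  exact h1.comp h2

lemma smooth_toSections [Smooth f] {U : X.Opens} (hU : IsAffineOpen U) :
    (toSections f U).hom.Smooth := by
  have h1 := f.smooth_appLE (isAffineOpen_top _) hU (le_top : U ≤ f ⁻¹ᵁ ⊤)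
  have h2 : (Scheme.ΓSpecIso (CommRingCat.of k)).inv.hom.Smooth :=
    RingHom.Smooth.of_bijective
      (Scheme.ΓSpecIso (CommRingCat.of k)).symm.commRingCatIsoToRingEquiv.bijective
  exact h2.comp h1

lemma essFiniteType_and_formallySmooth_toStalk [Smooth f] (x : X) :
    (toStalk f x).hom.EssFiniteType ∧ (toStalk f x).hom.FormallySmooth := by
  obtain ⟨U, hU, hxU, -⟩ := Opens.isBasis_iff_nbhd.mp X.isBasis_affineOpens (Opens.mem_top x)
  have h1 := smooth_toSections f hU
  have h2 := (finiteType_toSections f hU).essFiniteType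
  have h3 := congrArg CommRingCat.Hom.hom (toSections_germ f hxU)
  let := X.presheaf.algebra_section_stalk ⟨x, hxU⟩
  have hloc := hU.isLocalization_stalk ⟨x, hxU⟩
  have h4 : (X.presheaf.germ U x hxU).hom.EssFiniteType :=
    Algebra.EssFiniteType.of_isLocalization (X.presheaf.stalk x)
      (hU.primeIdealOf ⟨x, hxU⟩).asIdeal.primeCompl
  have h5 : (X.presheaf.germ U x hxU).hom.FormallySmooth :=
    Algebra.FormallySmooth.of_isLocalization (hU.primeIdealOf ⟨x, hxU⟩).asIdeal.primeCompl
  rw [← h3]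
  exact ⟨h2.comp h4, h1.formallySmooth.comp h5⟩

end SmoothStalk

section Frame

lemma exists_D_eq_sum {k R : Type u} [Field k] [CommRing R] [Algebra k R] {K : Type u} [Field K]
    [Algebra R K] [Algebra k K] [IsScalarTower k R K] {ι : Type u} [Fintype ι] {y : ι → R}
    (b : Module.Basis ι R Ω[R⁄k]) (hb : ∀ i, b i = KaehlerDifferential.D k R (y i)) (g : R) :
    ∃ r : ι → R, KaehlerDifferential.D k K (algebraMap R K g) =
      ∑ i, algebraMap R K (r i) • KaehlerDifferential.D k K (algebraMap R K (y i)) := by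
  refine ⟨fun i => b.repr (KaehlerDifferential.D k R g) i, ?_⟩
  have h1 := congrArg (KaehlerDifferential.map k k R K) (b.sum_repr (KaehlerDifferential.D k R g))
  rw [map_sum, KaehlerDifferential.map_D] at h1
  rw [← h1]
  refine Finset.sum_congr rfl fun i _ => ?_
  rw [map_smul, hb, KaehlerDifferential.map_D, algebraMap_smul]

variable {k : Type u} [Field k] [PerfectField k] {V : Scheme.{u}} [IsIntegral V]
  (v : V ⟶ Spec (CommRingCat.of k)) [Smooth v]

/-- Part of a regular system of parameters at a point of a smooth variety can be completed to a
family whose differentials are linearly independent rational forms and generate the differentials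
of the local ring. -/
lemma exists_linearIndependent_d (x : V) [IsNoetherianRing (V.presheaf.stalk x)] {n : ℕ}
    (t : Fin n → V.presheaf.stalk x) (hdim : ringKrullDim (V.presheaf.stalk x) = n)
    (ht : Ideal.span (Set.range t) = IsLocalRing.maximalIdeal (V.presheaf.stalk x)) :
    ∃ (ι : Type u) (_ : Fintype ι) (y : ι → V.presheaf.stalk x) (c : Fin n → ι),
      Function.Injective c ∧ (∀ i, y (c i) = t i) ∧
      LinearIndependent V.functionField
        (fun i => d v (algebraMap (V.presheaf.stalk x) V.functionField (y i))) ∧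
      ∀ g : V.presheaf.stalk x, ∃ r : ι → V.presheaf.stalk x, d v (algebraMap _ V.functionField g) =
        ∑ i, algebraMap _ V.functionField (r i) • d v (algebraMap _ V.functionField (y i)) := by
  obtain ⟨h1, h2⟩ := essFiniteType_and_formallySmooth_toStalk v x
  let _ : Algebra k (V.presheaf.stalk x) := (toStalk v x).hom.toAlgebra
  let _ : Algebra k V.functionField := (toFunctionField v).hom.toAlgebra
  have htower : IsScalarTower k (V.presheaf.stalk x) V.functionField :=
    IsScalarTower.of_algebraMap_eq'
      (congrArg CommRingCat.Hom.hom (toStalk_stalkSpecializes v x)).symm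
  have h1' : Algebra.EssFiniteType k (V.presheaf.stalk x) := h1
  have h2' : Algebra.FormallySmooth k (V.presheaf.stalk x) := h2
  obtain ⟨ι, hι, y, c, b, hc, hy, hb⟩ := exists_basis_D_of_regularSystem (k := k) t hdim ht
  have := Fintype.ofFinite ι
  have hli : LinearIndependent (V.presheaf.stalk x) fun i => KaehlerDifferential.D k _ (y i) := by
    have := b.linearIndependent
    rwa [funext hb] at this
  refine ⟨ι, this, y, c, hc, hy, ?_, fun g => ?_⟩
  · exact linearIndependent_D_fractionRing (K := V.functionField) hli
  · exact exists_D_eq_sum (K := V.functionField) b hb g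

/-- The stalk of the logarithmic forms is generated by linearly independent forms: the logarithmic
differentials of some members of a system of local coordinates, and the differentials of the
others. -/
theorem HasNormalCrossings.exists_frame_logStalk [IsLocallyNoetherian V] {J : Type w}
    {E : J → V.IdealSheafData} (hE : HasNormalCrossings E) (x : V) :
    ∃ (ι : Type u) (_ : Fintype ι) (e : ι → RationalForms v),
      LinearIndependent V.functionField e ∧
      logStalk v E x = Submodule.span (localRing V x) (Set.range e) := by
  classical
  obtain ⟨n, t, c, h, hdim, ht, hc, ht', hu, hEh⟩ := hE.exists_equations x
  have hh : IsCrossingFamily h := isCrossingFamily_of_regularSystem t hdim ht h c hc ht'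
    fun j hj => by rw [hu j hj]; exact isUnit_one
  obtain ⟨ι, hι, y, c', hc', hy, hli, hgen⟩ := exists_linearIndependent_d v x t hdim ht
  let ρ := algebraMap (V.presheaf.stalk x) V.functionField
  have hy0 : ∀ j, ρ (y (c' (c j))) ≠ 0 := fun j => by
    rw [hy, ← ht']
    exact (map_ne_zero_iff _ (algebraMap_functionField_injective x)).mpr (hh.ne_zero _)
  -- If `y i` is an equation of a divisor through `x`, then `a i = y i`, and otherwise `a i = 1`, so
  -- that `(a i)⁻¹ • d (y i)` is a logarithmic differential or a differential.
  let a : ι → V.functionField := fun i => if ∃ j, c' (c j) = i then ρ (y i) else 1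
  have ha0 : ∀ i, a i ≠ 0 := fun i => by
    by_cases hi : ∃ j, c' (c j) = i
    · simp only [a, if_pos hi]
      obtain ⟨j, rfl⟩ := hi
      exact hy0 j
    · simp only [a, if_neg hi]
      exact one_ne_zero
  have haA : ∀ i, a i ∈ localRing V x := fun i => by
    by_cases hi : ∃ j, c' (c j) = i
    · simp only [a, if_pos hi]; exact ⟨_, rfl⟩
    · simp only [a, if_neg hi]; exact one_mem _
  have haj : ∀ j, a (c' (c j)) = ρ (h j.1) := fun j => by
    have : ∃ j', c' (c j') = c' (c j) := ⟨j, rfl⟩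
    simp only [a, if_pos this, hy, ht']
  let e : ι → RationalForms v := fun i => (a i)⁻¹ • d v (ρ (y i))
  have hej : ∀ j, e (c' (c j)) = (ρ (h j.1))⁻¹ • d v (ρ (h j.1)) := fun j => by
    simp only [e, haj, hy, ht']
  have hde : ∀ i, d v (ρ (y i)) = a i • e i := fun i => by
    simp only [e, smul_smul, mul_inv_cancel₀ (ha0 i), one_smul]
  refine ⟨ι, hι, e, ?_, le_antisymm ?_ ?_⟩
  · exact hli.units_smul fun i => (Units.mk0 (a i) (ha0 i))⁻¹
  · refine logStalk_le v hEh (fun g => ?_) fun j => ?_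
    · obtain ⟨r, hr⟩ := hgen g
      rw [hr]
      refine Submodule.sum_mem _ fun i _ => ?_
      rw [hde i]
      exact Submodule.smul_mem _ (⟨_, _, rfl⟩ : localRing V x)
        (Submodule.smul_mem _ (⟨_, haA i⟩ : localRing V x) (Submodule.subset_span ⟨i, rfl⟩))
    · by_cases hj : x ∈ (E j).support
      · exact Submodule.subset_span ⟨_, hej ⟨j, hj⟩⟩
      · rw [hu j hj, map_one, ← rationalD_apply, (rationalD v).map_one_eq_zero, smul_zero]
        exact Submodule.zero_mem _
  · refine Submodule.span_le.mpr ?_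
    rintro _ ⟨i, rfl⟩
    by_cases hi : ∃ j, c' (c j) = i
    · obtain ⟨j, rfl⟩ := hi
      rw [hej]
      exact dlog_mem_logStalk v (hEh _)
    · have : e i = d v (ρ (y i)) := by simp only [e, a, if_neg hi, inv_one, one_smul]
      rw [this]
      exact d_mem_logStalk v E _

end Frame


section Spreading

open Filter Topology

variable {k : Type u} [Field k] {X : Scheme.{u}} [IsIntegral X] (f : X ⟶ Spec (CommRingCat.of k))

lemma algebraMap_germ_eq {U : X.Opens} {x y : X} (hx : x ∈ U) (hy : y ∈ U) (a : Γ(X, U)) :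
    algebraMap _ X.functionField (X.presheaf.germ U x hx a) =
      algebraMap _ X.functionField (X.presheaf.germ U y hy a) :=
  congrArg (fun φ => φ a) (LogSection.ev_eq (⟨x, hx⟩ : U) ⟨y, hy⟩)

lemma eventually_mem_localRing {x : X} {a : X.functionField} (ha : a ∈ localRing X x) :
    ∀ᶠ y in 𝓝 x, a ∈ localRing X y := by
  obtain ⟨a, rfl⟩ := ha
  obtain ⟨U, hxU, a, rfl⟩ := X.presheaf.exists_germ_eq a
  filter_upwards [U.isOpen.mem_nhds hxU] with y hy
  exact ⟨X.presheaf.germ U y hy a, algebraMap_germ_eq hy hxU a⟩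

/-- A local equation of a closed subscheme is an equation in a neighbourhood. -/
lemma eventually_exists_stalkIdeal_eq [IsLocallyNoetherian X] (I : X.IdealSheafData) {x : X}
    {h : X.presheaf.stalk x} (hh : stalkIdeal I x = Ideal.span {h}) :
    ∀ᶠ y in 𝓝 x, ∃ h' : X.presheaf.stalk y, stalkIdeal I y = Ideal.span {h'} ∧
      algebraMap _ X.functionField h' = algebraMap _ X.functionField h := by
  obtain ⟨O, hxO, b, rfl⟩ := X.presheaf.exists_germ_eq h
  obtain ⟨U, hU, hxU, -⟩ := Opens.isBasis_iff_nbhd.mp X.isBasis_affineOpens (Opens.mem_top x)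
  have := IsLocallyNoetherian.component_noetherian (X := X) ⟨U, hU⟩
  obtain ⟨O', hxO', hO, hO'⟩ := exists_nhds_stalkIdeal_eq_span I ⟨U, hU⟩
    (IsNoetherian.noetherian _) hxU hxO b hh
  filter_upwards [O'.isOpen.mem_nhds hxO'] with y hy
  exact ⟨_, hO' y hy, algebraMap_germ_eq _ _ _⟩

lemma eventually_mem_logStalk [IsLocallyNoetherian X] {J : Type w} {D : J → X.IdealSheafData}
    {x : X} {ω : RationalForms f} (hω : ω ∈ logStalk f D x) :
    ∀ᶠ y in 𝓝 x, ω ∈ logStalk f D y := by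
  induction hω using Submodule.span_induction with
  | mem ω h =>
    rcases h with ⟨g, rfl⟩ | ⟨j, h, hj, rfl⟩
    · filter_upwards [eventually_mem_localRing (x := x) ⟨g, rfl⟩] with y hy
      obtain ⟨g', hg'⟩ := hy
      rw [← hg']
      exact d_mem_logStalk f D g'
    · filter_upwards [eventually_exists_stalkIdeal_eq (D j) hj] with y ⟨h', hh', he⟩
      rw [← he]
      exact dlog_mem_logStalk f hh'
  | zero => exact Eventually.of_forall fun y => Submodule.zero_mem _
  | add a b _ _ ha hb =>
    filter_upwards [ha, hb] with y hya hyb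
    exact Submodule.add_mem _ hya hyb
  | smul c a _ ha =>
    filter_upwards [ha, eventually_mem_localRing c.2] with y hya hyc
    exact Submodule.smul_mem _ (⟨c, hyc⟩ : localRing X y) hya

lemma eventually_mem_span_range {ι : Type*} [Fintype ι] {e : ι → RationalForms f} {x : X}
    {ω : RationalForms f} (hω : ω ∈ Submodule.span (localRing X x) (Set.range e)) :
    ∀ᶠ y in 𝓝 x, ω ∈ Submodule.span (localRing X y) (Set.range e) := by
  obtain ⟨r, rfl⟩ := (Submodule.mem_span_range_iff_exists_fun _).mp hω
  filter_upwards [eventually_all.mpr fun i => eventually_mem_localRing (r i).2] with y hy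
  exact Submodule.sum_mem _ fun i _ => Submodule.smul_mem _ (⟨r i, hy i⟩ : localRing X y)
    (Submodule.subset_span ⟨i, rfl⟩)

/-- If the differentials of generators of the coordinate ring of an affine neighbourhood of `x` lie
in a module over the local ring at `x`, then so do all differentials of elements of that ring. -/
lemma d_mem_of_adjoin_eq_top {U : X.Opens} (hU : IsAffineOpen U) {x : X} (hx : x ∈ U)
    {s : Set Γ(X, U)}
    (hs : @Algebra.adjoin k Γ(X, U) _ _ (toSections f U).hom.toAlgebra s = ⊤)
    {N : Submodule (localRing X x) (RationalForms f)}
    (hN : ∀ a ∈ s, d f (algebraMap _ X.functionField (X.presheaf.germ U x hx a)) ∈ N)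
    (g : X.presheaf.stalk x) : d f (algebraMap _ X.functionField g) ∈ N := by
  let P := (derivationSubring (rationalD f) (localRing X x) N).comap
    (algebraMap (X.presheaf.stalk x) X.functionField)
  suffices h : g ∈ P from h.2
  have hP : ∀ a : Γ(X, U), X.presheaf.germ U x hx a ∈ P := by
    let := (toSections f U).hom.toAlgebra
    intro a
    have ha : a ∈ Algebra.adjoin k s := hs ▸ Algebra.mem_top
    induction ha using Algebra.adjoin_induction with
    | mem a ha => exact ⟨⟨_, rfl⟩, hN a ha⟩
    | algebraMap c =>
      refine ⟨⟨_, rfl⟩, ?_⟩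
      have h1 : algebraMap _ X.functionField (X.presheaf.germ U x hx (algebraMap k Γ(X, U) c)) =
          (toFunctionField f).hom c := by
        rw [← toStalk_stalkSpecializes f x, ← toSections_germ f hx]
        rfl
      rw [h1, rationalD_apply, d_toFunctionField]
      exact N.zero_mem
    | add a b _ _ ha hb => rw [map_add]; exact P.add_mem ha hb
    | mul a b _ _ ha hb => rw [map_mul]; exact P.mul_mem ha hb
  let := X.presheaf.algebra_section_stalk ⟨x, hx⟩
  have hloc := hU.isLocalization_stalk ⟨x, hx⟩
  obtain ⟨a, b, rfl⟩ := IsLocalization.exists_mk'_eq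
    (hU.primeIdealOf ⟨x, hx⟩).asIdeal.primeCompl g
  rw [IsLocalization.mk'_eq_mul_mk'_one]
  refine P.mul_mem (hP a) ?_
  refine mem_derivationSubring_of_mul_eq_one _ (hP b) ⟨_, rfl⟩ ?_
  rw [← map_mul, mul_comm, ← map_one (algebraMap (X.presheaf.stalk x) X.functionField)]
  exact congrArg _ ((IsLocalization.mk'_spec _ _ _).trans (map_one _))

/-- The logarithmic forms on a smooth variety are locally free: near every point, they are generated
by a fixed family of linearly independent rational forms. -/
theorem HasNormalCrossings.exists_frame [PerfectField k] [Smooth f] {J : Type w} [Finite J]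
    {E : J → X.IdealSheafData} (hE : HasNormalCrossings E) (x : X) :
    ∃ (U : X.Opens) (ι : Type u) (_ : Fintype ι) (e : ι → RationalForms f), x ∈ U ∧
      LinearIndependent X.functionField e ∧
      ∀ y ∈ U, logStalk f E y = Submodule.span (localRing X y) (Set.range e) := by
  have hnoeth : IsLocallyNoetherian X := LocallyOfFiniteType.isLocallyNoetherian f
  obtain ⟨ι, hι, e, hli, he⟩ := hE.exists_frame_logStalk f x
  obtain ⟨n, t, c, h, -, -, -, -, -, hEh⟩ := hE.exists_equations x
  obtain ⟨U, hU, hxU, -⟩ := Opens.isBasis_iff_nbhd.mp X.isBasis_affineOpens (Opens.mem_top x)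
  have hft : @Algebra.FiniteType k Γ(X, U) _ _ (toSections f U).hom.toAlgebra :=
    finiteType_toSections f hU
  obtain ⟨s, hs⟩ := hft.out
  suffices h : ∀ᶠ y in 𝓝 x, logStalk f E y = Submodule.span (localRing X y) (Set.range e) by
    obtain ⟨O, hO, hO', hxO⟩ := mem_nhds_iff.mp h
    exact ⟨⟨O, hO'⟩, ι, hι, e, hxO, hli, hO⟩
  -- Equality of the two modules is a matter of finitely many memberships, each of which spreads
  -- from `x` to a neighborhood: the forms `e i`, the differentials of finitely many functions that
  -- generate the coordinate ring of `U`, and the logarithmic differentials of the equations `h j`.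
  have h1 : ∀ᶠ y in 𝓝 x, ∀ i, e i ∈ logStalk f E y :=
    eventually_all.mpr fun i => eventually_mem_logStalk f (he ▸ Submodule.subset_span ⟨i, rfl⟩)
  have h2 : ∀ᶠ y in 𝓝 x, ∀ a ∈ s, d f (algebraMap _ X.functionField (X.presheaf.germ U x hxU a)) ∈
      Submodule.span (localRing X y) (Set.range e) :=
    (Filter.eventually_all_finset s).mpr fun a _ =>
      eventually_mem_span_range f (he ▸ d_mem_logStalk f E _)
  have h3 : ∀ᶠ y in 𝓝 x, ∀ j, ∃ h' : X.presheaf.stalk y, stalkIdeal (E j) y = Ideal.span {h'} ∧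
      algebraMap _ X.functionField h' = algebraMap _ X.functionField (h j) :=
    eventually_all.mpr fun j => eventually_exists_stalkIdeal_eq (E j) (hEh j)
  have h4 : ∀ᶠ y in 𝓝 x, ∀ j, (algebraMap _ X.functionField (h j))⁻¹ •
      d f (algebraMap _ X.functionField (h j)) ∈ Submodule.span (localRing X y) (Set.range e) :=
    eventually_all.mpr fun j => eventually_mem_span_range f (he ▸ dlog_mem_logStalk f (hEh j))
  filter_upwards [h1, h2, h3, h4, U.isOpen.mem_nhds hxU] with y hy1 hy2 hy3 hy4 hyU
  choose h' hh' hh'h using hy3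
  refine le_antisymm (logStalk_le f hh' (fun g => ?_) fun j => ?_) ?_
  · refine d_mem_of_adjoin_eq_top f hU hyU hs (fun a ha => ?_) g
    rw [algebraMap_germ_eq hyU hxU]
    exact hy2 a ha
  · rw [hh'h]
    exact hy4 j
  · refine Submodule.span_le.mpr ?_
    rintro _ ⟨i, rfl⟩
    exact hy1 i

end Spreading


/-! ### Sheaves of modules with compatible local frames -/

section ModuleSections

variable {X : Scheme.{u}}

/-- Restriction of sections of a sheaf of modules. -/
noncomputable def resM (M : X.Modules) {U O : X.Opens} (h : O ≤ U) : Γ(M, U) →+ Γ(M, O) :=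
  (M.presheaf.map (homOfLE h).op).hom

/-- Restriction of regular functions. -/
noncomputable def resO {U O : X.Opens} (h : O ≤ U) : Γ(X, U) →+* Γ(X, O) :=
  (X.presheaf.map (homOfLE h).op).hom

variable {M N : X.Modules} {U O P : X.Opens}

lemma resM_resM (h : O ≤ U) (h' : P ≤ O) (m : Γ(M, U)) :
    resM M h' (resM M h m) = resM M (h'.trans h) m :=
  (CategoryTheory.comp_apply _ _ _).symm.trans
    (congrArg (fun t => t m) (M.presheaf.map_comp (homOfLE h).op (homOfLE h').op).symm)

lemma resM_self (m : Γ(M, U)) : resM M le_rfl m = m :=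
  congrArg (fun t => t m) (M.presheaf.map_id (.op U))

lemma resM_smul (h : O ≤ U) (r : Γ(X, U)) (m : Γ(M, U)) :
    resM M h (r • m) = resO h r • resM M h m :=
  M.map_smul (homOfLE h) r m

lemma resM_app (φ : M ⟶ N) (h : O ≤ U) (m : Γ(M, U)) :
    resM N h (φ.app U m) = φ.app O (resM M h m) :=
  (congrArg (fun t => t m) (φ.mapPresheaf.naturality (homOfLE h).op)).symm

/-- Sections of a sheaf of modules that agree near every point are equal. -/
lemma eq_of_locally_resM_eq {m m' : Γ(M, U)}
    (h : ∀ x ∈ U, ∃ (O : X.Opens) (hO : O ≤ U), x ∈ O ∧ resM M hO m = resM M hO m') : m = m' := by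
  choose O hO hx heq using h
  refine TopCat.Sheaf.eq_of_locally_eq' ⟨M.presheaf, M.isSheaf⟩ (fun x : U => O x.1 x.2) U
    (fun x => homOfLE (hO x.1 x.2)) (fun x hxU => ?_) m m' fun x => heq x.1 x.2
  exact Opens.mem_iSup.mpr ⟨⟨x, hxU⟩, hx x hxU⟩

/-- Gluing of sections of a sheaf of modules given near every point. -/
lemma exists_resM_eq (O : U → X.Opens) (hO : ∀ x, O x ≤ U) (hx : ∀ x : U, x.1 ∈ O x)
    (m : ∀ x, Γ(M, O x))
    (hm : ∀ x y, resM M (inf_le_left : O x ⊓ O y ≤ O x) (m x) =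
      resM M (inf_le_right : O x ⊓ O y ≤ O y) (m y)) :
    ∃ m' : Γ(M, U), ∀ x, resM M (hO x) m' = m x := by
  obtain ⟨m', hm', -⟩ := TopCat.Sheaf.existsUnique_gluing' ⟨M.presheaf, M.isSheaf⟩ O U
    (fun x => homOfLE (hO x)) (fun x hxU => Opens.mem_iSup.mpr ⟨⟨x, hxU⟩, hx ⟨x, hxU⟩⟩) m hm
  exact ⟨m', hm'⟩

/-- A morphism of sheaves of modules from compatible linear maps on sections. -/
lemma exists_hom (g : ∀ U : X.Opens, Γ(M, U) → Γ(N, U))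
    (hadd : ∀ U m m', g U (m + m') = g U m + g U m')
    (hsmul : ∀ U (r : Γ(X, U)) m, g U (r • m) = r • g U m)
    (hres : ∀ {U O : X.Opens} (h : O ≤ U) m, g O (resM M h m) = resM N h (g U m)) :
    ∃ φ : M ⟶ N, ∀ U m, φ.app U m = g U m := by
  let φ : M.presheaf ⟶ N.presheaf :=
    { app := fun U => AddCommGrpCat.ofHom (AddMonoidHom.mk' (g U.unop) (hadd U.unop))
      naturality := fun U O i => by
        ext m
        exact hres i.unop.le m }
  exact ⟨⟨PresheafOfModules.homMk φ fun U r m => hsmul U.unop r m⟩, fun U m => rfl⟩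

variable {W V : Scheme.{u}} {π : W ⟶ V} {M : V.Modules} {L : W.Modules}

/-- The map on sections given by a morphism to a direct image. -/
noncomputable def adjApp (α : M ⟶ (Scheme.Modules.pushforward π).obj L) (U : V.Opens) :
    Γ(M, U) →+ Γ(L, π ⁻¹ᵁ U) :=
  (α.app U).hom

lemma adjApp_smul (α : M ⟶ (Scheme.Modules.pushforward π).obj L) {U : V.Opens} (r : Γ(V, U))
    (m : Γ(M, U)) : adjApp α U (r • m) = (π.app U).hom r • adjApp α U m :=
  α.app_smul r m

lemma resM_adjApp (α : M ⟶ (Scheme.Modules.pushforward π).obj L) {U O : V.Opens} (h : O ≤ U)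
    (m : Γ(M, U)) : resM L (π.preimage_mono h) (adjApp α U m) = adjApp α O (resM M h m) :=
  resM_app α h m

end ModuleSections


section PullbackFrame

variable {W V : Scheme.{u}} {π : W ⟶ V} {M : V.Modules} {L N : W.Modules}

/-- The linear combination on `O` of sections of a sheaf of modules with the coefficients `f`. -/
noncomputable def comb (L : W.Modules) {U O : W.Opens} (h : O ≤ U) {ι : Type u} [Fintype ι]
    (a : ι → Γ(L, U)) (f : ι → Γ(W, O)) : Γ(L, O) :=
  ∑ i, f i • resM L h (a i)

lemma resM_comb {U O P : W.Opens} (h : O ≤ U) (h' : P ≤ O) {ι : Type u} [Fintype ι]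
    (a : ι → Γ(L, U)) (f : ι → Γ(W, O)) :
    resM L h' (comb L h a f) = comb L (h'.trans h) a fun i => resO h' (f i) := by
  simp only [comb, map_sum, resM_smul, resM_resM]

lemma comb_add {U O : W.Opens} (h : O ≤ U) {ι : Type u} [Fintype ι]
    (a : ι → Γ(L, U)) (f g : ι → Γ(W, O)) :
    comb L h a (f + g) = comb L h a f + comb L h a g := by
  simp only [comb, Pi.add_apply, add_smul, Finset.sum_add_distrib]

lemma comb_sub {U O : W.Opens} (h : O ≤ U) {ι : Type u} [Fintype ι]
    (a : ι → Γ(L, U)) (f g : ι → Γ(W, O)) :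
    comb L h a (f - g) = comb L h a f - comb L h a g := by
  simp only [comb, Pi.sub_apply, sub_smul, Finset.sum_sub_distrib]

lemma comb_smul {U O : W.Opens} (h : O ≤ U) {ι : Type u} [Fintype ι]
    (a : ι → Γ(L, U)) (r : Γ(W, O)) (f : ι → Γ(W, O)) :
    comb L h a (fun i => r * f i) = r • comb L h a f := by
  simp only [comb, Finset.smul_sum, mul_smul]

/-- Sections `s` of `M` over `U` form a frame compatible with `α : M ⟶ π_* L` if they generate `M`
locally on `U` and their images form a basis of `L` locally on `π⁻¹ U`. -/
structure IsPullbackFrame (α : M ⟶ (Scheme.Modules.pushforward π).obj L) (U : V.Opens) {ι : Type u}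
    [Fintype ι] (s : ι → Γ(M, U)) : Prop where
  exists_eq_comb : ∀ (O : V.Opens) (hO : O ≤ U) (m : Γ(M, O)), ∀ y ∈ O,
    ∃ (O' : V.Opens) (h : O' ≤ O), y ∈ O' ∧ ∃ f : ι → Γ(V, O'), resM M h m = comb M (h.trans hO) s f
  exists_eq_comb_adjApp : ∀ (O : W.Opens) (hO : O ≤ π ⁻¹ᵁ U) (l : Γ(L, O)), ∀ x ∈ O,
    ∃ (O' : W.Opens) (h : O' ≤ O), x ∈ O' ∧ ∃ f : ι → Γ(W, O'),
      resM L h l = comb L (h.trans hO) (fun i => adjApp α U (s i)) f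
  eq_zero_of_comb : ∀ (O : W.Opens) (hO : O ≤ π ⁻¹ᵁ U) (f : ι → Γ(W, O)),
    comb L hO (fun i => adjApp α U (s i)) f = 0 → f = 0

lemma resM_adjApp_comb (γ : M ⟶ (Scheme.Modules.pushforward π).obj L) {U O : V.Opens} (h : O ≤ U)
    {P : W.Opens} (hP : P ≤ π ⁻¹ᵁ O) {ι : Type u} [Fintype ι] (s : ι → Γ(M, U))
    (f : ι → Γ(V, O)) :
    resM L hP (adjApp γ O (comb M h s f)) =
      comb L (hP.trans (π.preimage_mono h)) (fun i => adjApp γ U (s i))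
        fun i => resO hP ((π.app O).hom (f i)) := by
  simp only [comb, map_sum, adjApp_smul, resM_smul, ← resM_adjApp, resM_resM]

variable (α : M ⟶ (Scheme.Modules.pushforward π).obj L)
  (β : M ⟶ (Scheme.Modules.pushforward π).obj N)
  {U : W → V.Opens} {ι : W → Type u} [∀ w, Fintype (ι w)] (s : ∀ w, ι w → Γ(M, U w))

/-- Sections `l` of `L` and `n` of `N` correspond to each other if, near every point, they are the
same combination of the images of a frame under `α` and `β`. -/
def FrameRel {O : W.Opens} (l : Γ(L, O)) (n : Γ(N, O)) : Prop :=
  ∀ x ∈ O, ∃ (O' : W.Opens) (h : O' ≤ O) (h' : O' ≤ π ⁻¹ᵁ U x), x ∈ O' ∧ ∃ f : ι x → Γ(W, O'),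
    resM L h l = comb L h' (fun i => adjApp α (U x) (s x i)) f ∧
    resM N h n = comb N h' (fun i => adjApp β (U x) (s x i)) f

variable {α β s}

lemma FrameRel.resM {O P : W.Opens} {l : Γ(L, O)} {n : Γ(N, O)} (hln : FrameRel α β s l n)
    (h : P ≤ O) : FrameRel α β s (resM L h l) (LogForms.resM N h n) := by
  intro x hx
  obtain ⟨O', h1, h2, hxO', f, hl, hn⟩ := hln x (h hx)
  refine ⟨O' ⊓ P, inf_le_right, inf_le_left.trans h2, ⟨hxO', hx⟩, fun i => resO inf_le_left (f i),
    ?_, ?_⟩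
  · rw [resM_resM, ← resM_comb h2, ← hl, resM_resM]
  · rw [resM_resM, ← resM_comb h2, ← hn, resM_resM]

/-- The correspondence can be checked locally. -/
lemma FrameRel.of_locally {O : W.Opens} {l : Γ(L, O)} {n : Γ(N, O)}
    (h : ∀ x ∈ O, ∃ (P : W.Opens) (hP : P ≤ O), x ∈ P ∧
      FrameRel α β s (LogForms.resM L hP l) (LogForms.resM N hP n)) : FrameRel α β s l n := by
  intro x hx
  obtain ⟨P, hP, hxP, hln⟩ := h x hx
  obtain ⟨O', h1, h2, hxO', f, hl, hn⟩ := hln x hxP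
  refine ⟨O', h1.trans hP, h2, hxO', f, ?_, ?_⟩
  · rw [← hl, resM_resM]
  · rw [← hn, resM_resM]

lemma FrameRel.add {O : W.Opens} {l l' : Γ(L, O)} {n n' : Γ(N, O)} (hln : FrameRel α β s l n)
    (hln' : FrameRel α β s l' n') : FrameRel α β s (l + l') (n + n') := by
  intro x hx
  obtain ⟨O₁, h1, h2, hxO₁, f, hl, hn⟩ := hln x hx
  obtain ⟨O₂, h1', h2', hxO₂, f', hl', hn'⟩ := hln' x hx
  refine ⟨O₁ ⊓ O₂, inf_le_left.trans h1, inf_le_left.trans h2, ⟨hxO₁, hxO₂⟩,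
    (fun i => resO inf_le_left (f i)) + fun i => resO inf_le_right (f' i), ?_, ?_⟩
  · rw [comb_add, ← resM_comb h2, ← resM_comb h2', ← hl, ← hl', resM_resM, resM_resM, map_add]
  · rw [comb_add, ← resM_comb h2, ← resM_comb h2', ← hn, ← hn', resM_resM, resM_resM, map_add]

lemma FrameRel.smul {O : W.Opens} {l : Γ(L, O)} {n : Γ(N, O)} (hln : FrameRel α β s l n)
    (r : Γ(W, O)) : FrameRel α β s (r • l) (r • n) := by
  intro x hx
  obtain ⟨O₁, h1, h2, hxO₁, f, hl, hn⟩ := hln x hx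
  refine ⟨O₁, h1, h2, hxO₁, fun i => resO h1 r * f i, ?_, ?_⟩
  · rw [comb_smul, resM_smul, hl]
  · rw [comb_smul, resM_smul, hn]

lemma FrameRel.zero {O : W.Opens} (hU : ∀ w, π w ∈ U w) :
    FrameRel α β s (0 : Γ(L, O)) (0 : Γ(N, O)) := fun x hx =>
  ⟨O ⊓ π ⁻¹ᵁ U x, inf_le_left, inf_le_right, ⟨hx, hU x⟩, 0, by simp [comb], by simp [comb]⟩

lemma FrameRel.sum {O : W.Opens} (hU : ∀ w, π w ∈ U w) {κ : Type u} (T : Finset κ)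
    {l : κ → Γ(L, O)} {n : κ → Γ(N, O)} (hln : ∀ i ∈ T, FrameRel α β s (l i) (n i)) :
    FrameRel α β s (∑ i ∈ T, l i) (∑ i ∈ T, n i) := by
  classical
  induction T using Finset.induction_on with
  | empty => exact FrameRel.zero hU
  | insert i T hi ih =>
    rw [Finset.sum_insert hi, Finset.sum_insert hi]
    exact (hln i (Finset.mem_insert_self i T)).add
      (ih fun j hj => hln j (Finset.mem_insert_of_mem hj))

lemma FrameRel.unique (hs : ∀ w, IsPullbackFrame α (U w) (s w)) {O : W.Opens} {l : Γ(L, O)}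
    {n n' : Γ(N, O)} (hln : FrameRel α β s l n) (hln' : FrameRel α β s l n') : n = n' := by
  refine eq_of_locally_resM_eq fun x hx => ?_
  obtain ⟨O₁, h1, h2, hxO₁, f, hl, hn⟩ := hln x hx
  obtain ⟨O₂, h1', h2', hxO₂, f', hl', hn'⟩ := hln' x hx
  refine ⟨O₁ ⊓ O₂, inf_le_left.trans h1, ⟨hxO₁, hxO₂⟩, ?_⟩
  have h3 : (fun i => resO inf_le_left (f i)) - (fun i => resO inf_le_right (f' i)) = 0 := by
    refine (hs x).eq_zero_of_comb (O₁ ⊓ O₂) (inf_le_left.trans h2) _ ?_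
    rw [comb_sub, ← resM_comb h2 inf_le_left, ← resM_comb h2' inf_le_right, ← hl, ← hl', resM_resM,
      resM_resM, sub_self]
  rw [← resM_resM h1 inf_le_left, hn, ← resM_resM h1' inf_le_right, hn', resM_comb, resM_comb,
    sub_eq_zero.mp h3]

/-- The images of a section of `M` correspond to each other. -/
lemma frameRel_adjApp (hs : ∀ w, IsPullbackFrame α (U w) (s w)) (hU : ∀ w, π w ∈ U w)
    {O : V.Opens} (m : Γ(M, O)) {P : W.Opens} (hP : P ≤ π ⁻¹ᵁ O) :
    FrameRel α β s (resM L hP (adjApp α O m)) (resM N hP (adjApp β O m)) := by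
  intro x hx
  obtain ⟨O', h, hxO', f, hf⟩ := (hs x).exists_eq_comb (O ⊓ U x) inf_le_right
    (resM M inf_le_left m) (π x) ⟨hP hx, hU x⟩
  rw [resM_resM] at hf
  have key : ∀ {Q : W.Modules} (γ : M ⟶ (Scheme.Modules.pushforward π).obj Q),
      resM Q (inf_le_left : P ⊓ π ⁻¹ᵁ O' ≤ P) (resM Q hP (adjApp γ O m)) =
        comb Q (inf_le_right.trans (π.preimage_mono (h.trans inf_le_right)))
          (fun i => adjApp γ (U x) (s x i)) fun i => resO inf_le_right ((π.app O').hom (f i)) := by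
    intro Q γ
    rw [← resM_adjApp_comb γ (h.trans inf_le_right) inf_le_right, ← hf, ← resM_adjApp, resM_resM,
      resM_resM]
  exact ⟨P ⊓ π ⁻¹ᵁ O', inf_le_left, inf_le_right.trans (π.preimage_mono (h.trans inf_le_right)),
    ⟨hx, hxO'⟩, _, key α, key β⟩

/-- Every section of `L` corresponds to a section of `N`: locally this is the combination with the
same coefficients, and these are unique, hence glue. -/
lemma exists_frameRel (hs : ∀ w, IsPullbackFrame α (U w) (s w)) (hU : ∀ w, π w ∈ U w)
    {O : W.Opens} (l : Γ(L, O)) : ∃ n : Γ(N, O), FrameRel α β s l n := by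
  have hloc : ∀ x : O, ∃ (P : W.Opens) (hP : P ≤ O) (n : Γ(N, P)), x.1 ∈ P ∧
      FrameRel α β s (resM L hP l) n := by
    intro x
    obtain ⟨P, hP, hxP, f, hf⟩ := (hs x.1).exists_eq_comb_adjApp (O ⊓ π ⁻¹ᵁ U x.1) inf_le_right
      (resM L inf_le_left l) x.1 ⟨x.2, hU x.1⟩
    refine ⟨P, hP.trans inf_le_left,
      comb N (hP.trans inf_le_right) (fun i => adjApp β (U x.1) (s x.1 i)) f, hxP, ?_⟩
    rw [← resM_resM inf_le_left hP, hf]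
    exact FrameRel.sum hU _ fun i _ => (frameRel_adjApp hs hU (s x.1 i) _).smul (f i)
  choose P hP n hxP hn using hloc
  obtain ⟨n', hn'⟩ := exists_resM_eq P hP hxP n fun x y => by
    have h1 := (hn x).resM (inf_le_left : P x ⊓ P y ≤ P x)
    have h2 := (hn y).resM (inf_le_right : P x ⊓ P y ≤ P y)
    rw [resM_resM] at h1 h2
    exact h1.unique hs h2
  exact ⟨n', FrameRel.of_locally fun x hx =>
    ⟨P ⟨x, hx⟩, hP _, hxP ⟨x, hx⟩, by rw [hn']; exact hn _⟩⟩

/-- If `M` has local frames compatible with `α : M ⟶ π_* L`, then `α` is universal among the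
morphisms from `M` to direct images. -/
theorem existsUnique_comp_pushforward (hs : ∀ w, IsPullbackFrame α (U w) (s w))
    (hU : ∀ w, π w ∈ U w) (β : M ⟶ (Scheme.Modules.pushforward π).obj N) :
    ∃! ψ : L ⟶ N, α ≫ (Scheme.Modules.pushforward π).map ψ = β := by
  choose g hg using fun (O : W.Opens) (l : Γ(L, O)) => exists_frameRel (β := β) hs hU l
  have heq : ∀ {O : W.Opens} {l : Γ(L, O)} {n : Γ(N, O)}, FrameRel α β s l n → g O l = n :=
    fun h => (hg _ _).unique hs h
  obtain ⟨ψ, hψ⟩ := exists_hom g (fun O l l' => heq ((hg O l).add (hg O l')))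
    (fun O r l => heq ((hg O l).smul r)) fun h l => heq ((hg _ l).resM h)
  refine ⟨ψ, ?_, fun ψ' hψ' => ?_⟩
  · refine Scheme.Modules.hom_ext _ _ fun O => ?_
    ext m
    refine (hψ (π ⁻¹ᵁ O) (adjApp α O m)).trans (heq ?_)
    have h1 := frameRel_adjApp (β := β) hs hU m (le_refl (π ⁻¹ᵁ O))
    rw [resM_self, resM_self] at h1
    exact h1
  · have hψ'α : ∀ (O : V.Opens) (m : Γ(M, O)),
        ψ'.app (π ⁻¹ᵁ O) (adjApp α O m) = adjApp β O m := by
      subst hψ'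
      exact fun O m => rfl
    refine Scheme.Modules.hom_ext _ _ fun O => ?_
    ext l
    refine Eq.trans ?_ (hψ O l).symm
    refine (heq fun x hx => ?_).symm
    obtain ⟨P, hP, hxP, f, hf⟩ := (hs x).exists_eq_comb_adjApp (O ⊓ π ⁻¹ᵁ U x) inf_le_right
      (resM L inf_le_left l) x ⟨hx, hU x⟩
    rw [resM_resM] at hf
    refine ⟨P, hP.trans inf_le_left, hP.trans inf_le_right, hxP, f, hf, ?_⟩
    rw [resM_app, hf]
    simp only [comb, map_sum, Scheme.Modules.Hom.app_smul, ← resM_app, hψ'α]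

/-- If `M` has local frames compatible with `α : M ⟶ π_* L`, then the adjoint of `α` identifies
`π^* M` with `L`. -/
theorem isIso_homEquiv_symm (hs : ∀ w, IsPullbackFrame α (U w) (s w)) (hU : ∀ w, π w ∈ U w) :
    IsIso (((Scheme.Modules.pullbackPushforwardAdjunction π).homEquiv _ _).symm α) := by
  refine (isIso_iff_coyoneda_map_bijective _).mpr fun N => ?_
  let adj := Scheme.Modules.pullbackPushforwardAdjunction π
  have key : ∀ ψ : L ⟶ N, (adj.homEquiv _ _) ((adj.homEquiv _ _).symm α ≫ ψ) =
      α ≫ (Scheme.Modules.pushforward π).map ψ := fun ψ => by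
    rw [Adjunction.homEquiv_naturality_right, Equiv.apply_symm_apply]
  refine ⟨fun ψ ψ' h => ?_, fun γ => ?_⟩
  · refine (existsUnique_comp_pushforward hs hU
      (α ≫ (Scheme.Modules.pushforward π).map ψ')).unique ?_ rfl
    rw [← key, ← key]
    exact congrArg _ h
  · obtain ⟨ψ, hψ, -⟩ := existsUnique_comp_pushforward hs hU (adj.homEquiv _ _ γ)
    exact ⟨ψ, (adj.homEquiv _ _).injective ((key ψ).trans hψ)⟩

end PullbackFrame


/-! ### The sheaf of logarithmic forms and its pullback -/

section LogFormsSections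

variable {k : Type u} [Field k] {X : Scheme.{u}} [IsIntegral X] {f : X ⟶ Spec (CommRingCat.of k)}
  {J : Type w} {D : J → X.IdealSheafData} {U O : X.Opens}

lemma sectionForm_ext {m m' : Γ(logForms f D, U)} (h : ∀ x, sectionForm m x = sectionForm m' x) :
    m = m' :=
  LogSection.ext (f := f) (D := D) (funext h)

lemma sectionForm_const (m : Γ(logForms f D, U)) (x y : U) : sectionForm m x = sectionForm m y :=
  LogSection.const (f := f) (D := D) m x y

lemma sectionForm_mem (m : Γ(logForms f D, U)) (x : U) : sectionForm m x ∈ logStalk f D x.1 :=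
  LogSection.mem (f := f) (D := D) m x

lemma sectionForm_resM (h : O ≤ U) (m : Γ(logForms f D, U)) (x : O) :
    sectionForm (resM (logForms f D) h m) x = sectionForm m ⟨x.1, h x.2⟩ := rfl

lemma sectionForm_add (m m' : Γ(logForms f D, U)) (x : U) :
    sectionForm (m + m') x = sectionForm m x + sectionForm m' x := rfl

lemma sectionForm_smul (r : Γ(X, U)) (m : Γ(logForms f D, U)) (x : U) :
    sectionForm (r • m) x = LogSection.ev x r • sectionForm m x := rfl

lemma sectionForm_zero (x : U) : sectionForm (0 : Γ(logForms f D, U)) x = 0 := rfl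

lemma sectionForm_sum {ι : Type u} (T : Finset ι) (m : ι → Γ(logForms f D, U)) (x : U) :
    sectionForm (∑ i ∈ T, m i) x = ∑ i ∈ T, sectionForm (m i) x := by
  classical
  induction T using Finset.induction_on with
  | empty => exact sectionForm_zero x
  | insert i T hi ih => rw [Finset.sum_insert hi, Finset.sum_insert hi, sectionForm_add, ih]

lemma sectionForm_comb (h : O ≤ U) {ι : Type u} [Fintype ι] (a : ι → Γ(logForms f D, U))
    (g : ι → Γ(X, O)) (x : O) :
    sectionForm (comb (logForms f D) h a g) x =
      ∑ i, LogSection.ev x (g i) • sectionForm (a i) ⟨x.1, h x.2⟩ := by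
  simp only [comb, sectionForm_sum, sectionForm_smul, sectionForm_resM]

/-- Sections whose forms generate the stalks generate the sheaf of logarithmic forms locally. -/
lemma exists_resM_eq_comb {ι : Type u} [Fintype ι] {e : ι → RationalForms f}
    {a : ι → Γ(logForms f D, U)} (ha : ∀ i x, sectionForm (a i) x = e i)
    (he : ∀ x ∈ U, logStalk f D x ≤ Submodule.span (localRing X x) (Set.range e)) (hO : O ≤ U)
    (m : Γ(logForms f D, O)) {x : X} (hx : x ∈ O) :
    ∃ (O' : X.Opens) (h : O' ≤ O), x ∈ O' ∧ ∃ g : ι → Γ(X, O'),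
      resM _ h m = comb _ (h.trans hO) a g := by
  obtain ⟨r, hr⟩ := (Submodule.mem_span_range_iff_exists_fun _).mp
    (he x (hO hx) (sectionForm_mem m ⟨x, hx⟩))
  have hloc : ∀ i, ∃ (T : X.Opens) (hT : x ∈ T) (b : Γ(X, T)),
      algebraMap _ X.functionField (X.presheaf.germ T x hT b) = (r i).1 := fun i => by
    obtain ⟨b, hb⟩ := (r i).2
    obtain ⟨T, hT, b, rfl⟩ := X.presheaf.exists_germ_eq b
    exact ⟨T, hT, b, hb⟩
  choose T hT b hb using hloc
  let O' : X.Opens := O ⊓ ⟨⋂ i, (T i : Set X), isOpen_iInter_of_finite fun i => (T i).isOpen⟩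
  have hO'T : ∀ i, O' ≤ T i := fun i => inf_le_right.trans (Set.iInter_subset _ i)
  refine ⟨O', inf_le_left, ⟨hx, Set.mem_iInter.mpr hT⟩, fun i => resO (hO'T i) (b i), ?_⟩
  refine sectionForm_ext fun y => ?_
  rw [sectionForm_resM, sectionForm_const m _ ⟨x, hx⟩, ← hr, sectionForm_comb]
  refine Finset.sum_congr rfl fun i _ => ?_
  rw [ha, Subring.smul_def]
  congr 1
  rw [← hb i, algebraMap_germ_eq (hT i) (hO'T i y.2)]
  exact (LogSection.ev_map (homOfLE (hO'T i)) y (b i)).symm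

/-- Linearly independent forms define linearly independent sections. -/
lemma eq_zero_of_comb_eq_zero {ι : Type u} [Fintype ι] {e : ι → RationalForms f}
    (hli : LinearIndependent X.functionField e) {a : ι → Γ(logForms f D, U)}
    (ha : ∀ i x, sectionForm (a i) x = e i) (hO : O ≤ U) {g : ι → Γ(X, O)}
    (hg : comb _ hO a g = 0) : g = 0 := by
  funext i
  refine TopCat.Presheaf.section_ext X.sheaf O _ _ fun x hx => ?_
  have h1 := congrArg (fun m => sectionForm m ⟨x, hx⟩) hg
  simp only [sectionForm_comb, ha, sectionForm_zero] at h1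
  have h2 := Fintype.linearIndependent_iff.mp hli _ h1 i
  apply algebraMap_functionField_injective x
  refine h2.trans ?_
  rw [Pi.zero_apply]
  exact (map_zero (LogSection.ev (⟨x, hx⟩ : O))).symm

end LogFormsSections

section LogFormsPullback

variable {k : Type u} [Field k] {W V : Scheme.{u}} [IsIntegral W] [IsIntegral V]
  (v : V ⟶ Spec (CommRingCat.of k)) {π : W ⟶ V} [IsDominant π] {J J' : Type w}
  {E : J → V.IdealSheafData} {D : J' → W.IdealSheafData}

/-- If pullback of rational forms preserves logarithmic forms, it defines a morphism from the sheaf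
of logarithmic forms to a direct image. -/
lemma exists_pullbackHom
    (h : ∀ w, ∀ ω ∈ logStalk v E (π w), pullbackForm v π ω ∈ logStalk (π ≫ v) D w) :
    ∃ α : logForms v E ⟶ (Scheme.Modules.pushforward π).obj (logForms (π ≫ v) D),
      ∀ (U : V.Opens) (s : Γ(logForms v E, U)) (x : W) (hx : x ∈ π ⁻¹ᵁ U),
        sectionForm (adjApp α U s) ⟨x, hx⟩ = pullbackForm v π (sectionForm s ⟨π x, hx⟩) := by
  let g : ∀ U : V.Opens, LogSection v E U → LogSection (π ≫ v) D (π ⁻¹ᵁ U) := fun U s =>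
    ⟨fun x => pullbackForm v π (s.form ⟨π x.1, x.2⟩), fun x y => by rw [s.const],
      fun x => h _ _ (s.mem ⟨π x.1, x.2⟩)⟩
  obtain ⟨α, hα⟩ := exists_hom (M := logForms v E)
    (N := (Scheme.Modules.pushforward π).obj (logForms (π ≫ v) D)) g
    (fun U m m' => LogSection.ext (funext fun x => pullbackForm_add v π _ _))
    (fun U r m => LogSection.ext (f := π ≫ v) (D := D) (funext fun x => by
      refine (pullbackForm_smul v π _ _).trans ?_
      refine congrArg (· • pullbackForm v π _) ?_
      refine (functionFieldMap_algebraMap π x.1 _).trans ?_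
      exact congrArg _ (Scheme.Hom.germ_stalkMap_apply π U x.1 x.2 r)))
    (fun h m => rfl)
  exact ⟨α, fun U s x hx => congrArg (fun t => sectionForm (f := π ≫ v) (D := D) t ⟨x, hx⟩)
    (hα U s)⟩

/-- Pullback along a birational morphism preserves linear independence of rational forms. -/
lemma linearIndependent_pullbackForm (hbij : Function.Bijective (functionFieldMap π).hom)
    {ι : Type u} [Fintype ι] {e : ι → RationalForms v}
    (he : LinearIndependent V.functionField e) :
    LinearIndependent W.functionField fun i => pullbackForm v π (e i) := by
  refine Fintype.linearIndependent_iff.mpr fun g hg => ?_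
  choose g' hg' using fun i => hbij.2 (g i)
  have h1 : pullbackForm v π (∑ i, g' i • e i) = ∑ i, g i • pullbackForm v π (e i) := by
    refine (map_sum (pullbackFormHom v π) _ _).trans (Finset.sum_congr rfl fun i _ => ?_)
    rw [← hg']
    exact pullbackForm_smul v π _ _
  have h2 : ∑ i, g' i • e i = 0 := by
    apply pullbackForm_injective v π hbij
    rw [h1, hg]
    exact (map_zero (pullbackFormHom v π)).symm
  intro i
  rw [← hg', Fintype.linearIndependent_iff.mp he g' h2 i, map_zero]

/-- If the pullback of rational forms along a birational morphism preserves logarithmic forms and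
the pullbacks generate the logarithmic forms of `W`, then it is an isomorphism from the pullback of
the sheaf of logarithmic forms. -/
theorem exists_pullback_iso [PerfectField k] [Smooth v] [Finite J]
    (hE : HasNormalCrossings E) (hbij : Function.Bijective (functionFieldMap π).hom)
    (h : ∀ w, logStalk (π ≫ v) D w =
      Submodule.span (localRing W w) (pullbackForm v π '' logStalk v E (π w))) :
    ∃ φ : (Scheme.Modules.pullback π).obj (logForms v E) ≅ logForms (π ≫ v) D,
      ∀ (U : V.Opens) (s : Γ(logForms v E, U)) (x : W) (hx : x ∈ π ⁻¹ᵁ U),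
        sectionForm ((((Scheme.Modules.pullbackPushforwardAdjunction π).homEquiv _ _ φ.hom).app U s :
            Γ(logForms (π ≫ v) D, π ⁻¹ᵁ U))) ⟨x, hx⟩ =
          pullbackForm v π (sectionForm s ⟨π x, hx⟩) := by
  obtain ⟨α, hα⟩ := exists_pullbackHom v (E := E) (D := D) (π := π) fun w ω hω => by
    rw [h]; exact Submodule.subset_span ⟨ω, hω, rfl⟩
  choose U ι hι e hU hli he using fun w => hE.exists_frame v (π w)
  let s : ∀ w, ι w → Γ(logForms v E, U w) := fun w i =>
    (⟨fun _ => e w i, fun _ _ => rfl, fun x => by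
      rw [he w x.1 x.2]; exact Submodule.subset_span ⟨i, rfl⟩⟩ : LogSection v E (U w))
  have hs : ∀ w i x, sectionForm (s w i) x = e w i := fun w i x => rfl
  have hsα : ∀ w i x, sectionForm (adjApp α (U w) (s w i)) x = pullbackForm v π (e w i) :=
    fun w i x => (hα _ _ _ x.2).trans (congrArg _ (hs w i _))
  have hframe : ∀ w, IsPullbackFrame α (U w) (s w) := fun w =>
    { exists_eq_comb := fun O hO m y hy =>
        exists_resM_eq_comb (hs w) (fun x hx => (he w x hx).le) hO m hy
      exists_eq_comb_adjApp := fun O hO l x hx => by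
        refine exists_resM_eq_comb (hsα w) (fun x hx => ?_) hO l hx
        rw [h, Submodule.span_le]
        rintro _ ⟨ω, hω, rfl⟩
        rw [SetLike.mem_coe, he w (π x) hx] at hω
        suffices hle : Submodule.span (localRing V (π x)) (Set.range (e w)) ≤
            comapPullbackForm v x (Submodule.span (localRing W x)
              (Set.range fun i => pullbackForm v π (e w i))) from hle hω
        rw [Submodule.span_le]
        rintro _ ⟨i, rfl⟩
        exact Submodule.subset_span ⟨i, rfl⟩
      eq_zero_of_comb := fun O hO g hg =>
        eq_zero_of_comb_eq_zero (linearIndependent_pullbackForm v hbij (hli w)) (hsα w) hO hg }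
  have hiso := isIso_homEquiv_symm hframe hU
  refine ⟨asIso (((Scheme.Modules.pullbackPushforwardAdjunction π).homEquiv _ _).symm α),
    fun O m x hx => ?_⟩
  rw [asIso_hom, Equiv.apply_symm_apply]
  exact hα O m x hx

end LogFormsPullback

end LogForms

theorem mainTheorem3 {k : Type u} [Field k] [PerfectField k]
    {V W : Scheme.{u}} (v : V ⟶ Spec (CommRingCat.of k))
    [IsIntegral V] [IsSeparated v] [QuasiCompact v] [Smooth v]
    {J : Type w} [Finite J] (E : J → V.IdealSheafData)
    (hE_irreducible : ∀ j, IsIntegral (E j).subscheme)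
    (hE : LogForms.HasNormalCrossings E)
    (S : Set J) (hS : S.Nonempty)
    (B : V.IdealSheafData) (hB : B = ⨆ j ∈ S, E j)
    (π : W ⟶ V) (hπ : LogForms.IsBlowup π B) :
    ∃ (_ : IsIntegral W) (_ : IsDominant π)
      (φ : (Scheme.Modules.pullback π).obj (LogForms.logForms v E) ≅
        LogForms.logForms (π ≫ v) (LogForms.totalFamily π B E)),
      ∀ (U : V.Opens) (s : Γ(LogForms.logForms v E, U)) (x : W) (hx : x ∈ π ⁻¹ᵁ U),
        LogForms.sectionForm
          ((((Scheme.Modules.pullbackPushforwardAdjunction π).homEquiv _ _ φ.hom).app U s :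
            Γ(LogForms.logForms (π ≫ v) (LogForms.totalFamily π B E), π ⁻¹ᵁ U))) ⟨x, hx⟩ =
          LogForms.pullbackForm v π (LogForms.sectionForm s ⟨π x, hx⟩) := by
  subst hB
  have hgen : genericPoint V ∉ (⨆ j ∈ S, E j).support := by
    obtain ⟨s, hs⟩ := hS
    exact fun h => hE.genericPoint_notMem s
      (Scheme.IdealSheafData.support_antitone (le_iSup₂ (f := fun j (_ : j ∈ S) => E j) s hs) h)
  obtain ⟨hW, hdom⟩ := hπ.isIntegral_and_isDominant hgen
  have hnoeth : IsLocallyNoetherian V := LocallyOfFiniteType.isLocallyNoetherian v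
  exact ⟨hW, hdom, LogForms.exists_pullback_iso v hE (hπ.bijective_functionFieldMap hgen)
    fun w => hπ.logStalk_eq_span v hE w⟩
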